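/- Let $3\le D\le 7$, $n=11-D$, $r\ge 12-D$ and $m=D+r-11=r-n\ge 1$; all algebras are over $\mathbb R$. **Algebras.** Given an integer Cartan matrix $A$ and a set of odd nodes, take the Lie superalgebra generated by $e_i,f_i,h_i$ (with $e_i,f_i$ odd exactly for the odd nodes $i$, all $h_i$ even) subject to $[h_i,e_j]=A_{ij}e_j$, $[h_i,f_j]=-A_{ij}f_j$, $[\![e_i,f_j]\!]=\delta_{ij}h_j$, $[h_i,h_j]=0$, and divide out the maximal ideal (homogeneous for the root lattice grading) that intersects $\mathrm{span}\{h_i\}$ trivially. Let $E_r$ be the Kac–Moody algebra obtained in this way, without odd nodes, from the simply laced Dynkin diagram in which the nodes $1,\dots,r-1$ form a chain and the node $r$ is attached to the node $r-3$ (diagonal entries $2$); similarly $E_n$. Let $U_{n+1}$ be the Borcherds superalgebra whose diagram is that of $E_n$ with one additional odd node $0$ attached to the node $1$, with $A_{00}=0$. The subalgebra of $U_{n+1}$ generated by the $e_i,f_i$ with $i\neq0$ is a copy of $E_n$. In $E_r$ the nodes $m+1,\dots,r$ give a copy of $E_n$ and the nodes $1,\dots,m-1$ a copy of $\mathfrak{sl}_m$.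 **Levels.** Grade $U_{n+1}$ by the node $0$ and $E_r$ by the node $m$: the corresponding generator $e$ has level $-1$, $f$ has level $1$, and all other Chevalley generators have level $0$. Let $\langle\cdot|\cdot\rangle$ be the invariant bilinear form on either algebra with $\langle h_i|h_j\rangle=A_{ij}$, $\langle e_i|f_j\rangle=\delta_{ij}$, $\langle e_i|e_j\rangle=\langle f_i|f_j\rangle=0$; it is supersymmetric on $U_{n+1}$ and symmetric on $E_r$, and subspaces of levels $p,q$ with $p+q\ne0$ are orthogonal. Let $E_{\mathcal M}$ and $F^{\mathcal M}$ be dual bases of $(U_{n+1})_{-1}$ and $(U_{n+1})_{1}$, $\langle E_{\mathcal M}|F^{\mathcal N}\rangle=\delta_{\mathcal M}{}^{\mathcal N}$. **Claims.** The two forms exist. There are bases $E_{\mathcal M}{}^a$ of $(E_r)_{-1}$ and $F^{\mathcal M}{}_a$ of $(E_r)_{1}$ ($a=1,\dots,m$) such that $E_n$ acts on the index $\mathcal M$ as on $E_{\mathcal M}$ and $F^{\mathcal M}$, $\mathfrak{sl}_m$ acts on the upper (lower) index $a$ in the fundamental (dual) representation, and $\langle E_{\mathcal M}{}^a|F^{\mathcal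 N}{}_b\rangle=\delta_{\mathcal M}{}^{\mathcal N}\delta^a{}_b$. For every such choice, write $E_{\mathcal M_1\cdots\mathcal M_p}=[\![E_{\mathcal M_1},[\![E_{\mathcal M_2},\dots,[\![E_{\mathcal M_{p-1}},E_{\mathcal M_p}]\!]\cdots]\!]]\!]$, similarly $F^{\mathcal N_1\cdots\mathcal N_p}$, and similarly $E_{\mathcal M_1\cdots\mathcal M_p}{}^{a_1\cdots a_p}$ and $F^{\mathcal N_1\cdots\mathcal N_p}{}_{b_1\cdots b_p}$ in $E_r$; square brackets around indices denote antisymmetrization with total weight one. Then: 1. For all $p\ge1$, $$\big\langle E_{\mathcal M_1\cdots\mathcal M_p}{}^{[a_1\cdots a_p]}\,\big|\,F^{\mathcal N_1\cdots\mathcal N_p}{}_{b_1\cdots b_p}\big\rangle=(-1)^{p(p-1)/2}\,\delta^{[a_1\cdots a_p]}{}_{b_1\cdots b_p}\,\big\langle E_{\mathcal M_1\cdots\mathcal M_p}\,\big|\,F^{\mathcal N_1\cdots\mathcal N_p}\big\rangle,$$ where $\delta^{[a_1\cdots a_p]}{}_{b_1\cdots b_p}=\delta^{[a_1}{}_{b_1}\cdots\delta^{a_p]}{}_{b_p}$.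 2. Let $1\le p\le m=D+r-11$ and let $\mathbf s_p=(U_{n+1})_{-p}$ as a representation of $E_n$. For any distinct $a_1,\dots,a_p$ the span $\mathbf t_p$ of the elements $E_{\mathcal M_1\cdots\mathcal M_p}{}^{[a_1\cdots a_p]}$ (over all $\mathcal M_1,\dots,\mathcal M_p$) is a representation of $E_n$, and $E_{\mathcal M_1\cdots\mathcal M_p}\mapsto E_{\mathcal M_1\cdots\mathcal M_p}{}^{[a_1\cdots a_p]}$ defines an isomorphism $\mathbf s_p\cong\mathbf t_p$ of representations of $E_n$. Moreover $E_{\mathcal M_1\cdots\mathcal M_p}\otimes(\epsilon_{a_1}\wedge\dots\wedge \epsilon_{a_p})\mapsto E_{\mathcal M_1\cdots\mathcal M_p}{}^{[a_1\cdots a_p]}$, with $\epsilon_a$ the standard basis of $\mathbb R^m$, defines an $E_n$-equivariant isomorphism from $\mathbf s_p\otimes\Lambda^p\mathbb R^m$ onto the span of all the elements $E_{\mathcal M_1\cdots\mathcal M_p}{}^{[a_1\cdots a_p]}$, that is, the part of $(E_r)_{-p}$ that is antisymmetric in the $\mathfrak{sl}_m$ indices. In particular (for $r=11$, where $m=D$),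 $E_{11}$ reproduces the representations $\mathbf s_p$ for $1\le p\le D$. -/

import Mathlib

noncomputable section

namespace TensorHierarchy

open scoped TensorProduct

/-! ### Quotients of algebras by ideals

An algebra is a real vector space `V` with a bilinear product `br`. -/

/-- `I` is a two-sided ideal of the algebra `(V, br)`. -/
def IsIdeal {V : Type} [AddCommGroup V] [Module ℝ V] (br : V →ₗ[ℝ] V →ₗ[ℝ] V)
    (I : Submodule ℝ V) : Prop :=
  ∀ x : V, ∀ y ∈ I, br x y ∈ I ∧ br y x ∈ I

theorem isIdeal_sInf {V : Type} [AddCommGroup V] [Module ℝ V] (br : V →ₗ[ℝ] V →ₗ[ℝ] V)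
    (s : Set (Submodule ℝ V)) (hs : ∀ I ∈ s, IsIdeal br I) : IsIdeal br (sInf s) := by
  intro x y hy
  rw [Submodule.mem_sInf] at hy
  constructor <;> rw [Submodule.mem_sInf] <;> intro I hI
  · exact (hs I hI x y (hy I hI)).1
  · exact (hs I hI x y (hy I hI)).2

theorem isIdeal_sSup {V : Type} [AddCommGroup V] [Module ℝ V] (br : V →ₗ[ℝ] V →ₗ[ℝ] V)
    (s : Set (Submodule ℝ V)) (hs : ∀ I ∈ s, IsIdeal br I) : IsIdeal br (sSup s) := by
  intro x y hy
  have h1 : sSup s ≤ (sSup s).comap (br x) :=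
    sSup_le fun I hI z hz => (le_sSup hI : I ≤ sSup s) (hs I hI x z hz).1
  have h2 : sSup s ≤ (sSup s).comap (br.flip x) :=
    sSup_le fun I hI z hz => (le_sSup hI : I ≤ sSup s) (hs I hI x z hz).2
  exact ⟨h1 hy, h2 hy⟩

/-- The product induced on the quotient of an algebra by an ideal. -/
def quotBr {V : Type} [AddCommGroup V] [Module ℝ V] (br : V →ₗ[ℝ] V →ₗ[ℝ] V)
    (I : Submodule ℝ V) (hI : IsIdeal br I) : (V ⧸ I) →ₗ[ℝ] (V ⧸ I) →ₗ[ℝ] (V ⧸ I) :=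
  I.liftQ
    { toFun := fun x => I.mapQ I (br x) (fun y hy => (hI x y hy).1)
      map_add' := fun x y => by ext z; simp
      map_smul' := fun c x => by ext z; simp }
    (fun y hy => by
      rw [LinearMap.mem_ker]
      ext z
      simpa using (hI z y hy).2)

@[simp]
theorem quotBr_mk {V : Type} [AddCommGroup V] [Module ℝ V] (br : V →ₗ[ℝ] V →ₗ[ℝ] V)
    (I : Submodule ℝ V) (hI : IsIdeal br I) (x y : V) :
    quotBr br I hI (I.mkQ x) (I.mkQ y) = I.mkQ (br x y) := rfl

/-! ### The Lie superalgebra of a Cartan matrix -/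

/-- The Chevalley generators `e_i, f_i, h_i`. -/
inductive Gen (ι : Type) : Type
  | e : ι → Gen ι
  | f : ι → Gen ι
  | h : ι → Gen ι

variable {ι : Type}

/-- The degree of a generator in the root lattice `ℤ^ι`. -/
def Gen.weight [DecidableEq ι] : Gen ι → ι → ℤ
  | .e i => Pi.single i 1
  | .f i => -Pi.single i 1
  | .h _ => 0

/-- The parity of a generator: `e_i` and `f_i` are odd exactly for the nodes `i` with
`odd i = true`. -/
def Gen.parity (odd : ι → Bool) : Gen ι → Bool
  | .e i => odd i
  | .f i => odd i
  | .h _ => false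

/-- The degree in the root lattice of a bracket monomial in the generators. -/
def monWeight [DecidableEq ι] : FreeMagma (Gen ι) → ι → ℤ
  | .of x => x.weight
  | .mul u v => monWeight u + monWeight v

/-- The parity of a bracket monomial in the generators. -/
def monParity (odd : ι → Bool) : FreeMagma (Gen ι) → Bool
  | .of x => x.parity odd
  | .mul u v => xor (monParity odd u) (monParity odd v)

/-- The sign `(-1)^{st}`. -/
def koszul (s t : Bool) : ℝ := if s && t then -1 else 1

/-- The free non-associative algebra on the Chevalley generators. -/
abbrev FreeAlg (ι : Type) : Type := FreeNonUnitalNonAssocAlgebra ℝ (Gen ι)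

/-- A bracket monomial, as an element of the free algebra. -/
def mon (u : FreeMagma (Gen ι)) : FreeAlg ι := MonoidAlgebra.single u 1

theorem mon_mul (u v : FreeMagma (Gen ι)) : mon u * mon v = mon (u * v) := by
  simp [mon, MonoidAlgebra.single_mul_single]

theorem monParity_false (u : FreeMagma (Gen ι)) : monParity (fun _ => false) u = false := by
  induction u with
  | ih1 x => cases x <;> rfl
  | ih2 u v hu hv =>
    change xor (monParity _ u) (monParity _ v) = false
    rw [hu, hv]; rfl

/-- A generator, as an element of the free algebra. -/
def gen (x : Gen ι) : FreeAlg ι := mon (FreeMagma.of x)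

variable [DecidableEq ι]

/-- The defining relations of a Lie superalgebra (on monomials; they extend by linearity) and the
Chevalley relations. -/
inductive Rel (A : Matrix ι ι ℤ) (odd : ι → Bool) : FreeAlg ι → Prop
  | skew (u v : FreeMagma (Gen ι)) :
      Rel A odd (mon (u * v) + koszul (monParity odd u) (monParity odd v) • mon (v * u))
  | jacobi (u v w : FreeMagma (Gen ι)) :
      Rel A odd (mon (u * v * w) -
        (mon (u * (v * w)) - koszul (monParity odd u) (monParity odd v) • mon (v * (u * w))))
  | he (i j : ι) : Rel A odd (gen (.h i) * gen (.e j) - (A i j : ℝ) • gen (.e j))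
  | hf (i j : ι) : Rel A odd (gen (.h i) * gen (.f j) + (A i j : ℝ) • gen (.f j))
  | ef (i j : ι) : Rel A odd (gen (.e i) * gen (.f j) - if i = j then gen (.h j) else 0)
  | hh (i j : ι) : Rel A odd (gen (.h i) * gen (.h j))

/-- The ideal of the free algebra generated by the relations. -/
def relIdeal (A : Matrix ι ι ℤ) (odd : ι → Bool) : Submodule ℝ (FreeAlg ι) :=
  sInf {I | IsIdeal (LinearMap.mul ℝ (FreeAlg ι)) I ∧ ∀ x, Rel A odd x → x ∈ I}

theorem relIdeal_isIdeal (A : Matrix ι ι ℤ) (odd : ι → Bool) :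
    IsIdeal (LinearMap.mul ℝ (FreeAlg ι)) (relIdeal A odd) :=
  isIdeal_sInf _ _ fun _ hI => hI.1

/-- The Lie superalgebra generated by `e_i, f_i, h_i` modulo the Chevalley relations. -/
abbrev Tilde (A : Matrix ι ι ℤ) (odd : ι → Bool) : Type := FreeAlg ι ⧸ relIdeal A odd

/-- The superbracket of `Tilde A odd`. -/
def tildeBr (A : Matrix ι ι ℤ) (odd : ι → Bool) :
    Tilde A odd →ₗ[ℝ] Tilde A odd →ₗ[ℝ] Tilde A odd :=
  quotBr (LinearMap.mul ℝ (FreeAlg ι)) (relIdeal A odd) (relIdeal_isIdeal A odd)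

/-- The Cartan subalgebra, spanned by the `h_i`. -/
def tildeCartan (A : Matrix ι ι ℤ) (odd : ι → Bool) : Submodule ℝ (Tilde A odd) :=
  Submodule.span ℝ (Set.range fun i => (relIdeal A odd).mkQ (gen (.h i)))

/-- The homogeneous component of degree `α` in the root lattice grading. -/
def tildeWeight (A : Matrix ι ι ℤ) (odd : ι → Bool) (α : ι → ℤ) : Submodule ℝ (Tilde A odd) :=
  Submodule.span ℝ {x | ∃ u, monWeight u = α ∧ x = (relIdeal A odd).mkQ (mon u)}

/-- The maximal one among the ideals (homogeneous for the root lattice grading) that intersect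
the Cartan subalgebra trivially. If the Cartan matrix is nonsingular, then every ideal is
homogeneous, because the degrees are separated by the eigenvalues of the `h_i`. -/
def maxIdeal (A : Matrix ι ι ℤ) (odd : ι → Bool) : Submodule ℝ (Tilde A odd) :=
  sSup {I | IsIdeal (tildeBr A odd) I ∧ I ≤ ⨆ α, I ⊓ tildeWeight A odd α ∧
    I ⊓ tildeCartan A odd = ⊥}

theorem maxIdeal_isIdeal (A : Matrix ι ι ℤ) (odd : ι → Bool) :
    IsIdeal (tildeBr A odd) (maxIdeal A odd) :=
  isIdeal_sSup _ _ fun _ hI => hI.1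

/-- The Borcherds (Kac-Moody) superalgebra with Cartan matrix `A` and odd nodes given by `odd`. -/
abbrev Borcherds (A : Matrix ι ι ℤ) (odd : ι → Bool) : Type := Tilde A odd ⧸ maxIdeal A odd

section Borcherds

variable (A : Matrix ι ι ℤ) (odd : ι → Bool)

/-- The superbracket. -/
def superBr : Borcherds A odd →ₗ[ℝ] Borcherds A odd →ₗ[ℝ] Borcherds A odd :=
  quotBr (tildeBr A odd) (maxIdeal A odd) (maxIdeal_isIdeal A odd)

instance : Bracket (Borcherds A odd) (Borcherds A odd) := ⟨fun x y => superBr A odd x y⟩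

/-- The image in the superalgebra of an element of the free algebra. -/
def proj : FreeAlg ι →ₗ[ℝ] Borcherds A odd := (maxIdeal A odd).mkQ ∘ₗ (relIdeal A odd).mkQ

/-- The generator `e_i`. -/
def gE (i : ι) : Borcherds A odd := proj A odd (gen (.e i))
/-- The generator `f_i`. -/
def gF (i : ι) : Borcherds A odd := proj A odd (gen (.f i))
/-- The generator `h_i`. -/
def gH (i : ι) : Borcherds A odd := proj A odd (gen (.h i))

/-- The subspace of even (`s = false`) or odd (`s = true`) elements. -/
def parityPart (s : Bool) : Submodule ℝ (Borcherds A odd) :=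
  Submodule.span ℝ {x | ∃ u, monParity odd u = s ∧ x = proj A odd (mon u)}

/-- The subspace at level `p` in the `ℤ`-grading associated to the node `j`: the generator `e_j`
has level `-1`, the generator `f_j` has level `1` and all the others have level `0`. -/
def level (j : ι) (p : ℤ) : Submodule ℝ (Borcherds A odd) :=
  Submodule.span ℝ {x | ∃ u, monWeight u j = -p ∧ x = proj A odd (mon u)}

/-- `B` is the invariant bilinear form of the algebra, graded by the level associated to the
node `j`. -/
structure IsStandardForm (j : ι) (B : Borcherds A odd →ₗ[ℝ] Borcherds A odd →ₗ[ℝ] ℝ) :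
    Prop where
  hh : ∀ i k, B (gH A odd i) (gH A odd k) = A i k
  ef : ∀ i k, B (gE A odd i) (gF A odd k) = if i = k then 1 else 0
  ee : ∀ i k, B (gE A odd i) (gE A odd k) = 0
  ff : ∀ i k, B (gF A odd i) (gF A odd k) = 0
  invariant : ∀ x y z, B ⁅x, y⁆ z = B x ⁅y, z⁆
  supersymm : ∀ s t, ∀ x ∈ parityPart A odd s, ∀ y ∈ parityPart A odd t,
    B x y = koszul s t * B y x
  graded : ∀ p q : ℤ, p + q ≠ 0 → ∀ x ∈ level A odd j p, ∀ y ∈ level A odd j q, B x y = 0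

variable {A odd}

theorem bracket_def (x y : Borcherds A odd) : ⁅x, y⁆ = superBr A odd x y := rfl

theorem proj_bracket (a b : FreeAlg ι) :
    ⁅proj A odd a, proj A odd b⁆ = proj A odd (a * b) := rfl

theorem proj_rel {a : FreeAlg ι} (h : Rel A odd a) : proj A odd a = 0 := by
  have : a ∈ relIdeal A odd := Submodule.mem_sInf.2 fun I hI => hI.2 a h
  simp only [proj, LinearMap.comp_apply]
  rw [show (relIdeal A odd).mkQ a = 0 from (Submodule.Quotient.mk_eq_zero _).2 this, map_zero]

theorem proj_mon_bracket (u v : FreeMagma (Gen ι)) :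
    ⁅proj A odd (mon u), proj A odd (mon v)⁆ = proj A odd (mon (u * v)) := by
  rw [proj_bracket, mon_mul]

theorem proj_surjective : Function.Surjective (proj A odd) :=
  (Submodule.mkQ_surjective _).comp (Submodule.mkQ_surjective _)

/-- The superalgebra is spanned by the bracket monomials in the generators. -/
theorem span_mon : Submodule.span ℝ (Set.range fun u => proj A odd (mon u)) = ⊤ := by
  rw [eq_top_iff]
  rintro x -
  obtain ⟨a, rfl⟩ := proj_surjective x
  induction a using MonoidAlgebra.induction_linear with
  | zero => simp
  | add a b ha hb => rw [map_add]; exact add_mem ha hb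
  | single u c =>
    have : (MonoidAlgebra.single u c : FreeAlg ι) = c • mon u := by simp [mon]
    rw [this, map_smul]
    exact Submodule.smul_mem _ _ (Submodule.subset_span ⟨u, rfl⟩)

theorem level_bracket {j : ι} {p q : ℤ} {x y : Borcherds A odd} (hx : x ∈ level A odd j p)
    (hy : y ∈ level A odd j q) : ⁅x, y⁆ ∈ level A odd j (p + q) := by
  rw [bracket_def]
  have := Submodule.apply_mem_map₂ (superBr A odd) hx hy
  rw [level, level, Submodule.map₂_span_span] at this
  refine Submodule.span_mono ?_ this
  rintro _ ⟨_, ⟨u, hu, rfl⟩, _, ⟨v, hv, rfl⟩, rfl⟩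
  refine ⟨u * v, ?_, proj_mon_bracket u v⟩
  change monWeight u j + monWeight v j = _
  rw [hu, hv]
  ring

end Borcherds

/-! ### Kac-Moody algebras: the case without odd nodes -/

/-- The Kac-Moody algebra with Cartan matrix `A`. -/
abbrev KacMoody (A : Matrix ι ι ℤ) : Type := Borcherds A (fun _ => false)

theorem kacMoody_skew (A : Matrix ι ι ℤ) (x y : KacMoody A) : ⁅x, y⁆ + ⁅y, x⁆ = 0 := by
  have key : superBr A (fun _ => false) + (superBr A (fun _ => false)).flip = 0 := by
    refine LinearMap.ext_on_range span_mon fun u => LinearMap.ext_on_range span_mon fun v => ?_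
    have := proj_rel (Rel.skew (A := A) (odd := fun _ => false) u v)
    simpa [monParity_false, koszul, ← proj_mon_bracket, bracket_def] using this
  exact LinearMap.congr_fun (LinearMap.congr_fun key x) y

theorem kacMoody_jacobi (A : Matrix ι ι ℤ) (x y z : KacMoody A) :
    ⁅x, ⁅y, z⁆⁆ = ⁅⁅x, y⁆, z⁆ + ⁅y, ⁅x, z⁆⁆ := by
  let b := superBr A (fun _ => false)
  have hx : x ∈ Submodule.span ℝ (Set.range fun u => proj A (fun _ => false) (mon u)) := by
    rw [span_mon]; trivial
  have hy : y ∈ Submodule.span ℝ (Set.range fun u => proj A (fun _ => false) (mon u)) := by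
    rw [span_mon]; trivial
  suffices h : (b x) ∘ₗ (b y) = b (b x y) + (b y) ∘ₗ (b x) from LinearMap.congr_fun h z
  induction hx using Submodule.span_induction with
  | zero => simp
  | add x₁ x₂ _ _ h₁ h₂ =>
    simp only [map_add, LinearMap.add_apply, LinearMap.add_comp, LinearMap.comp_add, h₁, h₂]
    abel
  | smul c x₁ _ h₁ =>
    simp only [map_smul, LinearMap.smul_apply, LinearMap.smul_comp, LinearMap.comp_smul, h₁,
      smul_add]
  | mem x hx =>
    obtain ⟨u, rfl⟩ := hx
    induction hy using Submodule.span_induction with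
    | zero => simp
    | add y₁ y₂ _ _ h₁ h₂ =>
      simp only [map_add, LinearMap.add_comp, LinearMap.comp_add, h₁, h₂]
      abel
    | smul c y₁ _ h₁ =>
      simp only [map_smul, LinearMap.smul_comp, LinearMap.comp_smul, h₁, smul_add]
    | mem y hy =>
      obtain ⟨v, rfl⟩ := hy
      refine LinearMap.ext_on_range span_mon fun w => ?_
      have h := proj_rel (Rel.jacobi (A := A) (odd := fun _ => false) u v w)
      simp only [monParity_false, koszul, map_sub, ← proj_mon_bracket, bracket_def,
        Bool.and_self, Bool.false_eq_true, if_false, one_smul] at h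
      simp only [LinearMap.comp_apply, LinearMap.add_apply, b]
      rw [sub_eq_zero.1 h]
      exact (sub_add_cancel _ _).symm

/-- A Kac-Moody algebra is a Lie algebra. -/
instance (A : Matrix ι ι ℤ) : LieRing (KacMoody A) where
  add_lie x y z := by simp [bracket_def]
  lie_add x y z := by simp [bracket_def]
  lie_self x := by
    have h := kacMoody_skew A x x
    rw [← two_smul ℝ] at h
    exact (smul_eq_zero.1 h).resolve_left two_ne_zero
  leibniz_lie := kacMoody_jacobi A

instance (A : Matrix ι ι ℤ) : LieAlgebra ℝ (KacMoody A) where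
  lie_smul c x y := by simp [bracket_def]

/-! ### The algebras `E_r` and `U_{n+1}` -/

/-- The Cartan matrix of `E_r`. The nodes `1, …, r - 1` form a chain and the node `r` is attached
to the node `r - 3`; here the node `k` is the element `k - 1` of `Fin r`. -/
def cartanE (r : ℕ) : Matrix (Fin r) (Fin r) ℤ := fun i j =>
  if i = j then 2
  else if (i.val + 1 = j.val ∧ j.val + 1 < r) ∨ (j.val + 1 = i.val ∧ i.val + 1 < r) ∨
      (i.val + 4 = r ∧ j.val + 1 = r) ∨ (j.val + 4 = r ∧ i.val + 1 = r) then -1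
  else 0

/-- The Cartan matrix of `U_{n+1}`: a black node `none`, with diagonal entry `0`, is attached to
the first node of the Dynkin diagram of `E_n`. -/
def cartanU (n : ℕ) : Matrix (Option (Fin n)) (Option (Fin n)) ℤ
  | none, none => 0
  | none, some i => if i.val = 0 then -1 else 0
  | some i, none => if i.val = 0 then -1 else 0
  | some i, some j => cartanE n i j

/-- The Kac-Moody algebra `E_r` (split real form). -/
abbrev E (r : ℕ) : Type := KacMoody (cartanE r)

/-- The Borcherds superalgebra `U_{n+1}`; only the generators `e_0, f_0` of the black node are
odd. -/
abbrev U (n : ℕ) : Type := Borcherds (cartanU n) Option.isNone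

/-- The level `p` subspace of `U_{n+1}` in the grading associated to the black node. -/
abbrev levelU (n : ℕ) (p : ℤ) : Submodule ℝ (U n) := level (cartanU n) Option.isNone none p

section LevelDecomposition

variable {n m r : ℕ}

/-- The `i`-th node of the subdiagram `E_n` of the diagram of `E_r`, `r = m + n`. -/
def nodeE (hr : m + n = r) (i : Fin n) : Fin r := ⟨m + i, by omega⟩

/-- The first `m` nodes of the diagram of `E_r`. The last one of them, the node `m`, defines the
level, and the others form the diagram of `sl_m`. -/
def nodeSl (hr : m + n = r) (i : Fin m) : Fin r := ⟨i, by omega⟩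

/-- The node `m = r - n` of `E_r`, which defines the level. -/
def nodeL (hm : 1 ≤ m) (hr : m + n = r) : Fin r := nodeSl hr ⟨m - 1, by omega⟩

/-- The level `p` subspace of `E_r` in the grading associated to the node `m = r - n`. -/
abbrev levelE (hm : 1 ≤ m) (hr : m + n = r) (p : ℤ) : Submodule ℝ (E r) :=
  level (cartanE r) (fun _ => false) (nodeL hm hr) p

/-- The level decompositions of `U_{n+1}` with respect to `E_n` and of `E_r` with respect to
`E_n ⊕ sl_m`, `m = r - n`, together with the standard bilinear forms and the identification of the
level `±1` subspaces of `E_r` with the tensor products of those of `U_{n+1}` with the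
(anti)fundamental representation of `sl_m`. For `x = E_M` in `(U_{n+1})_{-1}` the element `xE a x`
is `E_M^a`, and for `y = F^M` in `(U_{n+1})_1` the element `xF a y` is `F^M_a`. -/
structure LevelDecomposition (hm : 1 ≤ m) (hr : m + n = r) where
  /-- The invariant form of `U_{n+1}`. -/
  formU : U n →ₗ[ℝ] U n →ₗ[ℝ] ℝ
  formU_standard : IsStandardForm (cartanU n) Option.isNone none formU
  /-- The invariant form of `E_r`. -/
  formE : E r →ₗ[ℝ] E r →ₗ[ℝ] ℝ
  formE_standard : IsStandardForm (cartanE r) (fun _ => false) (nodeL hm hr) formE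
  /-- The embedding of `E_n` into `U_{n+1}`. -/
  enU : E n →ₗ[ℝ] U n
  enU_lie : ∀ z w : E n, enU ⁅z, w⁆ = ⁅enU z, enU w⁆
  enU_e : ∀ i, enU (gE _ _ i) = gE _ _ (some i)
  enU_f : ∀ i, enU (gF _ _ i) = gF _ _ (some i)
  enU_mem : ∀ z, enU z ∈ levelU n 0
  /-- The embedding of `E_n` into `E_r`. -/
  enE : E n →ₗ⁅ℝ⁆ E r
  enE_e : ∀ i, enE (gE _ _ i) = gE _ _ (nodeE hr i)
  enE_f : ∀ i, enE (gF _ _ i) = gF _ _ (nodeE hr i)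
  /-- The element `E_M^a` for `x = E_M`. -/
  xE : Fin m → levelU n (-1) →ₗ[ℝ] E r
  /-- The element `F^M_a` for `y = F^M`. -/
  xF : Fin m → levelU n 1 →ₗ[ℝ] E r
  /-- If `x` runs through a basis of `(U_{n+1})_{-1}`, then the elements `xE a x` form a basis of
  `(E_r)_{-1}`, and similarly for `xF`. -/
  xE_injective : Function.Injective fun x : Fin m → levelU n (-1) => ∑ a, xE a (x a)
  xE_range : Set.range (fun x : Fin m → levelU n (-1) => ∑ a, xE a (x a)) = levelE hm hr (-1)
  xF_injective : Function.Injective fun y : Fin m → levelU n 1 => ∑ a, xF a (y a)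
  xF_range : Set.range (fun y : Fin m → levelU n 1 => ∑ a, xF a (y a)) = levelE hm hr 1
  /-- Equivariance under `E_n`. -/
  xE_equivariant : ∀ (z : E n) (a : Fin m) (x x' : levelU n (-1)),
    (x' : U n) = ⁅enU z, (x : U n)⁆ → xE a x' = ⁅enE z, xE a x⁆
  xF_equivariant : ∀ (z : E n) (a : Fin m) (y y' : levelU n 1),
    (y' : U n) = ⁅enU z, (y : U n)⁆ → xF a y' = ⁅enE z, xF a y⁆
  /-- The Chevalley generators `e_i` and `f_i` of `sl_m` act on the index `a` as the matrix units
  with the entry `1` at `(i, i + 1)` and `(i + 1, i)`, respectively: in the fundamental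
  representation for the upper index, in the dual one for the lower index. -/
  xE_sl_e : ∀ i j : Fin m, i.val + 1 = j.val → ∀ a x,
    ⁅(gE _ _ (nodeSl hr i) : E r), xE a x⁆ = if a = j then xE i x else 0
  xE_sl_f : ∀ i j : Fin m, i.val + 1 = j.val → ∀ a x,
    ⁅(gF _ _ (nodeSl hr i) : E r), xE a x⁆ = if a = i then xE j x else 0
  xF_sl_e : ∀ i j : Fin m, i.val + 1 = j.val → ∀ a y,
    ⁅(gE _ _ (nodeSl hr i) : E r), xF a y⁆ = if a = i then -xF j y else 0
  xF_sl_f : ∀ i j : Fin m, i.val + 1 = j.val → ∀ a y,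
    ⁅(gF _ _ (nodeSl hr i) : E r), xF a y⁆ = if a = j then -xF i y else 0
  /-- Normalization: `⟨E_M | F^N⟩ = δ_M^N` implies `⟨E_M^a | F^N_b⟩ = δ_M^N δ^a_b`. -/
  dual : ∀ (a b : Fin m) (x : levelU n (-1)) (y : levelU n 1),
    formE (xE a x) (xF b y) = if a = b then formU x y else 0

end LevelDecomposition

/-- The nested bracket `⁅x_1, ⁅x_2, …, ⁅x_{p-1}, x_p⁆ … ⁆⁆`. -/
def nest {L : Type} [Zero L] [Bracket L L] : (p : ℕ) → (Fin p → L) → L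
  | 0, _ => 0
  | 1, x => x 0
  | p + 2, x => ⁅x 0, nest (p + 1) fun i => x i.succ⁆

theorem nest_mem_level (A : Matrix ι ι ℤ) (odd : ι → Bool) (j : ι) (q : ℤ) (p : ℕ)
    (x : Fin p → Borcherds A odd) (hx : ∀ i, x i ∈ level A odd j q) :
    nest p x ∈ level A odd j (p * q) := by
  induction p with
  | zero => exact zero_mem _
  | succ p ih =>
    cases p with
    | zero => simpa [nest] using hx 0
    | succ p =>
      have := level_bracket (hx 0) (ih (fun i => x i.succ) fun i => hx i.succ)
      have e : q + ((p + 1 : ℕ) : ℤ) * q = ((p + 1 + 1 : ℕ) : ℤ) * q := by push_cast; ring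
      rw [e] at this
      exact this

/-- The element `E_{M_1 ⋯ M_p}` of `(U_{n+1})_{-p}`, for `x_i = E_{M_i}`. -/
def nestU {n p : ℕ} (x : Fin p → levelU n (-1)) : levelU n (-p) :=
  ⟨nest p fun i => (x i : U n), by
    simpa using nest_mem_level _ _ _ (-1) p (fun i => (x i : U n)) fun i => (x i).2⟩

/-- The generalized Kronecker delta `δ^{[a_1 ⋯ a_p]}_{b_1 ⋯ b_p}`, antisymmetrized with total
weight one. -/
def antisymDelta {m p : ℕ} (a b : Fin p → Fin m) : ℝ :=
  (p.factorial : ℝ)⁻¹ * ∑ σ : Equiv.Perm (Fin p),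
    ((Equiv.Perm.sign σ : ℤ) : ℝ) * ∏ i, if a (σ i) = b i then (1 : ℝ) else 0

namespace LevelDecomposition

variable {n m r : ℕ} {hm : 1 ≤ m} {hr : m + n = r} (d : LevelDecomposition hm hr)

/-- The inner product `f_{M_1 ⋯ M_p}^{N_1 ⋯ N_p}` in `U_{n+1}`, for `x_i = E_{M_i}` and
`y_i = F^{N_i}`. -/
def fTensor {p : ℕ} (x : Fin p → levelU n (-1)) (y : Fin p → levelU n 1) : ℝ :=
  d.formU (nest p fun i => (x i : U n)) (nest p fun i => (y i : U n))

/-- The inner product of `E_{M_1 ⋯ M_p}^{a_1 ⋯ a_p}` and `F^{N_1 ⋯ N_p}_{b_1 ⋯ b_p}` in `E_r`, for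
`x_i = E_{M_i}` and `y_i = F^{N_i}`. -/
def hTensor {p : ℕ} (x : Fin p → levelU n (-1)) (a : Fin p → Fin m)
    (y : Fin p → levelU n 1) (b : Fin p → Fin m) : ℝ :=
  d.formE (nest p fun i => d.xE (a i) (x i)) (nest p fun i => d.xF (b i) (y i))

/-- The element `E_{M_1 ⋯ M_p}^{[a_1 ⋯ a_p]}` of `(E_r)_{-p}`, for `x_i = E_{M_i}`,
antisymmetrized with total weight one. -/
def antisymE {p : ℕ} (x : Fin p → levelU n (-1)) (a : Fin p → Fin m) : E r :=
  (p.factorial : ℝ)⁻¹ • ∑ σ : Equiv.Perm (Fin p),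
    ((Equiv.Perm.sign σ : ℤ) : ℝ) • nest p fun i => d.xE (a (σ i)) (x i)

/-- The action of `E_n` on `s_p = (U_{n+1})_{-p}`. -/
def actS (p : ℕ) (z : E n) : levelU n (-p) →ₗ[ℝ] levelU n (-p) :=
  (superBr (cartanU n) Option.isNone (d.enU z)).restrict fun x hx => by
    simpa using! level_bracket (d.enU_mem z) hx

/-- The part of `(E_r)_{-p}` that is antisymmetric in the `sl_m` indices. -/
def antisymPart (p : ℕ) : Submodule ℝ (E r) :=
  Submodule.span ℝ {w | ∃ (x : Fin p → levelU n (-1)) (a : Fin p → Fin m), w = d.antisymE x a}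

/-- The representation `t_p` of `E_n`, spanned by the components `E_{M_1 ⋯ M_p}^{[a_1 ⋯ a_p]}` of
the antisymmetric part with a fixed choice of (distinct) `sl_m` indices `a_1, …, a_p`. -/
def tRep {p : ℕ} (a : Fin p → Fin m) : Submodule ℝ (E r) :=
  Submodule.span ℝ {w | ∃ x : Fin p → levelU n (-1), w = d.antisymE x a}

end LevelDecomposition

end TensorHierarchy

end

/-! Everything rests on invariant forms, constructed before the maximal ideal is divided out. For
elements x, y of opposite degrees α, −α the bracket has to be ⟨x|y⟩ t_α with t_α = Σ α_i h_i. The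
h_i are linearly independent, as Verma modules show, so summing their coefficients forces ⟨x|y⟩ to
be (ht α)⁻¹ times the coefficient sum of the bracket. This is taken as the definition (`tildeForm`),
with the Cartan matrix in degree 0, and invariance is proved by induction on the height (`invAt`).
In nonzero degrees the radical is exactly the maximal ideal, so the form descends to the quotient
and is nondegenerate between opposite nonzero levels (`eq_zero_of_borcherdsForm`).

Existence of the bases: the levels −1 and 1 of a node form a lowest and a highest weight module of
the diagram without that node, with a nondegenerate contravariant pairing. Such a pair is determined
by its Cartan matrix and weight (`DualPair.exists_equiv`). Removing the node m from E_r leaves a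
chain and E_n, and the node m meets E_n where the node 0 does in U_{n+1}. Hence the pair of E_r is
that of U_{n+1} tensored with the fundamental representation of sl_m and its dual.

Claim 1: equivariance reduces all triple brackets to the one relation ⁅e_m, f_m⁆ = h_m and gives
(`LevelDecomposition.good`) ⁅⁅E_M^a, F^N_b⁆, E_P^c⁆ = δ^a_b (⁅⁅E_M, F^N⁆, E_P⁆ + ⟨E_M|F^N⟩ E_P)^c +
δ^c_b ⟨E_M|F^N⟩ E_P^a. When this derivation acts on a nested bracket contracted with an
antisymmetric tensor, the last term exchanges two indices, changes sign and cancels the middle term,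
so only the bracket of U_{n+1} remains. The signs by which the super Jacobi identity differs from
the ordinary one are supplied by antisymmetry. Bracketing with F^N_b thus lowers p by one, sets the
first index to b and costs (−1)^(p−1) (`exists_pair_lower`); iterating with invariance of the forms
gives the sign (−1)^(p(p−1)/2) (`formE_antisymm`).

Claim 2: by claim 1, a linear relation between nested brackets of U_{n+1} still holds after
antisymmetrization in E_r, because the result is orthogonal to the opposite level. So X ⊗ w ↦ X^w is
well defined. Its pairings are products of a component of w and a pairing of X, so nondegeneracy on
U_{n+1} makes it injective. It is equivariant because E_n acts on both kinds of nested brackets by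
derivations. -/

noncomputable section
namespace TensorHierarchy
open scoped TensorProduct

/-! ### The root lattice grading of the free algebra -/

section FreeGrading

variable {ι : Type}

/-- The linear map on the free algebra with prescribed values on the monomials. -/
def liftMon {Y : Type*} [AddCommGroup Y] [Module ℝ Y] (F : FreeMagma (Gen ι) → Y) :
    FreeAlg ι →ₗ[ℝ] Y :=
  Finsupp.linearCombination ℝ F ∘ₗ (MonoidAlgebra.coeffLinearEquiv ℝ).toLinearMap

@[simp]
theorem liftMon_mon {Y : Type*} [AddCommGroup Y] [Module ℝ Y] (F : FreeMagma (Gen ι) → Y)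
    (u : FreeMagma (Gen ι)) : liftMon F (mon u) = F u := by
  simp [liftMon, mon, MonoidAlgebra.coeffLinearEquiv]

theorem free_span_mon : Submodule.span ℝ (Set.range (mon : FreeMagma (Gen ι) → FreeAlg ι)) = ⊤ := by
  rw [eq_top_iff]
  rintro a -
  induction a using MonoidAlgebra.induction_linear with
  | zero => simp
  | add a b ha hb => exact add_mem ha hb
  | single u c =>
    have : (MonoidAlgebra.single u c : FreeAlg ι) = c • mon u := by simp [mon]
    rw [this]
    exact Submodule.smul_mem _ _ (Submodule.subset_span ⟨u, rfl⟩)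

theorem free_induction {p : FreeAlg ι → Prop} (a : FreeAlg ι) (h0 : p 0)
    (hadd : ∀ a b, p a → p b → p (a + b)) (hsmul : ∀ (c : ℝ) a, p a → p (c • a))
    (hmon : ∀ u, p (mon u)) : p a := by
  have ha : a ∈ Submodule.span ℝ (Set.range (mon : FreeMagma (Gen ι) → FreeAlg ι)) := by
    rw [free_span_mon]; trivial
  induction ha using Submodule.span_induction with
  | zero => exact h0
  | add x y _ _ hx hy => exact hadd _ _ hx hy
  | smul c x _ hx => exact hsmul _ _ hx
  | mem x hx => obtain ⟨u, rfl⟩ := hx; exact hmon u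

theorem free_hom_ext {Y : Type*} [AddCommGroup Y] [Module ℝ Y] {f g : FreeAlg ι →ₗ[ℝ] Y}
    (h : ∀ u, f (mon u) = g (mon u)) : f = g :=
  LinearMap.ext_on_range free_span_mon h

variable [DecidableEq ι]

/-- The span of the monomials of degree `α`. -/
def freeWeight (α : ι → ℤ) : Submodule ℝ (FreeAlg ι) :=
  Submodule.span ℝ {x | ∃ u, monWeight u = α ∧ x = mon u}

theorem mon_mem_freeWeight (u : FreeMagma (Gen ι)) : mon u ∈ freeWeight (monWeight u) :=
  Submodule.subset_span ⟨u, rfl, rfl⟩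

theorem mon_mem_freeWeight' {u : FreeMagma (Gen ι)} {α : ι → ℤ} (h : monWeight u = α) :
    mon u ∈ freeWeight α := h ▸ mon_mem_freeWeight u

/-- The operator multiplying monomials of degree `α` by `c α`. -/
def freeDiag (c : (ι → ℤ) → ℝ) : FreeAlg ι →ₗ[ℝ] FreeAlg ι :=
  liftMon fun u => c (monWeight u) • mon u

@[simp]
theorem freeDiag_mon (c : (ι → ℤ) → ℝ) (u : FreeMagma (Gen ι)) :
    freeDiag c (mon u) = c (monWeight u) • mon u := liftMon_mon _ _

theorem monWeight_mul (u v : FreeMagma (Gen ι)) :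
    monWeight (u * v) = monWeight u + monWeight v := rfl

theorem freeDiag_of_mem {c : (ι → ℤ) → ℝ} {α : ι → ℤ} {x : FreeAlg ι} (hx : x ∈ freeWeight α) :
    freeDiag c x = c α • x := by
  induction hx using Submodule.span_induction with
  | zero => simp
  | add x y _ _ hx hy => rw [map_add, hx, hy, smul_add]
  | smul r x _ hx => rw [map_smul, hx, smul_comm]
  | mem x hx => obtain ⟨u, rfl, rfl⟩ := hx; simp

theorem freeDiag_one (a : FreeAlg ι) : freeDiag (fun _ => 1) a = a := by
  have : freeDiag (fun _ => 1) = (LinearMap.id : FreeAlg ι →ₗ[ℝ] FreeAlg ι) :=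
    free_hom_ext fun u => by simp
  rw [this, LinearMap.id_apply]

variable [Fintype ι]

/-- The indicator function of the degree `α`. -/
def ind (α : ι → ℤ) : (ι → ℤ) → ℝ := fun β => if β = α then 1 else 0

theorem freeDiag_ind_mem (α : ι → ℤ) (x : FreeAlg ι) : freeDiag (ind α) x ∈ freeWeight α := by
  induction x using free_induction with
  | h0 => simp
  | hadd a b ha hb => rw [map_add]; exact add_mem ha hb
  | hsmul c a ha => rw [map_smul]; exact Submodule.smul_mem _ _ ha
  | hmon u =>
    rw [freeDiag_mon, ind]
    split_ifs with h
    · rw [one_smul]; exact mon_mem_freeWeight' h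
    · rw [zero_smul]; exact zero_mem _

theorem freeDiag_mon_mul (α : ι → ℤ) (b : FreeMagma (Gen ι)) (y : FreeAlg ι) :
    freeDiag (ind α) (mon b * y) = mon b * freeDiag (ind (α - monWeight b)) y := by
  induction y using free_induction with
  | h0 => simp
  | hadd x y hx hy => rw [mul_add, map_add, hx, hy, map_add, mul_add]
  | hsmul c x hx => rw [mul_smul_comm, map_smul, hx, map_smul, mul_smul_comm]
  | hmon u =>
    rw [mon_mul, freeDiag_mon, freeDiag_mon, mul_smul_comm, mon_mul, monWeight_mul]
    congr 1
    simp [ind, eq_sub_iff_add_eq']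

theorem freeDiag_mul_mon (α : ι → ℤ) (b : FreeMagma (Gen ι)) (y : FreeAlg ι) :
    freeDiag (ind α) (y * mon b) = freeDiag (ind (α - monWeight b)) y * mon b := by
  induction y using free_induction with
  | h0 => simp
  | hadd x y hx hy => rw [add_mul, map_add, hx, hy, map_add, add_mul]
  | hsmul c x hx => rw [smul_mul_assoc, map_smul, hx, map_smul, smul_mul_assoc]
  | hmon u =>
    rw [mon_mul, freeDiag_mon, freeDiag_mon, smul_mul_assoc, mon_mul, monWeight_mul]
    congr 1
    simp [ind, eq_sub_iff_add_eq]

/-- An element involves only finitely many degrees. Allowing every `T'` containing `T` makes it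
possible to expand two summands over a common set. -/
theorem freeDiag_eq_sum (a : FreeAlg ι) : ∃ T : Finset (ι → ℤ), ∀ T', T ⊆ T' →
    ∀ c, freeDiag c a = ∑ α ∈ T', c α • freeDiag (ind α) a := by
  induction a using free_induction with
  | h0 => exact ⟨∅, by simp⟩
  | hadd a b ha hb =>
    obtain ⟨T, hT⟩ := ha
    obtain ⟨S, hS⟩ := hb
    refine ⟨T ∪ S, fun T' h c => ?_⟩
    simp only [map_add, smul_add, Finset.sum_add_distrib]
    exact congrArg₂ _ (hT T' (Finset.union_subset_left h) c)
      (hS T' (Finset.union_subset_right h) c)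
  | hsmul r a ha =>
    obtain ⟨T, hT⟩ := ha
    refine ⟨T, fun T' h c => ?_⟩
    simp only [map_smul, smul_comm _ r, ← Finset.smul_sum]
    exact congrArg _ (hT T' h c)
  | hmon u =>
    refine ⟨{monWeight u}, fun T' h c => ?_⟩
    rw [Finset.sum_eq_single (monWeight u)]
    · simp [ind]
    · intro α _ hα
      simp [ind, hα.symm]
    · intro h'
      exact absurd (h (Finset.mem_singleton_self _)) h'

/-- This is what makes `relIdeal` a graded ideal and gives `Tilde` its root lattice grading. -/
theorem rel_homogeneous {A : Matrix ι ι ℤ} {odd : ι → Bool} {x : FreeAlg ι} (h : Rel A odd x) :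
    ∃ α, x ∈ freeWeight α := by
  have hg : ∀ x y : Gen ι, gen x * gen y ∈ freeWeight (x.weight + y.weight) := fun x y => by
    have := mon_mem_freeWeight (FreeMagma.of x * FreeMagma.of y)
    rw [← mon_mul, monWeight_mul] at this
    exact this
  cases h with
  | skew u v =>
    refine ⟨monWeight u + monWeight v, add_mem (mon_mem_freeWeight' (monWeight_mul u v))
      (Submodule.smul_mem _ _ (mon_mem_freeWeight' ?_))⟩
    rw [monWeight_mul, add_comm]
  | jacobi u v w =>
    refine ⟨monWeight u + monWeight v + monWeight w, sub_mem (mon_mem_freeWeight' ?_) (sub_mem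
      (mon_mem_freeWeight' ?_) (Submodule.smul_mem _ _ (mon_mem_freeWeight' ?_)))⟩ <;>
    · simp only [monWeight_mul] <;> abel
  | he i j =>
    refine ⟨Pi.single j 1, sub_mem ?_ (Submodule.smul_mem _ _ (mon_mem_freeWeight' rfl))⟩
    simpa [Gen.weight] using hg (.h i) (.e j)
  | hf i j =>
    refine ⟨-Pi.single j 1, add_mem ?_ (Submodule.smul_mem _ _ (mon_mem_freeWeight' rfl))⟩
    simpa [Gen.weight] using hg (.h i) (.f j)
  | ef i j =>
    refine ⟨Pi.single i 1 - Pi.single j 1, sub_mem ?_ ?_⟩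
    · simpa [Gen.weight, sub_eq_add_neg] using hg (.e i) (.f j)
    · split_ifs with h
      · rw [h, sub_self]; exact mon_mem_freeWeight' rfl
      · exact zero_mem _
  | hh i j => exact ⟨0, by simpa [Gen.weight] using hg (.h i) (.h j)⟩

/-- A subspace containing the relations and closed under multiplication of its homogeneous elements
by monomials contains all homogeneous components of the elements of `relIdeal`. -/
theorem freeDiag_mem_of_mem_relIdeal {A : Matrix ι ι ℤ} {odd : ι → Bool}
    (K : Submodule ℝ (FreeAlg ι))
    (hK : ∀ b α, ∀ a ∈ freeWeight α, a ∈ K → mon b * a ∈ K ∧ a * mon b ∈ K)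
    (hrel : ∀ x, Rel A odd x → x ∈ K) {a : FreeAlg ι} (ha : a ∈ relIdeal A odd)
    (c : (ι → ℤ) → ℝ) : freeDiag c a ∈ K := by
  -- The elements all of whose homogeneous components lie in `K`. This is a two-sided ideal although
  -- `K` need not be one, since closure of `K` is only known on homogeneous elements.
  let S : Submodule ℝ (FreeAlg ι) := ⨅ α, K.comap (freeDiag (ind α))
  have hS : ∀ x, x ∈ S ↔ ∀ α, freeDiag (ind α) x ∈ K := fun x => by simp [S]
  have h1 : IsIdeal (LinearMap.mul ℝ (FreeAlg ι)) S := by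
    intro x y hy
    rw [hS] at hy
    induction x using free_induction with
    | h0 => simp
    | hadd a b ha hb =>
      simp only [LinearMap.mul_apply', add_mul, mul_add] at *
      exact ⟨add_mem ha.1 hb.1, add_mem ha.2 hb.2⟩
    | hsmul c a ha =>
      simp only [LinearMap.mul_apply', smul_mul_assoc, mul_smul_comm] at *
      exact ⟨S.smul_mem _ ha.1, S.smul_mem _ ha.2⟩
    | hmon b =>
      simp only [LinearMap.mul_apply']
      rw [hS, hS]
      constructor <;> intro α
      · rw [freeDiag_mon_mul]
        exact (hK b _ _ (freeDiag_ind_mem _ _) (hy _)).1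
      · rw [freeDiag_mul_mon]
        exact (hK b _ _ (freeDiag_ind_mem _ _) (hy _)).2
  have h2 : ∀ x, Rel A odd x → x ∈ S := by
    intro x hx
    obtain ⟨β, hβ⟩ := rel_homogeneous hx
    rw [hS]
    intro α
    rw [freeDiag_of_mem hβ]
    exact K.smul_mem _ (hrel x hx)
  have h3 := (hS a).1 (Submodule.mem_sInf.1 ha S ⟨h1, h2⟩)
  obtain ⟨T, hT⟩ := freeDiag_eq_sum a
  rw [hT T le_rfl]
  exact sum_mem fun α _ => K.smul_mem _ (h3 α)

theorem freeDiag_mem_relIdeal {A : Matrix ι ι ℤ} {odd : ι → Bool} {a : FreeAlg ι}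
    (ha : a ∈ relIdeal A odd) (c : (ι → ℤ) → ℝ) : freeDiag c a ∈ relIdeal A odd := by
  refine freeDiag_mem_of_mem_relIdeal (A := A) (odd := odd) _ (fun b α a _ ha => ?_)
    (fun x hx => Submodule.mem_sInf.2 fun I hI => hI.2 x hx) ha c
  exact relIdeal_isIdeal A odd (mon b) a ha

/-- The tool for defining maps on `Tilde`. Kernels of super representations are controlled through
sign rules that make sense only for homogeneous elements, hence the restricted closure condition. -/
theorem relIdeal_le {A : Matrix ι ι ℤ} {odd : ι → Bool} (K : Submodule ℝ (FreeAlg ι))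
    (hK : ∀ b α, ∀ a ∈ freeWeight α, a ∈ K → mon b * a ∈ K ∧ a * mon b ∈ K)
    (hrel : ∀ x, Rel A odd x → x ∈ K) : relIdeal A odd ≤ K := fun a ha => by
  simpa [freeDiag_one] using freeDiag_mem_of_mem_relIdeal K hK hrel ha (fun _ => 1)

end FreeGrading

/-! ### Parities and signs -/

section Parity

theorem koszul_comm (s t : Bool) : koszul s t = koszul t s := by cases s <;> cases t <;> rfl

@[simp]
theorem koszul_mul_self (s t : Bool) : koszul s t * koszul s t = 1 := by
  cases s <;> cases t <;> norm_num [koszul]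

@[simp]
theorem koszul_false_left (t : Bool) : koszul false t = 1 := by simp [koszul]

@[simp]
theorem koszul_false_right (t : Bool) : koszul t false = 1 := by simp [koszul]

theorem koszul_xor_right (s t t' : Bool) :
    koszul s (xor t t') = koszul s t * koszul s t' := by
  cases s <;> cases t <;> cases t' <;> norm_num [koszul]

theorem koszul_xor_left (s s' t : Bool) :
    koszul (xor s s') t = koszul s t * koszul s' t := by
  cases s <;> cases t <;> cases s' <;> norm_num [koszul]

variable {ι : Type} [Fintype ι]

/-- The parity of the elements of degree `α`. -/
def par (odd : ι → Bool) (α : ι → ℤ) : Bool := !decide (Even (∑ i, if odd i then α i else 0))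

theorem par_zero (odd : ι → Bool) : par odd 0 = false := by simp [par]

theorem par_add (odd : ι → Bool) (α β : ι → ℤ) :
    par odd (α + β) = xor (par odd α) (par odd β) := by
  have : (∑ i, if odd i then (α + β) i else 0) =
      (∑ i, if odd i then α i else 0) + ∑ i, if odd i then β i else 0 := by
    rw [← Finset.sum_add_distrib]
    exact Finset.sum_congr rfl fun i _ => by split_ifs <;> simp
  simp only [par, this, Int.even_add]
  by_cases h1 : Even (∑ i, if odd i then α i else 0) <;>
  by_cases h2 : Even (∑ i, if odd i then β i else 0) <;> simp [h1, h2]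

theorem par_neg (odd : ι → Bool) (α : ι → ℤ) : par odd (-α) = par odd α := by
  have : (∑ i, if odd i then (-α) i else 0) = -(∑ i, if odd i then α i else 0) := by
    rw [← Finset.sum_neg_distrib]
    exact Finset.sum_congr rfl fun i _ => by split_ifs <;> simp
  simp only [par, this, even_neg]

theorem par_sub (odd : ι → Bool) (α β : ι → ℤ) :
    par odd (α - β) = xor (par odd α) (par odd β) := by
  rw [sub_eq_add_neg, par_add, par_neg]

variable [DecidableEq ι]

theorem par_single (odd : ι → Bool) (i : ι) : par odd (Pi.single i 1) = odd i := by
  have : (∑ k, if odd k then (Pi.single i 1 : ι → ℤ) k else 0) = if odd i then 1 else 0 := by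
    rw [Finset.sum_eq_single i]
    · simp
    · intro b _ hb; simp [hb]
    · simp
  rw [par, this]
  cases odd i <;> simp

/-- Since parity depends on the degree alone, all Koszul signs in `Tilde` can be expressed through
`par` of root lattice degrees. -/
theorem monParity_eq (odd : ι → Bool) (u : FreeMagma (Gen ι)) :
    monParity odd u = par odd (monWeight u) := by
  induction u with
  | ih1 x =>
    cases x <;>
      simp [monParity, monWeight, Gen.parity, Gen.weight, par_single, par_neg, par_zero]
  | ih2 u v hu hv =>
    rw [monWeight_mul, par_add, ← hu, ← hv]; rfl

end Parity

end TensorHierarchy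
end

noncomputable section
set_option linter.unusedSectionVars false
namespace TensorHierarchy
open scoped TensorProduct

/-! ### The algebra `Tilde` -/

section Tilde

variable {ι : Type} [DecidableEq ι] (A : Matrix ι ι ℤ) (odd : ι → Bool)

/-- The image of a monomial in `Tilde A odd`. -/
def tm (u : FreeMagma (Gen ι)) : Tilde A odd := (relIdeal A odd).mkQ (mon u)

variable {A odd}

theorem tildeBr_tm (u v : FreeMagma (Gen ι)) :
    tildeBr A odd (tm A odd u) (tm A odd v) = tm A odd (u * v) := by
  rw [tm, tm, tildeBr, quotBr_mk, LinearMap.mul_apply', mon_mul, tm]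

theorem tilde_rel {a : FreeAlg ι} (h : Rel A odd a) : (relIdeal A odd).mkQ a = 0 :=
  (Submodule.Quotient.mk_eq_zero _).2 (Submodule.mem_sInf.2 fun _ hI => hI.2 a h)

theorem tilde_induction {p : Tilde A odd → Prop} (a : Tilde A odd) (h0 : p 0)
    (hadd : ∀ a b, p a → p b → p (a + b)) (hsmul : ∀ (c : ℝ) a, p a → p (c • a))
    (hmon : ∀ u, p (tm A odd u)) : p a := by
  obtain ⟨a, rfl⟩ := Submodule.mkQ_surjective _ a
  induction a using free_induction with
  | h0 => rwa [map_zero]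
  | hadd a b ha hb => rw [map_add]; exact hadd _ _ ha hb
  | hsmul c a ha => rw [map_smul]; exact hsmul _ _ ha
  | hmon u => exact hmon u

theorem tilde_hom_ext {Y : Type*} [AddCommGroup Y] [Module ℝ Y] {f g : Tilde A odd →ₗ[ℝ] Y}
    (h : ∀ u, f (tm A odd u) = g (tm A odd u)) : f = g := by
  refine LinearMap.ext fun x => ?_
  induction x using tilde_induction with
  | h0 => simp
  | hadd a b ha hb => rw [map_add, map_add, ha, hb]
  | hsmul c a ha => rw [map_smul, map_smul, ha]
  | hmon u => exact h u

theorem tm_mem (u : FreeMagma (Gen ι)) {α : ι → ℤ} (h : monWeight u = α) :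
    tm A odd u ∈ tildeWeight A odd α :=
  Submodule.subset_span ⟨u, h, rfl⟩

theorem tildeWeight_induction {α : ι → ℤ}
    {p : (a : Tilde A odd) → a ∈ tildeWeight A odd α → Prop} {a : Tilde A odd}
    (ha : a ∈ tildeWeight A odd α) (h0 : p 0 (zero_mem _))
    (hadd : ∀ a b ha hb, p a ha → p b hb → p (a + b) (add_mem ha hb))
    (hsmul : ∀ (c : ℝ) a ha, p a ha → p (c • a) (Submodule.smul_mem _ c ha))
    (hmon : ∀ u (hu : monWeight u = α), p (tm A odd u) (tm_mem u hu)) : p a ha := by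
  induction ha using Submodule.span_induction with
  | zero => exact h0
  | add x y _ _ hx hy => exact hadd _ _ _ _ hx hy
  | smul c x _ hx => exact hsmul _ _ _ hx
  | mem x hx => obtain ⟨u, hu, rfl⟩ := hx; exact hmon u hu

theorem tildeBr_mem {α β γ : ι → ℤ} {x y : Tilde A odd} (hx : x ∈ tildeWeight A odd α)
    (hy : y ∈ tildeWeight A odd β) (h : α + β = γ) : tildeBr A odd x y ∈ tildeWeight A odd γ := by
  induction hx using tildeWeight_induction with
  | h0 => simp
  | hadd a b _ _ ha hb => rw [map_add]; exact add_mem ha hb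
  | hsmul c a _ ha => rw [map_smul]; exact Submodule.smul_mem _ _ ha
  | hmon u hu =>
    induction hy using tildeWeight_induction with
    | h0 => simp
    | hadd a b _ _ ha hb => rw [map_add]; exact add_mem ha hb
    | hsmul c a _ ha => rw [map_smul]; exact Submodule.smul_mem _ _ ha
    | hmon v hv => rw [tildeBr_tm]; exact tm_mem _ (by rw [monWeight_mul, hu, hv, h])

variable [Fintype ι]

/-- The operator on `Tilde A odd` multiplying elements of degree `α` by `c α`. -/
def tildeDiag (c : (ι → ℤ) → ℝ) : Tilde A odd →ₗ[ℝ] Tilde A odd :=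
  (relIdeal A odd).mapQ (relIdeal A odd) (freeDiag c) fun _ ha => freeDiag_mem_relIdeal ha c

@[simp]
theorem tildeDiag_tm (c : (ι → ℤ) → ℝ) (u : FreeMagma (Gen ι)) :
    tildeDiag c (tm A odd u) = c (monWeight u) • tm A odd u := by
  rw [tm, tildeDiag, Submodule.mkQ_apply, Submodule.mapQ_apply, freeDiag_mon]
  rfl

theorem tildeDiag_of_mem (c : (ι → ℤ) → ℝ) {α : ι → ℤ} {x : Tilde A odd}
    (hx : x ∈ tildeWeight A odd α) : tildeDiag c x = c α • x := by
  induction hx using tildeWeight_induction with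
  | h0 => simp
  | hadd x y _ _ hx hy => rw [map_add, hx, hy, smul_add]
  | hsmul r x _ hx => rw [map_smul, hx, smul_comm]
  | hmon u hu => rw [tildeDiag_tm, hu]

theorem tildeDiag_ind_mem (α : ι → ℤ) (x : Tilde A odd) :
    tildeDiag (ind α) x ∈ tildeWeight A odd α := by
  induction x using tilde_induction with
  | h0 => simp
  | hadd a b ha hb => rw [map_add]; exact add_mem ha hb
  | hsmul c a ha => rw [map_smul]; exact Submodule.smul_mem _ _ ha
  | hmon u =>
    rw [tildeDiag_tm, ind]
    split_ifs with h
    · rw [one_smul]; exact tm_mem _ h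
    · rw [zero_smul]; exact zero_mem _

theorem tilde_eq_sum (x : Tilde A odd) :
    ∃ T : Finset (ι → ℤ), x = ∑ α ∈ T, tildeDiag (ind α) x := by
  obtain ⟨a, rfl⟩ := Submodule.mkQ_surjective _ x
  obtain ⟨T, hT⟩ := freeDiag_eq_sum a
  refine ⟨T, ?_⟩
  have := hT T le_rfl fun _ => 1
  rw [freeDiag_one] at this
  conv_lhs => rw [this]
  rw [map_sum]
  exact Finset.sum_congr rfl fun α _ => by rw [one_smul]; rfl

theorem tilde_skew {α β : ι → ℤ} {x y : Tilde A odd} (hx : x ∈ tildeWeight A odd α)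
    (hy : y ∈ tildeWeight A odd β) :
    tildeBr A odd x y = -(koszul (par odd α) (par odd β) • tildeBr A odd y x) := by
  induction hx using tildeWeight_induction with
  | h0 => simp
  | hadd a b _ _ ha hb => simp only [map_add, LinearMap.add_apply, ha, hb, smul_add, neg_add]
  | hsmul c a _ ha => simp only [map_smul, LinearMap.smul_apply, ha, smul_neg, smul_comm c]
  | hmon u hu =>
    induction hy using tildeWeight_induction with
    | h0 => simp
    | hadd a b _ _ ha hb => simp only [map_add, LinearMap.add_apply, ha, hb, smul_add, neg_add]
    | hsmul c a _ ha => simp only [map_smul, LinearMap.smul_apply, ha, smul_neg, smul_comm c]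
    | hmon v hv =>
      have h := tilde_rel (Rel.skew (A := A) (odd := odd) u v)
      rw [map_add, map_smul, monParity_eq, monParity_eq, hu, hv] at h
      rw [tildeBr_tm, tildeBr_tm, tm, tm]
      exact eq_neg_of_add_eq_zero_left h

theorem tilde_jacobi {α β : ι → ℤ} {x y : Tilde A odd} (hx : x ∈ tildeWeight A odd α)
    (hy : y ∈ tildeWeight A odd β) (z : Tilde A odd) :
    tildeBr A odd (tildeBr A odd x y) z = tildeBr A odd x (tildeBr A odd y z) -
      koszul (par odd α) (par odd β) • tildeBr A odd y (tildeBr A odd x z) := by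
  induction hx using tildeWeight_induction with
  | h0 => simp
  | hadd a b _ _ ha hb =>
    simp only [map_add, LinearMap.add_apply, ha, hb, smul_add]; abel
  | hsmul c a _ ha => simp only [map_smul, LinearMap.smul_apply, ha, smul_sub, smul_comm c]
  | hmon u hu =>
    induction hy using tildeWeight_induction with
    | h0 => simp
    | hadd a b _ _ ha hb => simp only [map_add, LinearMap.add_apply, ha, hb, smul_add]; abel
    | hsmul c a _ ha => simp only [map_smul, LinearMap.smul_apply, ha, smul_sub, smul_comm c]
    | hmon v hv =>
      induction z using tilde_induction with
      | h0 => simp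
      | hadd a b ha hb => simp only [map_add, ha, hb, smul_add]; abel
      | hsmul c a ha => simp only [map_smul, ha, smul_sub, smul_comm c]
      | hmon w =>
        have h := tilde_rel (Rel.jacobi (A := A) (odd := odd) u v w)
        rw [map_sub, map_sub, map_smul, monParity_eq, monParity_eq, hu, hv] at h
        simp only [tildeBr_tm]
        exact sub_eq_zero.1 h

/-! ### Generators -/

/-- The generator `e_i` (`s = true`) or `f_i` (`s = false`). -/
def ef (s : Bool) (i : ι) : Gen ι := if s then .e i else .f i

/-- The sign `1` for `e_i` and `-1` for `f_i`. -/
def sg (s : Bool) : ℤ := if s then 1 else -1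

theorem sg_not (s : Bool) : sg (!s) = -sg s := by cases s <;> rfl

theorem sg_mul_self (s : Bool) : sg s * sg s = 1 := by cases s <;> rfl

theorem sg_mul_self_real (s : Bool) : (sg s : ℝ) * (sg s : ℝ) = 1 := by
  exact_mod_cast sg_mul_self s

variable (A odd) in
/-- The image of `e_i` or `f_i` in `Tilde A odd`. -/
def tg (s : Bool) (i : ι) : Tilde A odd := tm A odd (.of (ef s i))

variable (A odd) in
/-- The image of `h_i` in `Tilde A odd`. -/
def th (i : ι) : Tilde A odd := tm A odd (.of (.h i))

theorem monWeight_ef (s : Bool) (i : ι) :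
    monWeight (.of (ef s i)) = sg s • (Pi.single i 1 : ι → ℤ) := by
  cases s <;> simp [ef, sg, monWeight, Gen.weight]

theorem tg_mem (s : Bool) (i : ι) : tg A odd s i ∈ tildeWeight A odd (sg s • Pi.single i 1) :=
  tm_mem _ (monWeight_ef s i)

theorem th_mem (i : ι) : th A odd i ∈ tildeWeight A odd 0 := tm_mem _ rfl

theorem par_sg (s : Bool) (α : ι → ℤ) : par odd (sg s • α) = par odd α := by
  cases s <;> simp [sg, par_neg]

/-- The scalar by which `h_i` acts in degree `α`. -/
def coroot (A : Matrix ι ι ℤ) (i : ι) (α : ι → ℤ) : ℝ := ∑ k, (A i k : ℝ) * α k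

theorem coroot_add (i : ι) (α β : ι → ℤ) : coroot A i (α + β) = coroot A i α + coroot A i β := by
  simp [coroot, mul_add, Finset.sum_add_distrib]

theorem coroot_neg (i : ι) (α : ι → ℤ) : coroot A i (-α) = -coroot A i α := by
  simp [coroot]

theorem coroot_sg (i k : ι) (s : Bool) :
    coroot A i (sg s • (Pi.single k 1 : ι → ℤ)) = sg s * A i k := by
  rw [coroot, Finset.sum_eq_single k]
  · simp [mul_comm]
  · intro b _ hb; simp [hb]
  · simp

/-- The coefficient in `⁅e_i, f_i⁆ = h_i` and `⁅f_i, e_i⁆ = ± h_i`. -/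
def kap (odd : ι → Bool) (s : Bool) (i : ι) : ℝ := if s then 1 else -koszul (odd i) (odd i)

theorem kap_ne_zero (s : Bool) (i : ι) : kap odd s i ≠ 0 := by
  cases s <;> cases h : odd i <;> norm_num [kap, koszul, h]

theorem tg_tg_not (s : Bool) (i j : ι) :
    tildeBr A odd (tg A odd s i) (tg A odd (!s) j) =
      if i = j then kap odd s i • th A odd i else 0 := by
  have key : ∀ i j, tildeBr A odd (tm A odd (.of (.e i))) (tm A odd (.of (.f j))) =
      if i = j then th A odd i else 0 := by
    intro i j
    have := tilde_rel (Rel.ef (A := A) (odd := odd) i j)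
    rw [map_sub, sub_eq_zero, gen, gen, mon_mul] at this
    rw [tildeBr_tm, tm, this]
    split_ifs with h
    · rw [h]; rfl
    · exact map_zero _
  cases s
  · rw [tilde_skew (tg_mem _ _) (tg_mem _ _)]
    rw [par_sg, par_sg, par_single, par_single]
    change -(_ • tildeBr A odd (tm A odd (.of (.e j))) (tm A odd (.of (.f i)))) = _
    rw [key]
    by_cases h : i = j
    · subst h; simp [kap]
    · simp [h, Ne.symm h]
  · change tildeBr A odd (tm A odd (.of (.e i))) (tm A odd (.of (.f j))) = _
    rw [key]
    simp [kap]

theorem th_tm (i : ι) (u : FreeMagma (Gen ι)) :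
    tildeBr A odd (th A odd i) (tm A odd u) = coroot A i (monWeight u) • tm A odd u := by
  induction u with
  | ih1 x =>
    cases x with
    | e j =>
      have := tilde_rel (Rel.he (A := A) (odd := odd) i j)
      rw [map_sub, sub_eq_zero, gen, gen, mon_mul, map_smul] at this
      rw [th, tildeBr_tm, tm, this]
      have h := coroot_sg (A := A) i j true
      simp only [sg, if_true, one_smul, Int.cast_one, one_mul] at h
      change _ = coroot A i (Pi.single j 1) • _
      rw [h]; rfl
    | f j =>
      have := tilde_rel (Rel.hf (A := A) (odd := odd) i j)
      rw [map_add, gen, gen, mon_mul, map_smul] at this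
      rw [th, tildeBr_tm, tm, eq_neg_of_add_eq_zero_left this]
      have h := coroot_sg (A := A) i j true
      simp only [sg, if_true, one_smul, Int.cast_one, one_mul] at h
      change _ = coroot A i (-Pi.single j 1) • _
      rw [coroot_neg, h, neg_smul]; rfl
    | h j =>
      have := tilde_rel (Rel.hh (A := A) (odd := odd) i j)
      rw [gen, gen, mon_mul] at this
      rw [th, tildeBr_tm, tm, this]
      change _ = coroot A i 0 • _
      simp [coroot]
  | ih2 u v hu hv =>
    rw [← tildeBr_tm]
    have := tilde_jacobi (th_mem (A := A) (odd := odd) i) (tm_mem u rfl) (tm A odd v)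
    rw [hu, par_zero, koszul_false_left, one_smul, hv, map_smul, map_smul, LinearMap.smul_apply,
      eq_sub_iff_add_eq] at this
    rw [← this, monWeight_mul, coroot_add, add_smul]

theorem th_br (i : ι) {α : ι → ℤ} {x : Tilde A odd} (hx : x ∈ tildeWeight A odd α) :
    tildeBr A odd (th A odd i) x = coroot A i α • x := by
  induction hx using tildeWeight_induction with
  | h0 => simp
  | hadd a b _ _ ha hb => rw [map_add, ha, hb, smul_add]
  | hsmul c a _ ha => rw [map_smul, ha, smul_comm]
  | hmon u hu => rw [th_tm, hu]

theorem br_th (i : ι) {α : ι → ℤ} {x : Tilde A odd} (hx : x ∈ tildeWeight A odd α) :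
    tildeBr A odd x (th A odd i) = -(coroot A i α • x) := by
  rw [tilde_skew hx (th_mem i), th_br i hx, par_zero, koszul_false_right, one_smul]

/-! ### Triangular decomposition -/

/-- Nested bracket monomials `⁅x_1, ⁅x_2, …, x_k⁆⁆` in the `e_i` (`s = true`) or in the `f_i`. -/
inductive IsWord (s : Bool) : FreeMagma (Gen ι) → Prop
  | of (i : ι) : IsWord s (.of (ef s i))
  | cons (i : ι) (w : FreeMagma (Gen ι)) : IsWord s w → IsWord s (.of (ef s i) * w)

variable (A odd) in
/-- The span of the words of degree `α` and, if `α = 0`, of the `h_i`. -/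
def wordSpan (s : Bool) (α : ι → ℤ) : Submodule ℝ (Tilde A odd) :=
  Submodule.span ℝ {x | ∃ u, (IsWord s u ∨ ∃ i, u = .of (.h i)) ∧ monWeight u = α ∧ x = tm A odd u}

theorem word_mem_wordSpan {s : Bool} {α : ι → ℤ} {u : FreeMagma (Gen ι)} (hu : IsWord s u)
    (h : monWeight u = α) : tm A odd u ∈ wordSpan A odd s α :=
  Submodule.subset_span ⟨u, Or.inl hu, h, rfl⟩

theorem th_mem_wordSpan (s : Bool) (i : ι) : th A odd i ∈ wordSpan A odd s 0 :=
  Submodule.subset_span ⟨_, Or.inr ⟨i, rfl⟩, rfl, rfl⟩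

theorem wordSpan_le (s : Bool) (α : ι → ℤ) : wordSpan A odd s α ≤ tildeWeight A odd α :=
  Submodule.span_mono fun _ ⟨u, _, h, e⟩ => ⟨u, h, e⟩

theorem tg_br_wordSpan (s : Bool) (i : ι) {α : ι → ℤ} {x : Tilde A odd}
    (hx : x ∈ wordSpan A odd s α) :
    tildeBr A odd (tg A odd s i) x ∈ wordSpan A odd s (sg s • Pi.single i 1 + α) := by
  induction hx using Submodule.span_induction with
  | zero => simp
  | add x y _ _ hx hy => rw [map_add]; exact add_mem hx hy
  | smul c x _ hx => rw [map_smul]; exact Submodule.smul_mem _ _ hx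
  | mem x hx =>
    obtain ⟨u, hu | ⟨k, rfl⟩, rfl, rfl⟩ := hx
    · rw [tg, tildeBr_tm]
      exact word_mem_wordSpan (.cons i u hu) (by rw [monWeight_mul, monWeight_ef])
    · change tildeBr A odd _ (th A odd k) ∈ _
      rw [br_th k (tg_mem s i)]
      refine neg_mem (Submodule.smul_mem _ _ (word_mem_wordSpan (.of i) ?_))
      rw [monWeight_ef]
      exact (add_zero _).symm

/-- An opposite generator is moved through the word by the Jacobi identity. Meeting its partner
produces a multiple of some h_i, which acts on the remaining word by a scalar; at the innermost
letter the h_i itself is left. -/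
theorem tg_not_br_word (s : Bool) (i : ι) {u : FreeMagma (Gen ι)} (hu : IsWord s u) :
    tildeBr A odd (tg A odd (!s) i) (tm A odd u) ∈
      wordSpan A odd s (sg (!s) • Pi.single i 1 + monWeight u) := by
  induction hu with
  | of k =>
    have := tg_tg_not (A := A) (odd := odd) (!s) i k
    rw [Bool.not_not] at this
    change tildeBr A odd _ (tg A odd s k) ∈ _
    rw [this]
    split_ifs with h
    · subst h
      rw [monWeight_ef, sg_not, neg_smul, neg_add_cancel]
      exact Submodule.smul_mem _ _ (th_mem_wordSpan s i)
    · exact zero_mem _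
  | cons k w hw ih =>
    rw [← tildeBr_tm]
    have h1 := tilde_jacobi (tg_mem (A := A) (odd := odd) (!s) i) (tg_mem s k) (tm A odd w)
    rw [eq_sub_iff_add_eq] at h1
    change tildeBr A odd _ (tildeBr A odd (tg A odd s k) _) ∈ _
    rw [← h1]
    refine add_mem ?_ (Submodule.smul_mem _ _ ?_)
    · have := tg_tg_not (A := A) (odd := odd) (!s) i k
      rw [Bool.not_not] at this
      rw [this]
      split_ifs with h
      · subst h
        rw [map_smul, LinearMap.smul_apply, th_tm]
        refine Submodule.smul_mem _ _ (Submodule.smul_mem _ _ (word_mem_wordSpan hw ?_))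
        rw [monWeight_mul, monWeight_ef, sg_not, neg_smul, neg_add_cancel_left]
      · simp
    · have := tg_br_wordSpan s k ih
      rwa [monWeight_mul, monWeight_ef, add_left_comm]

/-- Triangular decomposition: the span of the words in the e_i, the words in the f_i and the h_i is
stable under bracketing with generators (`hgen`), hence with all monomials by the Jacobi identity
(`hall`). The h_i are counted in both summands. -/
theorem tm_mem_wordSpan (u : FreeMagma (Gen ι)) :
    tm A odd u ∈ wordSpan A odd true (monWeight u) ⊔ wordSpan A odd false (monWeight u) := by
  have hgen : ∀ x : Gen ι, ∀ α, ∀ y ∈ wordSpan A odd true α ⊔ wordSpan A odd false α,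
      tildeBr A odd (tm A odd (.of x)) y ∈ wordSpan A odd true (monWeight (.of x) + α) ⊔
        wordSpan A odd false (monWeight (.of x) + α) := by
    have hef : ∀ s i α, ∀ t, ∀ y ∈ wordSpan A odd t α,
        tildeBr A odd (tg A odd s i) y ∈ wordSpan A odd t (sg s • Pi.single i 1 + α) ⊔
          wordSpan A odd s (sg s • Pi.single i 1 + α) := by
      intro s i α t y hy
      by_cases hst : t = s
      · subst hst
        exact Submodule.mem_sup_left (tg_br_wordSpan t i hy)
      · obtain rfl : s = !t := by cases s <;> cases t <;> simp_all
        induction hy using Submodule.span_induction with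
        | zero => simp
        | add x y _ _ hx hy => rw [map_add]; exact add_mem hx hy
        | smul c x _ hx => rw [map_smul]; exact Submodule.smul_mem _ _ hx
        | mem x hx =>
          obtain ⟨u, hu | ⟨k, rfl⟩, rfl, rfl⟩ := hx
          · exact Submodule.mem_sup_left (tg_not_br_word t i hu)
          · exact Submodule.mem_sup_right (tg_br_wordSpan (!t) i (th_mem_wordSpan _ k))
    intro x α y hy
    obtain ⟨y₁, h₁, y₂, h₂, rfl⟩ := Submodule.mem_sup.1 hy
    rw [map_add]
    cases x with
    | h i =>
      change tildeBr A odd (th A odd i) _ + tildeBr A odd (th A odd i) _ ∈ _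
      rw [th_br i (wordSpan_le _ _ h₁), th_br i (wordSpan_le _ _ h₂)]
      change _ ∈ wordSpan A odd true (0 + α) ⊔ wordSpan A odd false (0 + α)
      rw [zero_add]
      exact add_mem (Submodule.mem_sup_left (Submodule.smul_mem _ _ h₁))
        (Submodule.mem_sup_right (Submodule.smul_mem _ _ h₂))
    | e i =>
      have e1 := hef true i α true y₁ h₁
      have e2 := hef true i α false y₂ h₂
      rw [sup_idem] at e1
      rw [sup_comm, ← monWeight_ef] at e2
      rw [← monWeight_ef] at e1
      exact add_mem (Submodule.mem_sup_left e1) e2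
    | f i =>
      have e1 := hef false i α true y₁ h₁
      have e2 := hef false i α false y₂ h₂
      rw [sup_idem] at e2
      rw [← monWeight_ef] at e1 e2
      exact add_mem e1 (Submodule.mem_sup_right e2)
  have hall : ∀ u : FreeMagma (Gen ι), ∀ α, ∀ y ∈ wordSpan A odd true α ⊔ wordSpan A odd false α,
      tildeBr A odd (tm A odd u) y ∈ wordSpan A odd true (monWeight u + α) ⊔
        wordSpan A odd false (monWeight u + α) := by
    intro u
    induction u with
    | ih1 x => exact hgen x
    | ih2 u v hu hv =>
      intro α y hy
      rw [← tildeBr_tm, tilde_jacobi (tm_mem u rfl) (tm_mem v rfl), monWeight_mul]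
      refine sub_mem ?_ (Submodule.smul_mem _ _ ?_)
      · rw [add_assoc]; exact hu _ _ (hv _ _ hy)
      · rw [add_comm (monWeight u), add_assoc]; exact hv _ _ (hu _ _ hy)
  induction u with
  | ih1 x =>
    cases x with
    | h i => exact Submodule.mem_sup_left (th_mem_wordSpan true i)
    | e i => exact Submodule.mem_sup_left (word_mem_wordSpan (IsWord.of (s := true) i) rfl)
    | f i => exact Submodule.mem_sup_right (word_mem_wordSpan (IsWord.of (s := false) i) rfl)
  | ih2 u v _ hv =>
    rw [← tildeBr_tm, monWeight_mul]
    exact hall u _ _ hv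

theorem tildeWeight_eq (α : ι → ℤ) :
    tildeWeight A odd α = wordSpan A odd true α ⊔ wordSpan A odd false α := by
  refine le_antisymm (Submodule.span_le.2 ?_) (sup_le (wordSpan_le _ _) (wordSpan_le _ _))
  rintro _ ⟨u, rfl, rfl⟩
  exact tm_mem_wordSpan u

/-- The height of an element of the root lattice. -/
def ht (α : ι → ℤ) : ℤ := ∑ i, α i

theorem ht_add (α β : ι → ℤ) : ht (α + β) = ht α + ht β := by
  simp [ht, Finset.sum_add_distrib]

theorem ht_neg (α : ι → ℤ) : ht (-α) = -ht α := by simp [ht]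

theorem ht_sub (α β : ι → ℤ) : ht (α - β) = ht α - ht β := by simp [ht]

theorem ht_sg (s : Bool) (i : ι) : ht (sg s • (Pi.single i 1 : ι → ℤ)) = sg s := by
  simp [ht, ← Finset.mul_sum]

theorem IsWord.weight_nonneg {s : Bool} {u : FreeMagma (Gen ι)} (hu : IsWord s u) (k : ι) :
    0 ≤ sg s * monWeight u k := by
  have h : ∀ i : ι, 0 ≤ sg s * (sg s • (Pi.single i 1 : ι → ℤ)) k := by
    intro i
    rw [Pi.smul_apply, smul_eq_mul, ← mul_assoc, sg_mul_self, one_mul]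
    by_cases h : k = i
    · subst h; simp
    · simp [h]
  induction hu with
  | of i => rw [monWeight_ef]; exact h i
  | cons i w _ ih =>
    rw [monWeight_mul, monWeight_ef, Pi.add_apply, mul_add]
    exact add_nonneg (h i) ih

theorem IsWord.ht_pos {s : Bool} {u : FreeMagma (Gen ι)} (hu : IsWord s u) :
    0 < sg s * ht (monWeight u) := by
  induction hu with
  | of i => rw [monWeight_ef, ht_sg, sg_mul_self]; exact one_pos
  | cons i w _ ih =>
    rw [monWeight_mul, ht_add, monWeight_ef, ht_sg, mul_add, sg_mul_self]
    exact add_pos one_pos ih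

end Tilde

end TensorHierarchy
end

noncomputable section
set_option linter.unusedSectionVars false
namespace TensorHierarchy
open scoped TensorProduct

/-! ### Verma modules and the coefficients of the `h_i` -/

section Verma

/-- The space with basis the words in the nodes. -/
def WordModule (ι : Type) : Type := List ι →₀ ℝ

instance (ι : Type) : AddCommGroup (WordModule ι) := inferInstanceAs (AddCommGroup (List ι →₀ ℝ))

instance (ι : Type) : Module ℝ (WordModule ι) := inferInstanceAs (Module ℝ (List ι →₀ ℝ))

/-- A word as an element of `WordModule`. -/
def wordVec {ι : Type} (l : List ι) : WordModule ι := Finsupp.single l (1 : ℝ)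

/-- The linear map with prescribed values on the words. -/
def wordLift {ι : Type} {Y : Type*} [AddCommGroup Y] [Module ℝ Y] (f : List ι → Y) :
    WordModule ι →ₗ[ℝ] Y := Finsupp.linearCombination ℝ f

@[simp]
theorem wordLift_wordVec {ι : Type} {Y : Type*} [AddCommGroup Y] [Module ℝ Y] (f : List ι → Y)
    (l : List ι) : wordLift f (wordVec l) = f l := by
  exact (Finsupp.linearCombination_single (v := f) ℝ (1 : ℝ) l).trans (one_smul _ _)

variable {ι : Type} [DecidableEq ι] (A : Matrix ι ι ℤ) (odd : ι → Bool) (lam : ι → ℝ)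

/-- The eigenvalue of `h_i` on the word `f_{j_1} f_{j_2} ⋯ v` of the Verma module with highest
weight `lam`. -/
def vermaWeight (i : ι) (l : List ι) : ℝ := lam i - (l.map fun j => (A i j : ℝ)).sum

/-- The action of `f_i` on the Verma module. -/
def vermaF (i : ι) : Module.End ℝ (WordModule ι) := wordLift fun l => wordVec (i :: l)

/-- The action of `h_i` on the Verma module. -/
def vermaH (i : ι) : Module.End ℝ (WordModule ι) :=
  wordLift fun l => vermaWeight A lam i l • wordVec l

/-- The action of `e_i` on the words of the Verma module. -/
def vermaEWord (i : ι) : List ι → WordModule ι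
  | [] => 0
  | j :: l => (if i = j then vermaWeight A lam i l • wordVec l else 0) +
      koszul (odd i) (odd j) • vermaF j (vermaEWord i l)

/-- The action of `e_i` on the Verma module. -/
def vermaE (i : ι) : Module.End ℝ (WordModule ι) :=
  wordLift (vermaEWord A odd lam i)

/-- The action of the bracket monomials on the Verma module. -/
def verma : FreeMagma (Gen ι) → Module.End ℝ (WordModule ι)
  | .of (.e i) => vermaE A odd lam i
  | .of (.f i) => vermaF i
  | .of (.h i) => vermaH A lam i
  | .mul u v => verma u * verma v -
      koszul (monParity odd u) (monParity odd v) • (verma v * verma u)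

theorem verma_mul (u v : FreeMagma (Gen ι)) : verma A odd lam (u * v) =
    verma A odd lam u * verma A odd lam v -
      koszul (monParity odd u) (monParity odd v) • (verma A odd lam v * verma A odd lam u) := rfl

variable {A odd lam}

theorem end_ext {f g : Module.End ℝ (WordModule ι)}
    (h : ∀ l, f (wordVec l) = g (wordVec l)) : f = g :=
  Finsupp.lhom_ext' (R := ℝ) (M := ℝ) (N := WordModule ι) fun l => LinearMap.ext_ring <| by
    exact h l

@[simp]
theorem vermaF_single (i : ι) (l : List ι) :
    vermaF i (wordVec l) = wordVec (i :: l) := by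
  simp [vermaF]

@[simp]
theorem vermaH_single (i : ι) (l : List ι) : vermaH A lam i (wordVec l) =
    vermaWeight A lam i l • wordVec l := by
  simp [vermaH]

@[simp]
theorem vermaE_single (i : ι) (l : List ι) : vermaE A odd lam i (wordVec l) =
    vermaEWord A odd lam i l := by
  simp [vermaE]

theorem vermaWeight_cons (i j : ι) (l : List ι) :
    vermaWeight A lam i (j :: l) = vermaWeight A lam i l - A i j := by
  simp [vermaWeight]; ring

theorem vermaH_mul_vermaF (i j : ι) :
    vermaH A lam i * vermaF j = vermaF j * vermaH A lam i - (A i j : ℝ) • vermaF j := by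
  refine end_ext fun l => ?_
  simp [vermaWeight_cons, sub_smul]

theorem vermaH_vermaEWord (i j : ι) (l : List ι) :
    vermaH A lam i (vermaEWord A odd lam j l) =
      (vermaWeight A lam i l + A i j) • vermaEWord A odd lam j l := by
  induction l with
  | nil => simp [vermaEWord]
  | cons k l ih =>
    have h := LinearMap.congr_fun (vermaH_mul_vermaF (A := A) (lam := lam) i k)
      (vermaEWord A odd lam j l)
    simp only [Module.End.mul_apply, LinearMap.sub_apply, LinearMap.smul_apply, ih,
      map_smul] at h
    rw [vermaEWord, map_add, map_smul, h, vermaWeight_cons, smul_add, ← sub_smul,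
      smul_comm (koszul _ _)]
    congr 1
    · split_ifs with hjk
      · subst hjk
        rw [map_smul, vermaH_single, sub_add_cancel, smul_comm]
      · simp
    · congr 1
      ring

theorem koszul_eq (s t : Bool) : koszul s t = 1 ∨ koszul s t = -1 := by
  cases s <;> cases t <;> simp [koszul]

/-- Here `a`, `b`, `c` are the signs of the pairs (x, y), (y, z), (x, z). The cancellation uses only
a² = 1, so `b` and `c` may stay arbitrary. -/
theorem supercommutator_jacobi {R : Type*} [Ring R] [Algebra ℝ R] (x y z : R) {a : ℝ}
    (ha : a = 1 ∨ a = -1) (b c : ℝ) :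
    (x * y - a • (y * x)) * z - (c * b) • (z * (x * y - a • (y * x))) -
      (x * (y * z - b • (z * y)) - (a * c) • ((y * z - b • (z * y)) * x) -
        a • (y * (x * z - c • (z * x)) - (a * b) • ((x * z - c • (z * x)) * y))) = 0 := by
  simp only [mul_sub, sub_mul, mul_smul_comm, smul_mul_assoc, mul_assoc]
  rcases ha with rfl | rfl <;> module

/-- The Lie superalgebra relations hold because brackets are sent to supercommutators in an
associative algebra; the Chevalley relations are checked on words. -/
theorem verma_rel {x : FreeAlg ι} (h : Rel A odd x) : liftMon (verma A odd lam) x = 0 := by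
  cases h with
  | skew u v =>
    rw [map_add, map_smul, liftMon_mon, liftMon_mon, verma_mul, verma_mul,
      koszul_comm (monParity odd v), smul_sub, smul_smul, koszul_mul_self, one_smul]
    abel
  | jacobi u v w =>
    have h1 : monParity odd (u * v) = xor (monParity odd u) (monParity odd v) := rfl
    have h2 : monParity odd (v * w) = xor (monParity odd v) (monParity odd w) := rfl
    have h3 : monParity odd (u * w) = xor (monParity odd u) (monParity odd w) := rfl
    simp only [map_sub, map_smul, liftMon_mon, verma_mul, h1, h2, h3, koszul_xor_left,
      koszul_xor_right]
    rw [koszul_comm (monParity odd v) (monParity odd u)]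
    exact supercommutator_jacobi _ _ _ (koszul_eq _ _) _ _
  | he i j =>
    rw [map_sub, map_smul, gen, gen, mon_mul, liftMon_mon, liftMon_mon, verma_mul]
    refine end_ext fun l => ?_
    simp [monParity, Gen.parity, verma, vermaH_vermaEWord, add_smul]
  | hf i j =>
    rw [map_add, map_smul, gen, gen, mon_mul, liftMon_mon, liftMon_mon, verma_mul]
    simp [monParity, Gen.parity, verma, vermaH_mul_vermaF]
  | ef i j =>
    rw [map_sub, gen, gen, mon_mul, liftMon_mon, verma_mul]
    refine end_ext fun l => ?_
    by_cases h : i = j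
    · subst h
      simp [monParity, Gen.parity, verma, vermaEWord, gen]
    · simp [monParity, Gen.parity, verma, vermaEWord, h]
  | hh i j =>
    rw [gen, gen, mon_mul, liftMon_mon, verma_mul]
    refine end_ext fun l => ?_
    simp [monParity, Gen.parity, verma, smul_smul, mul_comm]

variable [Fintype ι]

/-- An element acting by zero has zero supercommutator with everything. The sign in the
supercommutator requires a homogeneous element, which is what `relIdeal_le` provides. -/
theorem relIdeal_le_verma : relIdeal A odd ≤ LinearMap.ker (liftMon (verma A odd lam)) := by
  refine relIdeal_le _ (fun b α a ha h0 => ?_) fun x hx => verma_rel hx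
  have key : liftMon (verma A odd lam) (mon b * a) = verma A odd lam b *
      liftMon (verma A odd lam) a - koszul (par odd (monWeight b)) (par odd α) •
        (liftMon (verma A odd lam) a * verma A odd lam b) := by
    clear h0
    induction ha using Submodule.span_induction with
    | zero => simp
    | add x y _ _ hx hy => rw [mul_add, map_add, hx, hy, map_add, mul_add, add_mul, smul_add]; abel
    | smul c x _ hx =>
      rw [mul_smul_comm, map_smul, hx, map_smul, smul_sub, mul_smul_comm, smul_mul_assoc,
        smul_comm c]
    | mem x hx =>
      obtain ⟨u, rfl, rfl⟩ := hx
      rw [mon_mul, liftMon_mon, verma_mul, liftMon_mon, monParity_eq, monParity_eq]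
  have key' : liftMon (verma A odd lam) (a * mon b) = liftMon (verma A odd lam) a *
      verma A odd lam b - koszul (par odd α) (par odd (monWeight b)) •
        (verma A odd lam b * liftMon (verma A odd lam) a) := by
    clear h0 key
    induction ha using Submodule.span_induction with
    | zero => simp
    | add x y _ _ hx hy => rw [add_mul, map_add, hx, hy, map_add, mul_add, add_mul, smul_add]; abel
    | smul c x _ hx =>
      rw [smul_mul_assoc, map_smul, hx, map_smul, smul_sub, mul_smul_comm, smul_mul_assoc,
        smul_comm c]
    | mem x hx =>
      obtain ⟨u, rfl, rfl⟩ := hx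
      rw [mon_mul, liftMon_mon, verma_mul, liftMon_mon, monParity_eq, monParity_eq]
  rw [LinearMap.mem_ker] at h0 ⊢
  rw [LinearMap.mem_ker, key, key', h0]
  simp

variable (A odd) in
/-- The coefficient of `h_i` in an element of degree `0`, extended by `0` to the other degrees. -/
def hcoef (i : ι) : Tilde A odd →ₗ[ℝ] ℝ :=
  (wordLift (fun l => if l = [] then 1 else 0) ∘ₗ LinearMap.applyₗ (wordVec []) ∘ₗ
    (relIdeal A odd).liftQ (liftMon (verma A odd (Pi.single i 1))) relIdeal_le_verma) ∘ₗ
    tildeDiag (ind 0)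

theorem hcoef_of_mem (i : ι) {α : ι → ℤ} (hα : α ≠ 0) {x : Tilde A odd}
    (hx : x ∈ tildeWeight A odd α) : hcoef A odd i x = 0 := by
  rw [hcoef, LinearMap.comp_apply, tildeDiag_of_mem _ hx]
  simp [ind, hα]

/-- In the Verma module whose highest weight is the i-th coordinate function, h_j acts on the
highest weight vector by δ_ij. In particular the h_i are linearly independent in `Tilde`. -/
theorem hcoef_th (i j : ι) : hcoef A odd i (th A odd j) = if i = j then 1 else 0 := by
  rw [hcoef, LinearMap.comp_apply, tildeDiag_of_mem _ (th_mem j)]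
  have : (relIdeal A odd).liftQ (liftMon (verma A odd (Pi.single i 1))) relIdeal_le_verma
      (th A odd j) = vermaH A (Pi.single i 1) j := by
    rw [th, tm, Submodule.mkQ_apply, Submodule.liftQ_apply, liftMon_mon]
    rfl
  by_cases h : i = j
  · subst h
    simp [ind, this, vermaWeight]
  · simp [ind, this, vermaWeight, h, Ne.symm h]

/-! ### Homogeneous components of small degree -/

theorem wordSpan_eq_bot_of_ht {s : Bool} {α : ι → ℤ} (h : sg s * ht α < 0) :
    wordSpan A odd s α = ⊥ := by
  rw [wordSpan, Submodule.span_eq_bot]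
  rintro _ ⟨u, hu | ⟨i, rfl⟩, rfl, rfl⟩
  · exact absurd hu.ht_pos (not_lt.2 h.le)
  · exact absurd h (by simp [monWeight, Gen.weight, ht])

theorem tildeWeight_eq_wordSpan {s : Bool} {α : ι → ℤ} (h : 0 < sg s * ht α) :
    tildeWeight A odd α = wordSpan A odd s α := by
  have h' : wordSpan A odd (!s) α = ⊥ :=
    wordSpan_eq_bot_of_ht (by rw [sg_not, neg_mul]; exact neg_neg_of_pos h)
  rw [tildeWeight_eq]
  cases s
  · rw [show wordSpan A odd true α = ⊥ from h', bot_sup_eq]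
  · rw [show wordSpan A odd false α = ⊥ from h', sup_bot_eq]

/-- Words have degrees of nonzero height, so no nonzero degree of height 0 occurs. Thus the division
by the height in the form loses nothing. -/
theorem eq_zero_of_ht_eq_zero {α : ι → ℤ} (h : ht α = 0) (hα : α ≠ 0) {x : Tilde A odd}
    (hx : x ∈ tildeWeight A odd α) : x = 0 := by
  have hb : ∀ s, wordSpan A odd s α = ⊥ := by
    intro s
    rw [wordSpan, Submodule.span_eq_bot]
    rintro _ ⟨u, hu | ⟨i, rfl⟩, rfl, rfl⟩
    · have := hu.ht_pos
      rw [h, mul_zero] at this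
      exact absurd this (lt_irrefl _)
    · exact absurd rfl hα
  rw [tildeWeight_eq, hb, hb, sup_bot_eq] at hx
  simpa using hx

/-- An element of degree `± α_i` is a multiple of `e_i` or `f_i`. -/
theorem exists_smul_tg {s : Bool} {i : ι} {x : Tilde A odd}
    (hx : x ∈ tildeWeight A odd (sg s • Pi.single i 1)) : ∃ c : ℝ, x = c • tg A odd s i := by
  rw [tildeWeight_eq_wordSpan (s := s) (by rw [ht_sg, sg_mul_self]; exact one_pos)] at hx
  have : wordSpan A odd s (sg s • Pi.single i 1) ≤ Submodule.span ℝ {tg A odd s i} := by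
    refine Submodule.span_le.2 ?_
    rintro _ ⟨u, hu | ⟨k, rfl⟩, hw, rfl⟩
    · cases hu with
      | of k =>
        rw [monWeight_ef] at hw
        have hs : sg s ≠ 0 := by cases s <;> decide
        have h1 := congrFun hw k
        simp only [Pi.smul_apply, Pi.single_eq_same, smul_eq_mul, mul_one] at h1
        obtain rfl : k = i := by
          by_contra hne
          rw [Pi.single_eq_of_ne hne, mul_zero] at h1
          exact hs h1
        exact Submodule.subset_span rfl
      | cons k w h =>
        have h1 := congrArg (fun α => sg s * ht α) hw
        have h2 := h.ht_pos
        simp only [monWeight_mul, ht_add, monWeight_ef, ht_sg, mul_add, sg_mul_self] at h1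
        omega
    · have h1 := congrArg ht hw
      rw [ht_sg] at h1
      cases s <;> simp [monWeight, Gen.weight, ht, sg] at h1
  obtain ⟨c, hc⟩ := Submodule.mem_span_singleton.1 (this hx)
  exact ⟨c, hc.symm⟩

theorem eq_sum_hcoef {x : Tilde A odd} (hx : x ∈ tildeWeight A odd 0) :
    x = ∑ i, hcoef A odd i x • th A odd i := by
  have : x ∈ Submodule.span ℝ (Set.range (th A odd)) := by
    have h : ∀ s, wordSpan A odd s 0 ≤ Submodule.span ℝ (Set.range (th A odd)) := by
      intro s
      refine Submodule.span_le.2 ?_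
      rintro _ ⟨u, hu | ⟨k, rfl⟩, hw, rfl⟩
      · have := hu.ht_pos
        rw [hw] at this
        simp [ht] at this
      · exact Submodule.subset_span ⟨k, rfl⟩
    rw [tildeWeight_eq] at hx
    exact sup_le (h _) (h _) hx
  clear hx
  induction this using Submodule.span_induction with
  | zero => simp
  | add x y _ _ hx hy =>
    simp only [map_add, add_smul, Finset.sum_add_distrib]
    exact congrArg₂ _ hx hy
  | smul c x _ hx =>
    simp only [map_smul, smul_assoc, ← Finset.smul_sum]
    exact congrArg _ hx
  | mem x hx =>
    obtain ⟨k, rfl⟩ := hx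
    simp [hcoef_th]

/-- Induction over the elements of degree `α` with `ht α > 0` (`s = true`) or `ht α < 0`. -/
theorem tildeWeight_word_induction {s : Bool} {α : ι → ℤ} (hα : 0 < sg s * ht α)
    {p : (a : Tilde A odd) → a ∈ tildeWeight A odd α → Prop} {a : Tilde A odd}
    (ha : a ∈ tildeWeight A odd α) (h0 : p 0 (zero_mem _))
    (hadd : ∀ a b ha hb, p a ha → p b hb → p (a + b) (add_mem ha hb))
    (hsmul : ∀ (c : ℝ) a ha, p a ha → p (c • a) (Submodule.smul_mem _ c ha))
    (hof : ∀ i (hi : sg s • Pi.single i 1 = α), p (tg A odd s i) (hi ▸ tg_mem s i))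
    (hcons : ∀ i x (hx : x ∈ tildeWeight A odd (α - sg s • Pi.single i 1)),
      0 < sg s * ht (α - sg s • Pi.single i 1) →
        p (tildeBr A odd (tg A odd s i) x) (tildeBr_mem (tg_mem s i) hx (add_sub_cancel _ _))) :
    p a ha := by
  suffices h : ∃ h, p a h from h.2
  rw [tildeWeight_eq_wordSpan (s := s) hα] at ha
  induction ha using Submodule.span_induction with
  | zero => exact ⟨_, h0⟩
  | add x y _ _ hx hy => exact ⟨_, hadd _ _ _ _ hx.2 hy.2⟩
  | smul c x _ hx => exact ⟨_, hsmul _ _ _ hx.2⟩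
  | mem x hx =>
    obtain ⟨u, hu | ⟨k, rfl⟩, hw, rfl⟩ := hx
    · cases hu with
      | of k => exact ⟨_, hof k (by rw [← hw, monWeight_ef])⟩
      | cons k w h =>
        have hw' : monWeight w = α - sg s • Pi.single k 1 := by
          rw [← hw, monWeight_mul, monWeight_ef, add_sub_cancel_left]
        rw [← tildeBr_tm]
        exact ⟨_, hcons k _ (tm_mem w hw') (hw' ▸ h.ht_pos)⟩
    · rw [← hw] at hα
      exact absurd hα (by simp [monWeight, Gen.weight, ht])

end Verma

end TensorHierarchy
end

noncomputable section
set_option linter.unusedSectionVars false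
namespace TensorHierarchy
open scoped TensorProduct

/-! ### The invariant form on `Tilde` -/

section Form

variable {ι : Type} [DecidableEq ι] [Fintype ι] {A : Matrix ι ι ℤ} {odd : ι → Bool}

/-- The degree of `e_i` or `f_i`. -/
def rt (s : Bool) (i : ι) : ι → ℤ := sg s • Pi.single i 1

theorem rt_not (s : Bool) (i : ι) : rt (!s) i = -rt s i := by rw [rt, rt, sg_not, neg_smul]

theorem ht_rt (s : Bool) (i : ι) : ht (rt s i) = sg s := ht_sg s i

theorem par_rt (s : Bool) (i : ι) : par odd (rt s i) = odd i := by rw [rt, par_sg, par_single]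

theorem coroot_rt (s : Bool) (i k : ι) : coroot A i (rt s k) = sg s * A i k := coroot_sg i k s

theorem tg_mem_rt (s : Bool) (i : ι) : tg A odd s i ∈ tildeWeight A odd (rt s i) := tg_mem s i

theorem mem_of_weight_eq {α β : ι → ℤ} {x : Tilde A odd} (hx : x ∈ tildeWeight A odd α)
    (h : α = β) : x ∈ tildeWeight A odd β := h ▸ hx

variable (A odd) in
/-- The sum of the coefficients of the `h_i`. -/
def hsum : Tilde A odd →ₗ[ℝ] ℝ := ∑ i, hcoef A odd i

theorem hsum_apply (x : Tilde A odd) : hsum A odd x = ∑ i, hcoef A odd i x := by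
  simp [hsum]

theorem hsum_th (i : ι) : hsum A odd (th A odd i) = 1 := by simp [hsum_apply, hcoef_th]

variable (A odd) in
/-- The invariant form on `Tilde A odd`. -/
def tildeForm : Tilde A odd →ₗ[ℝ] Tilde A odd →ₗ[ℝ] ℝ :=
  -- For x of degree α and y of degree −α the factor −(ht (−α))⁻¹ equals (ht α)⁻¹, the normalization
  -- forced by ⁅x, y⁆ = ⟨x|y⟩ t_α. In degree 0 the convention 0⁻¹ = 0 removes this summand and only
  -- the Cartan matrix term contributes; in other degrees that term vanishes.
  ((tildeBr A odd).compr₂ (hsum A odd)).compl₂ (tildeDiag fun α => -(ht α : ℝ)⁻¹) +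
    ∑ i, ∑ k, (A i k : ℝ) • (hcoef A odd i).smulRight (hcoef A odd k)

theorem tildeForm_apply (x y : Tilde A odd) : tildeForm A odd x y =
    hsum A odd (tildeBr A odd x (tildeDiag (fun α => -(ht α : ℝ)⁻¹) y)) +
      ∑ i, ∑ k, (A i k : ℝ) * (hcoef A odd i x * hcoef A odd k y) := by
  simp [tildeForm]

theorem hsum_of_mem {α : ι → ℤ} (hα : α ≠ 0) {x : Tilde A odd}
    (hx : x ∈ tildeWeight A odd α) : hsum A odd x = 0 := by
  rw [hsum_apply]
  exact Finset.sum_eq_zero fun i _ => hcoef_of_mem i hα hx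

theorem tildeForm_of_ne {α β : ι → ℤ} (h : α + β ≠ 0) {x y : Tilde A odd}
    (hx : x ∈ tildeWeight A odd α) (hy : y ∈ tildeWeight A odd β) : tildeForm A odd x y = 0 := by
  rw [tildeForm_apply, tildeDiag_of_mem _ hy, map_smul, map_smul,
    hsum_of_mem h (tildeBr_mem hx hy rfl), smul_zero, zero_add]
  refine Finset.sum_eq_zero fun i _ => Finset.sum_eq_zero fun k _ => ?_
  by_cases hα : α = 0
  · have hβ : β ≠ 0 := by rintro rfl; exact h (by rw [hα, add_zero])
    rw [hcoef_of_mem k hβ hy, mul_zero, mul_zero]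
  · rw [hcoef_of_mem i hα hx, zero_mul, mul_zero]

theorem tildeForm_of_ht {α : ι → ℤ} (h : ht α ≠ 0) {x y : Tilde A odd}
    (hx : x ∈ tildeWeight A odd α) (hy : y ∈ tildeWeight A odd (-α)) :
    tildeForm A odd x y = (ht α : ℝ)⁻¹ * hsum A odd (tildeBr A odd x y) := by
  have hα : α ≠ 0 := by rintro rfl; exact h (by simp [ht])
  rw [tildeForm_apply, tildeDiag_of_mem _ hy, map_smul, map_smul, ht_neg, Int.cast_neg, inv_neg,
    neg_neg, smul_eq_mul, add_eq_left]
  refine Finset.sum_eq_zero fun i _ => Finset.sum_eq_zero fun k _ => ?_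
  rw [hcoef_of_mem i hα hx, zero_mul, mul_zero]

theorem tildeForm_th_th (i k : ι) : tildeForm A odd (th A odd i) (th A odd k) = A i k := by
  rw [tildeForm_apply, tildeDiag_of_mem _ (th_mem k), map_smul, th_br i (th_mem k)]
  simp [hcoef_th, coroot]

theorem tildeForm_tg_tg (s : Bool) (i : ι) :
    tildeForm A odd (tg A odd s i) (tg A odd (!s) i) = sg s * kap odd s i := by
  have h : ht (rt s i) ≠ 0 := by rw [ht_rt]; cases s <;> decide
  rw [tildeForm_of_ht h (tg_mem_rt s i) (rt_not s i ▸ tg_mem_rt (!s) i), ht_rt, tg_tg_not,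
    if_pos rfl, map_smul, hsum_th]
  cases s <;> simp [sg, inv_neg]

variable (A odd) in
/-- The element of the Cartan subalgebra dual to `α`. -/
def tT (α : ι → ℤ) : Tilde A odd := ∑ i, (α i : ℝ) • th A odd i

theorem tT_add (α β : ι → ℤ) : tT A odd (α + β) = tT A odd α + tT A odd β := by
  simp [tT, add_smul, Finset.sum_add_distrib]

theorem tT_zero : tT A odd 0 = 0 := by simp [tT]

theorem tT_rt (s : Bool) (i : ι) : tT A odd (rt s i) = (sg s : ℝ) • th A odd i := by
  rw [tT, Finset.sum_eq_single i]
  · simp [rt]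
  · intro b _ hb; simp [rt, hb]
  · simp

theorem hsum_tT (α : ι → ℤ) : hsum A odd (tT A odd α) = ht α := by
  simp [tT, hsum_th, ht]

theorem br_zero_zero {x y : Tilde A odd} (hx : x ∈ tildeWeight A odd 0)
    (hy : y ∈ tildeWeight A odd 0) : tildeBr A odd x y = 0 := by
  rw [eq_sum_hcoef hx, map_sum, LinearMap.sum_apply]
  refine Finset.sum_eq_zero fun i _ => ?_
  rw [map_smul, LinearMap.smul_apply, th_br i hy]
  simp [coroot]

/-- In nonzero degrees the minus sign in skew symmetry of the bracket is compensated by ht (−α) =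
−ht α; in degree 0 the symmetry of `A` is used. -/
theorem tildeForm_symm (hA : ∀ i k, A i k = A k i) {α β : ι → ℤ} {x y : Tilde A odd}
    (hx : x ∈ tildeWeight A odd α) (hy : y ∈ tildeWeight A odd β) :
    tildeForm A odd x y = koszul (par odd α) (par odd β) * tildeForm A odd y x := by
  by_cases h : α + β = 0
  · obtain rfl : β = -α := eq_neg_of_add_eq_zero_right h
    by_cases h0 : ht α = 0
    · by_cases hα : α = 0
      · subst hα
        rw [neg_zero] at hy
        have e : ∀ x ∈ tildeWeight A odd 0, ∀ y ∈ tildeWeight A odd 0, tildeForm A odd x y =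
            ∑ i, ∑ k, (A i k : ℝ) * (hcoef A odd i x * hcoef A odd k y) := by
          intro x hx y hy
          rw [tildeForm_apply, tildeDiag_of_mem _ hy, map_smul, br_zero_zero hx hy, smul_zero,
            map_zero, zero_add]
        rw [e x hx y hy, e y hy x hx, par_zero, koszul_false_left, one_mul, Finset.sum_comm]
        refine Finset.sum_congr rfl fun i _ => Finset.sum_congr rfl fun k _ => ?_
        rw [hA k i]; ring
      · rw [eq_zero_of_ht_eq_zero h0 hα hx]; simp
    · have hy' : x ∈ tildeWeight A odd (-(-α)) := by rwa [neg_neg]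
      rw [tildeForm_of_ht h0 hx hy, tildeForm_of_ht (by rwa [ht_neg, neg_ne_zero]) hy hy',
        tilde_skew hx hy, ht_neg, map_neg, map_smul]
      push_cast
      rw [inv_neg, smul_eq_mul]
      ring
  · rw [tildeForm_of_ne h hx hy, tildeForm_of_ne (by rwa [add_comm]) hy hx, mul_zero]

theorem tg_br_tT (hA : ∀ i k, A i k = A k i) (s : Bool) (i : ι) (α : ι → ℤ) :
    tildeBr A odd (tg A odd s i) (tT A odd α) = -((sg s * coroot A i α) • tg A odd s i) := by
  have h : ∀ k, tildeBr A odd (tg A odd s i) ((α k : ℝ) • th A odd k) =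
      (-(sg s * ((A i k : ℝ) * α k))) • tg A odd s i := by
    intro k
    rw [map_smul, br_th _ (tg_mem_rt s i), coroot_rt, ← neg_smul, smul_smul, hA k i]
    congr 1
    ring
  rw [tT, map_sum, Finset.sum_congr rfl fun k _ => h k, ← Finset.sum_smul, coroot,
    Finset.sum_neg_distrib, ← Finset.mul_sum, neg_smul]

/-- Brackets with elements of degree `± α_i`. -/
theorem tg_br_opposite (s : Bool) (i : ι) {y : Tilde A odd}
    (hy : y ∈ tildeWeight A odd (-rt s i)) : tildeBr A odd (tg A odd s i) y =
      (sg s * tildeForm A odd (tg A odd s i) y) • th A odd i := by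
  rw [← rt_not] at hy
  obtain ⟨c, rfl⟩ := exists_smul_tg hy
  rw [map_smul, map_smul, tg_tg_not, if_pos rfl, tildeForm_tg_tg, smul_smul, smul_eq_mul]
  congr 1
  linear_combination (-c * kap odd s i) * sg_mul_self_real s

variable (A odd) in
/-- Partial invariance of the form at height `± n`. -/
def InvAt (n : ℕ) : Prop := ∀ s : Bool, ∀ α : ι → ℤ, ht α = sg s * n →
  ∀ x ∈ tildeWeight A odd α,
    (∀ i, ∀ z ∈ tildeWeight A odd (-α - rt s i),
      tildeForm A odd x (tildeBr A odd (tg A odd s i) z) =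
        -(koszul (par odd α) (odd i) * tildeForm A odd (tg A odd s i) (tildeBr A odd x z)) ∧
      tildeForm A odd (tildeBr A odd (tg A odd s i) x) z =
        tildeForm A odd (tg A odd s i) (tildeBr A odd x z)) ∧
    ∀ y ∈ tildeWeight A odd (-α), tildeBr A odd x y = tildeForm A odd x y • tT A odd α

/-- The Jacobi identity splits the left side into a multiple of t_α, by `h2`, and a multiple of h_i.
Invariance in the form `h1` makes the coefficients match, so that the two parts combine to t of the
sum of the degrees. -/
theorem br_tg_br {s : Bool} {i : ι} {α : ι → ℤ} {x z : Tilde A odd}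
    (hx : x ∈ tildeWeight A odd α) (hz : z ∈ tildeWeight A odd (-α - rt s i))
    (h1 : tildeForm A odd x (tildeBr A odd (tg A odd s i) z) =
      -(koszul (par odd α) (odd i) * tildeForm A odd (tg A odd s i) (tildeBr A odd x z)))
    (h2 : ∀ y ∈ tildeWeight A odd (-α), tildeBr A odd x y = tildeForm A odd x y • tT A odd α) :
    tildeBr A odd (tildeBr A odd (tg A odd s i) x) z =
      tildeForm A odd (tg A odd s i) (tildeBr A odd x z) • tT A odd (α + rt s i) := by
  rw [tilde_jacobi (tg_mem_rt s i) hx,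
    h2 _ (tildeBr_mem (tg_mem_rt s i) hz (by abel)), h1, par_rt,
    tg_br_opposite s i (tildeBr_mem hx hz (by abel)), tT_add, tT_rt, koszul_comm (odd i)]
  have := koszul_mul_self (par odd α) (odd i)
  rw [smul_smul, smul_add, smul_smul, mul_neg, ← mul_assoc, this, one_mul, neg_smul,
    sub_neg_eq_add, add_comm, mul_comm]

/-- Summing the coefficients of the h_i in `br_tg_br` yields the height of α plus the degree of the
generator, which cancels the normalizing factor of the form. That height is nonzero because both
degrees have the same sign. -/
theorem tildeForm_tg_br {n : ℕ} {s : Bool} {i : ι} {α : ι → ℤ} (hα : ht α = sg s * n)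
    {x z : Tilde A odd}
    (hx : x ∈ tildeWeight A odd α) (hz : z ∈ tildeWeight A odd (-α - rt s i))
    (h1 : tildeForm A odd x (tildeBr A odd (tg A odd s i) z) =
      -(koszul (par odd α) (odd i) * tildeForm A odd (tg A odd s i) (tildeBr A odd x z)))
    (h2 : ∀ y ∈ tildeWeight A odd (-α), tildeBr A odd x y = tildeForm A odd x y • tT A odd α) :
    tildeForm A odd (tildeBr A odd (tg A odd s i) x) z =
      tildeForm A odd (tg A odd s i) (tildeBr A odd x z) := by
  have h0 : ht (α + rt s i) ≠ 0 := by
    rw [ht_add, ht_rt, hα]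
    cases s <;> simp only [sg] <;> simp <;> omega
  rw [tildeForm_of_ht h0 (tildeBr_mem (tg_mem_rt s i) hx (add_comm _ _))
    (by rwa [neg_add, ← sub_eq_add_neg]), br_tg_br hx hz h1 h2, map_smul, hsum_tT, smul_eq_mul,
    mul_comm, mul_assoc, mul_inv_cancel₀ (Int.cast_ne_zero.2 h0), mul_one]

/-- The middle clause of `InvAt` follows from the other two, so each induction step has to establish
only those. -/
theorem invAt_of_br {n : ℕ}
    (h1 : ∀ s : Bool, ∀ α : ι → ℤ, ht α = sg s * n → ∀ x ∈ tildeWeight A odd α,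
      ∀ i, ∀ z ∈ tildeWeight A odd (-α - rt s i),
      tildeForm A odd x (tildeBr A odd (tg A odd s i) z) =
        -(koszul (par odd α) (odd i) * tildeForm A odd (tg A odd s i) (tildeBr A odd x z)))
    (h2 : ∀ s : Bool, ∀ α : ι → ℤ, ht α = sg s * n → ∀ x ∈ tildeWeight A odd α,
      ∀ y ∈ tildeWeight A odd (-α), tildeBr A odd x y = tildeForm A odd x y • tT A odd α) :
    InvAt A odd n := fun s α hα x hx =>
  ⟨fun i z hz => ⟨h1 s α hα x hx i z hz,
    tildeForm_tg_br hα hx hz (h1 s α hα x hx i z hz) (h2 s α hα x hx)⟩, h2 s α hα x hx⟩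

theorem invAt_zero : InvAt A odd 0 := by
  refine invAt_of_br (fun s α hα x hx i z hz => ?_) fun s α hα x hx y hy => ?_
  · by_cases h0 : α = 0
    · subst h0
      rw [neg_zero, zero_sub, ← rt_not] at hz
      obtain ⟨c, rfl⟩ := exists_smul_tg hz
      have e : x = ∑ k, hcoef A odd k x • th A odd k := eq_sum_hcoef hx
      rw [e, par_zero, koszul_false_left, one_mul]
      simp only [map_sum, LinearMap.sum_apply, map_smul,
        LinearMap.smul_apply, tg_tg_not, if_true, tildeForm_th_th, th_br _ (tg_mem_rt (!s) i),
        tildeForm_tg_tg, coroot_rt, sg_not, smul_eq_mul]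
      simp only [Finset.mul_sum]
      rw [← Finset.sum_neg_distrib]
      refine Finset.sum_congr rfl fun k _ => ?_
      push_cast
      linear_combination (-c * hcoef A odd k x * A k i * kap odd s i) * sg_mul_self_real s
    · rw [eq_zero_of_ht_eq_zero (by simpa using hα) h0 hx]
      simp
  · by_cases h0 : α = 0
    · subst h0
      rw [tT_zero, smul_zero]
      exact br_zero_zero hx (by simpa using hy)
    · rw [eq_zero_of_ht_eq_zero (by simpa using hα) h0 hx]
      simp

/-- An element of height ±(n + 1) is a combination of generators and of brackets of a generator with
an element of height ±n, to which `br_tg_br` applies. -/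
theorem br_eq_of_invAt {n : ℕ} (h : InvAt A odd n) (s : Bool) (α : ι → ℤ)
    (hα : ht α = sg s * (n + 1 : ℕ)) (x : Tilde A odd) (hx : x ∈ tildeWeight A odd α)
    (y : Tilde A odd) (hy : y ∈ tildeWeight A odd (-α)) :
    tildeBr A odd x y = tildeForm A odd x y • tT A odd α := by
  have hpos : 0 < sg s * ht α := by
    rw [hα, ← mul_assoc, sg_mul_self, one_mul]; positivity
  induction hx using @tildeWeight_word_induction _ _ _ _ _ s α hpos with
  | h0 => simp
  | hadd a b _ _ ha hb => simp only [map_add, LinearMap.add_apply, ha, hb, add_smul]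
  | hsmul c a _ ha => simp only [map_smul, LinearMap.smul_apply, ha, smul_assoc]
  | hof i hi =>
    change rt s i = α at hi
    subst hi
    rw [tg_br_opposite s i hy, tT_rt, smul_smul, mul_comm]
  | hcons i x hx _ =>
    change x ∈ tildeWeight A odd (α - rt s i) at hx
    have hα' : ht (α - rt s i) = sg s * n := by
      rw [ht_sub, hα, ht_rt]; push_cast; ring
    have hy' : y ∈ tildeWeight A odd (-(α - rt s i) - rt s i) := by
      rwa [neg_sub, sub_sub_cancel_left]
    obtain ⟨h1, h2⟩ := h s _ hα' x hx
    rw [br_tg_br hx hy' (h1 i y hy').1 h2, (h1 i y hy').2, sub_add_cancel]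

/-- The heart of the induction. As z has height ∓(n + 2), it is a combination of brackets ⁅F, z'⁆
with F a generator of the sign opposite to g. Moving F over to x leaves ⁅x, F⁆ and ⁅g, z'⁆, both of
height ±n, where invariance is already known. -/
theorem form_br_of_invAt (hA : ∀ i k, A i k = A k i) {n : ℕ} (h : InvAt A odd n) (s : Bool)
    (α : ι → ℤ) (hα : ht α = sg s * (n + 1 : ℕ)) (x : Tilde A odd) (hx : x ∈ tildeWeight A odd α)
    (i : ι) (z : Tilde A odd) (hz : z ∈ tildeWeight A odd (-α - rt s i)) :
    tildeForm A odd x (tildeBr A odd (tg A odd s i) z) =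
      -(koszul (par odd α) (odd i) *
        tildeForm A odd (tg A odd s i) (tildeBr A odd x z)) := by
  have hpos : 0 < sg (!s) * ht (-α - rt s i) := by
    rw [ht_sub, ht_neg, hα, ht_rt, sg_not]
    have : -sg s * (-(sg s * ((n + 1 : ℕ) : ℤ)) - sg s) = (sg s * sg s) * (n + 2) := by
      push_cast; ring
    rw [this, sg_mul_self]; positivity
  induction hz using @tildeWeight_word_induction _ _ _ _ _ (!s) _ hpos with
  | h0 => simp
  | hadd a b _ _ ha hb => simp only [map_add, ha, hb]; ring
  | hsmul c a _ ha => simp only [map_smul, ha, smul_eq_mul]; ring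
  | hof j hj =>
    have := congrArg (fun β => sg s * ht β) hj
    change sg s * ht (rt (!s) j) = _ at this
    simp only [ht_rt, sg_not, ht_sub, ht_neg, hα, mul_sub, mul_neg, ← mul_assoc, sg_mul_self] at this
    push_cast at this
    omega
  | hcons j z hz _ =>
    change z ∈ tildeWeight A odd (-α - rt s i - rt (!s) j) at hz
    set g := tg A odd s i with hg
    set F := tg A odd (!s) j with hF
    have hgm : g ∈ tildeWeight A odd (rt s i) := tg_mem_rt s i
    have hFm : F ∈ tildeWeight A odd (rt (!s) j) := tg_mem_rt (!s) j
    have hYm : tildeBr A odd g z ∈ tildeWeight A odd (-α - rt (!s) j) :=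
      tildeBr_mem hgm hz (by abel)
    have hxF : tildeBr A odd x F ∈ tildeWeight A odd (α + rt (!s) j) := tildeBr_mem hx hFm rfl
    have hαF : ht (α + rt (!s) j) = sg s * n := by
      rw [ht_add, hα, ht_rt, sg_not]; push_cast; ring
    have hαY : ht (-α - rt (!s) j) = sg (!s) * n := by
      rw [ht_sub, ht_neg, hα, ht_rt, sg_not]; push_cast; ring
    have hz' : z ∈ tildeWeight A odd (-(α + rt (!s) j) - rt s i) := mem_of_weight_eq hz (by abel)
    have i1 := (((h s _ hαF _ hxF).1 i z) hz').1
    have hx' : x ∈ tildeWeight A odd (-(-α - rt (!s) j) - rt (!s) j) := mem_of_weight_eq hx (by abel)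
    obtain ⟨i2, i3⟩ := ((h (!s) _ hαY _ hYm).1 j x) hx'
    have j1 := tildeForm_symm hA hx (tildeBr_mem hFm hYm (γ := -α) (by abel))
    have j2 := tildeForm_symm hA hYm hxF
    have j3 := tilde_skew hFm hx
    have k1 := tilde_jacobi hgm hFm z
    have k2 := tilde_jacobi hx hFm z
    rw [j3, map_neg, map_smul, j2] at i2
    rw [i3] at j1
    rw [eq_sub_iff_add_eq] at k1 k2
    rw [← k1, ← k2, map_add, map_add, map_smul, map_smul, j1]
    simp only [par_add, par_neg, par_sub, par_rt, smul_eq_mul] at i1 i2 ⊢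
    -- The contribution of ⁅g, F⁆ in the Jacobi identity. If i = j, this bracket is a multiple of
    -- h_i and acts by a scalar. If i ≠ j, it vanishes, and so does ⁅x, z⁆ on the right, whose
    -- degree is nonzero of height 0.
    have hd : tildeForm A odd x (tildeBr A odd (tildeBr A odd g F) z) =
        -(koszul (par odd α) (odd i) * (koszul (par odd α) (odd j) *
          tildeForm A odd g (tildeBr A odd F (tildeBr A odd x z)))) := by
      rw [hg, hF, tg_tg_not]
      split_ifs with hij
      · subst hij
        have hzα : z ∈ tildeWeight A odd (-α) := mem_of_weight_eq hz (by rw [rt_not]; abel)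
        rw [map_smul, LinearMap.smul_apply, map_smul, th_br i hzα,
          br_eq_of_invAt h s α hα x hx z hzα, coroot_neg]
        simp only [map_smul, tg_br_tT hA, map_neg, tildeForm_tg_tg, sg_not, smul_eq_mul]
        push_cast
        linear_combination (coroot A i α * kap odd s i * tildeForm A odd x z) *
          (koszul_mul_self (par odd α) (odd i)) + (coroot A i α * kap odd s i * tildeForm A odd x z *
            koszul (par odd α) (odd i) * koszul (par odd α) (odd i)) * sg_mul_self_real s
      · have hm := tildeBr_mem hx hz rfl
        rw [eq_zero_of_ht_eq_zero _ _ hm]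
        · simp
        · rw [ht_add, ht_sub, ht_sub, ht_neg, ht_rt, ht_rt, sg_not]; ring
        · intro h0
          have h1 : rt s i + rt (!s) j = 0 := by
            rw [← neg_eq_zero, ← h0]; abel
          have := congrFun h1 i
          have hs : sg s ≠ 0 := by cases s <;> decide
          simp [rt, hij, hs, sg_not] at this
    rw [hd]
    generalize tildeForm A odd (tildeBr A odd x F) (tildeBr A odd g z) = X1 at *
    generalize tildeForm A odd F (tildeBr A odd (tildeBr A odd g z) x) = X2 at *
    generalize tildeForm A odd g (tildeBr A odd (tildeBr A odd x F) z) = X3 at *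
    generalize tildeForm A odd g (tildeBr A odd F (tildeBr A odd x z)) = X4 at *
    clear hd j1 j2 j3 k1 k2 hxF hαF hαY hYm
    generalize par odd α = a at *
    generalize odd i = p at *
    generalize odd j = q at *
    cases a <;> cases p <;> cases q <;> simp [koszul] at i1 i2 ⊢ <;> linarith

theorem invAt (hA : ∀ i k, A i k = A k i) (n : ℕ) : InvAt A odd n := by
  induction n with
  | zero => exact invAt_zero
  | succ n ih => exact invAt_of_br (form_br_of_invAt hA ih) (br_eq_of_invAt ih)

theorem exists_sg_nat (k : ℤ) : ∃ (s : Bool) (n : ℕ), k = sg s * n := by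
  rcases le_total 0 k with h | h
  · exact ⟨true, k.toNat, by simp [sg, h]⟩
  · exact ⟨false, (-k).toNat, by simp [sg, h]⟩

/-- The bracket of elements of opposite degrees. -/
theorem br_eq_form_smul (hA : ∀ i k, A i k = A k i) {α : ι → ℤ} {x y : Tilde A odd}
    (hx : x ∈ tildeWeight A odd α) (hy : y ∈ tildeWeight A odd (-α)) :
    tildeBr A odd x y = tildeForm A odd x y • tT A odd α := by
  obtain ⟨s, n, h⟩ := exists_sg_nat (ht α)
  exact (invAt hA n s α h x hx).2 y hy

theorem form_tg_invariant (hA : ∀ i k, A i k = A k i) (s : Bool) (i : ι) {α γ : ι → ℤ}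
    {x z : Tilde A odd} (hx : x ∈ tildeWeight A odd α) (hz : z ∈ tildeWeight A odd γ) :
    tildeForm A odd (tildeBr A odd x (tg A odd s i)) z =
      tildeForm A odd x (tildeBr A odd (tg A odd s i) z) := by
  by_cases h : γ = -α - rt s i
  swap
  · rw [tildeForm_of_ne _ (tildeBr_mem hx (tg_mem_rt s i) rfl) hz,
      tildeForm_of_ne _ hx (tildeBr_mem (tg_mem_rt s i) hz rfl)]
    · intro h'; exact h (by rw [← sub_eq_zero, ← h']; abel)
    · intro h'; exact h (by rw [← sub_eq_zero, ← h']; abel)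
  subst h
  -- The heights of x and z add up to −`sg s`, so one of them is `sg s` times a natural number, and
  -- `invAt` applies to x or to z accordingly.
  obtain ⟨n, hn⟩ | ⟨n, hn⟩ : (∃ n : ℕ, ht α = sg s * n) ∨
      ∃ n : ℕ, ht (-α - rt s i) = sg s * n := by
    rw [ht_sub, ht_neg, ht_rt]
    cases s
    · rcases le_or_gt 0 (-ht α) with h | h
      · exact Or.inl ⟨(-ht α).toNat, by simp only [sg]; simp; omega⟩
      · exact Or.inr ⟨(ht α - 1).toNat, by simp only [sg]; simp; omega⟩
    · rcases le_or_gt 0 (ht α) with h | h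
      · exact Or.inl ⟨(ht α).toNat, by simp only [sg]; simp; omega⟩
      · exact Or.inr ⟨(-ht α - 1).toNat, by simp only [sg]; simp; omega⟩
  · obtain ⟨h1, h2⟩ := (invAt hA n s α hn x hx).1 i z hz
    rw [h1, tilde_skew hx (tg_mem_rt s i), map_neg, map_smul, LinearMap.neg_apply,
      LinearMap.smul_apply, h2, par_rt, smul_eq_mul]
  · have hx' : x ∈ tildeWeight A odd (-(-α - rt s i) - rt s i) := mem_of_weight_eq hx (by abel)
    obtain ⟨h1, h2⟩ := (invAt hA n s _ hn z hz).1 i x hx'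
    have e1 := tildeForm_symm hA (tildeBr_mem hx (tg_mem_rt s i) rfl) hz
    have e2 := tildeForm_symm hA hx (tildeBr_mem (tg_mem_rt s i) hz (γ := -α) (by abel))
    rw [e1, e2, h2, tilde_skew hx (tg_mem_rt s i), map_neg, map_smul, h1]
    simp only [par_add, par_neg, par_sub, par_rt, smul_eq_mul]
    generalize tildeForm A odd (tg A odd s i) (tildeBr A odd z x) = X
    generalize par odd α = a
    generalize odd i = p
    cases a <;> cases p <;> simp [koszul]

/-- By the Jacobi identity, invariance with middle arguments u and v implies it for ⁅u, v⁆ (`hmul`).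
So the e_i and f_i suffice, with h_i = ⁅e_i, f_i⁆. -/
theorem form_tm_invariant (hA : ∀ i k, A i k = A k i) (u : FreeMagma (Gen ι)) {α γ : ι → ℤ}
    {x z : Tilde A odd} (hx : x ∈ tildeWeight A odd α) (hz : z ∈ tildeWeight A odd γ) :
    tildeForm A odd (tildeBr A odd x (tm A odd u)) z =
      tildeForm A odd x (tildeBr A odd (tm A odd u) z) := by
  have hmul : ∀ (u v : Tilde A odd) (β δ : ι → ℤ), u ∈ tildeWeight A odd β →
      v ∈ tildeWeight A odd δ →
      (∀ α γ, ∀ x ∈ tildeWeight A odd α, ∀ z ∈ tildeWeight A odd γ,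
        tildeForm A odd (tildeBr A odd x u) z = tildeForm A odd x (tildeBr A odd u z)) →
      (∀ α γ, ∀ x ∈ tildeWeight A odd α, ∀ z ∈ tildeWeight A odd γ,
        tildeForm A odd (tildeBr A odd x v) z = tildeForm A odd x (tildeBr A odd v z)) →
      ∀ α γ, ∀ x ∈ tildeWeight A odd α, ∀ z ∈ tildeWeight A odd γ,
        tildeForm A odd (tildeBr A odd x (tildeBr A odd u v)) z =
          tildeForm A odd x (tildeBr A odd (tildeBr A odd u v) z) := by
    intro u v β δ hu hv h1 h2 α γ x hx z hz
    have e1 := tilde_jacobi hx hu v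
    rw [eq_sub_iff_add_eq] at e1
    have e2 := tilde_skew hu (tildeBr_mem hx hv rfl)
    rw [← e1, e2, map_add, LinearMap.add_apply, h2 _ _ _ (tildeBr_mem hx hu rfl) _ hz,
      h1 _ _ _ hx _ (tildeBr_mem hv hz rfl), tilde_jacobi hu hv, map_sub, map_smul]
    rw [map_smul, map_neg, map_smul, LinearMap.smul_apply, LinearMap.neg_apply,
      LinearMap.smul_apply, h1 _ _ _ (tildeBr_mem hx hv rfl) _ hz,
      h2 _ _ _ hx _ (tildeBr_mem hu hz rfl)]
    simp only [smul_eq_mul, par_add]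
    generalize par odd α = a
    generalize par odd β = b
    generalize par odd δ = c
    cases a <;> cases b <;> cases c <;> simp [koszul] <;> ring
  induction u generalizing α γ x z with
  | ih1 y =>
    cases y with
    | e i => exact form_tg_invariant hA true i hx hz
    | f i => exact form_tg_invariant hA false i hx hz
    | h i =>
      have h := tg_tg_not (A := A) (odd := odd) true i i
      rw [if_pos rfl, kap, if_pos rfl, one_smul] at h
      change tildeForm A odd (tildeBr A odd x (th A odd i)) z =
        tildeForm A odd x (tildeBr A odd (th A odd i) z)
      rw [← h]
      exact hmul _ _ _ _ (tg_mem_rt true i) (tg_mem_rt false i)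
        (fun _ _ _ hx _ hz => form_tg_invariant hA true i hx hz)
        (fun _ _ _ hx _ hz => form_tg_invariant hA false i hx hz) _ _ x hx z hz
  | ih2 u v hu hv =>
    rw [← tildeBr_tm]
    exact hmul _ _ _ _ (tm_mem u rfl) (tm_mem v rfl) (fun _ _ _ hx _ hz => hu hx hz)
      (fun _ _ _ hx _ hz => hv hx hz) _ _ x hx z hz

theorem tildeForm_invariant (hA : ∀ i k, A i k = A k i) (x y z : Tilde A odd) :
    tildeForm A odd (tildeBr A odd x y) z = tildeForm A odd x (tildeBr A odd y z) := by
  induction x using tilde_induction with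
  | h0 => simp
  | hadd a b ha hb => simp only [map_add, LinearMap.add_apply, ha, hb]
  | hsmul c a ha => simp only [map_smul, LinearMap.smul_apply, ha]
  | hmon u =>
    induction y using tilde_induction with
    | h0 => simp
    | hadd a b ha hb => simp only [map_add, LinearMap.add_apply, ha, hb]
    | hsmul c a ha => simp only [map_smul, LinearMap.smul_apply, ha]
    | hmon v =>
      induction z using tilde_induction with
      | h0 => simp
      | hadd a b ha hb => simp only [map_add, ha, hb]
      | hsmul c a ha => simp only [map_smul, ha]
      | hmon w => exact form_tm_invariant hA v (tm_mem u rfl) (tm_mem w rfl)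

end Form

end TensorHierarchy
end

noncomputable section
set_option linter.unusedSectionVars false
namespace TensorHierarchy
open scoped TensorProduct

/-! ### The invariant form on `Borcherds` -/

section BorcherdsForm

variable {ι : Type} [DecidableEq ι] [Fintype ι] {A : Matrix ι ι ℤ} {odd : ι → Bool}

theorem tildeWeight_zero_le : tildeWeight A odd 0 ≤ tildeCartan A odd := fun x hx => by
  rw [eq_sum_hcoef hx]
  exact sum_mem fun i _ => Submodule.smul_mem _ _ (Submodule.subset_span ⟨i, rfl⟩)

theorem tildeCartan_le : tildeCartan A odd ≤ tildeWeight A odd 0 :=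
  Submodule.span_le.2 (by rintro _ ⟨i, rfl⟩; exact th_mem i)

theorem th_ne_zero (i : ι) : th A odd i ≠ 0 := fun h => by
  have := congrArg (hcoef A odd i) h
  simp [hcoef_th] at this

/-- If an ideal meets the Cartan subalgebra trivially, a multiple of f_i in it must vanish, since
its bracket with e_i is a multiple of h_i. So its homogeneous elements are orthogonal to all
generators, and then to all monomials by invariance. -/
theorem tildeForm_eq_zero_of_mem_maxIdeal (hA : ∀ i k, A i k = A k i) {x : Tilde A odd}
    (hx : x ∈ maxIdeal A odd) (y : Tilde A odd) : tildeForm A odd x y = 0 := by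
  suffices h : maxIdeal A odd ≤ LinearMap.ker (tildeForm A odd) by
    have := h hx
    rw [LinearMap.mem_ker] at this
    rw [this, LinearMap.zero_apply]
  refine sSup_le ?_
  rintro I ⟨h1, h2, h3⟩ x hx
  have key : ∀ (u : FreeMagma (Gen ι)) (α : ι → ℤ) (x : Tilde A odd), x ∈ I →
      x ∈ tildeWeight A odd α → tildeForm A odd x (tm A odd u) = 0 := by
    intro u
    have hg : ∀ s i (α : ι → ℤ) (x : Tilde A odd), x ∈ I →
        x ∈ tildeWeight A odd α → tildeForm A odd x (tg A odd s i) = 0 := by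
      intro s i α x hxI hx
      by_cases h : α + rt s i = 0
      · obtain rfl : α = rt (!s) i := by rw [rt_not]; exact eq_neg_of_add_eq_zero_left h
        obtain ⟨c, rfl⟩ := exists_smul_tg hx
        have h5 := (h1 (tg A odd s i) _ hxI).1
        rw [map_smul, tg_tg_not, if_pos rfl, smul_smul] at h5
        have h6 : (c * kap odd s i) • th A odd i ∈ I ⊓ tildeCartan A odd :=
          ⟨h5, Submodule.smul_mem _ _ (Submodule.subset_span ⟨i, rfl⟩)⟩
        rw [h3, Submodule.mem_bot, smul_eq_zero] at h6
        have h7 := (mul_eq_zero.1 (h6.resolve_right (th_ne_zero i))).resolve_right (kap_ne_zero s i)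
        rw [h7, zero_smul, map_zero, LinearMap.zero_apply]
      · exact tildeForm_of_ne h hx (tg_mem_rt s i)
    induction u with
    | ih1 y =>
      cases y with
      | e i => exact hg true i
      | f i => exact hg false i
      | h i =>
        intro α x hxI hx
        by_cases h : α = 0
        · subst h
          have h6 : x ∈ I ⊓ tildeCartan A odd := ⟨hxI, tildeWeight_zero_le hx⟩
          rw [h3, Submodule.mem_bot] at h6
          rw [h6, map_zero, LinearMap.zero_apply]
        · exact tildeForm_of_ne (by rwa [add_zero]) hx (th_mem i)
    | ih2 u v hu hv =>
      intro α x hxI hx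
      rw [← tildeBr_tm, ← tildeForm_invariant hA]
      exact hv _ _ (h1 _ _ hxI).2 (tildeBr_mem hx (tm_mem u rfl) rfl)
  have h4 : (⨆ α, I ⊓ tildeWeight A odd α) ≤ LinearMap.ker (tildeForm A odd) :=
    iSup_le fun α x hx => LinearMap.mem_ker.2 (tilde_hom_ext fun u => key u α x hx.1 hx.2)
  exact h4 (h2 hx)

/-- The radical elements of nonzero degree span an ideal: a bracket that lands in degree 0 equals
⟨y|u⟩ t_α = 0, and the others stay in the radical by invariance. This ideal has no part in degree 0,
so it lies in the maximal one. -/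
theorem mem_maxIdeal (hA : ∀ i k, A i k = A k i) {α : ι → ℤ} (hα : α ≠ 0) {x : Tilde A odd}
    (hx : x ∈ tildeWeight A odd α) (h : ∀ y ∈ tildeWeight A odd (-α), tildeForm A odd x y = 0) :
    x ∈ maxIdeal A odd := by
  have hmem : ∀ α x, x ∈ tildeWeight A odd α →
      (∀ y ∈ tildeWeight A odd (-α), tildeForm A odd x y = 0) →
      ∀ y, tildeForm A odd x y = 0 := by
    intro α x hx h y
    induction y using tilde_induction with
    | h0 => simp
    | hadd a b ha hb => rw [map_add, ha, hb, add_zero]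
    | hsmul c a ha => rw [map_smul, ha, smul_zero]
    | hmon u =>
      by_cases h' : α + monWeight u = 0
      · exact h _ (tm_mem u (eq_neg_of_add_eq_zero_right h'))
      · exact tildeForm_of_ne h' hx (tm_mem u rfl)
  let s : Set (Tilde A odd) :=
    {x | ∃ α, α ≠ 0 ∧ x ∈ tildeWeight A odd α ∧ ∀ y, tildeForm A odd x y = 0}
  have hJ : Submodule.span ℝ s ≤ maxIdeal A odd := by
    refine le_sSup ⟨?_, ?_, ?_⟩
    · have key : ∀ (u : FreeMagma (Gen ι)), ∀ y ∈ s, tildeBr A odd y (tm A odd u) ∈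
          Submodule.span ℝ s := by
        rintro u y ⟨α, hα, hy, h⟩
        have hm := tildeBr_mem hy (tm_mem u rfl) rfl
        by_cases h' : α + monWeight u = 0
        · rw [br_eq_form_smul hA hy (tm_mem u (eq_neg_of_add_eq_zero_right h')), h, zero_smul]
          exact zero_mem _
        · exact Submodule.subset_span ⟨_, h', hm, fun z => by rw [tildeForm_invariant hA, h]⟩
      have key2 : ∀ x, ∀ y ∈ s, tildeBr A odd x y ∈ Submodule.span ℝ s ∧
          tildeBr A odd y x ∈ Submodule.span ℝ s := by
        intro x y hy
        induction x using tilde_induction with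
        | h0 => simp
        | hadd a b ha hb =>
          rw [map_add, map_add, LinearMap.add_apply]
          exact ⟨add_mem ha.1 hb.1, add_mem ha.2 hb.2⟩
        | hsmul c a ha =>
          rw [map_smul, map_smul, LinearMap.smul_apply]
          exact ⟨Submodule.smul_mem _ _ ha.1, Submodule.smul_mem _ _ ha.2⟩
        | hmon u =>
          refine ⟨?_, key u y hy⟩
          obtain ⟨α, -, hy', -⟩ := id hy
          rw [tilde_skew (tm_mem u rfl) hy']
          exact neg_mem (Submodule.smul_mem _ _ (key u y hy))
      intro x y hy
      induction hy using Submodule.span_induction with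
      | zero => simp
      | add a b _ _ ha hb =>
        rw [map_add, map_add, LinearMap.add_apply]
        exact ⟨add_mem ha.1 hb.1, add_mem ha.2 hb.2⟩
      | smul c a _ ha =>
        rw [map_smul, map_smul, LinearMap.smul_apply]
        exact ⟨Submodule.smul_mem _ _ ha.1, Submodule.smul_mem _ _ ha.2⟩
      | mem y hy => exact key2 x y hy
    · refine Submodule.span_le.2 fun y hy => ?_
      obtain ⟨α, -, hy', -⟩ := id hy
      exact Submodule.mem_iSup_of_mem α ⟨Submodule.subset_span hy, hy'⟩
    · rw [eq_bot_iff]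
      rintro y ⟨hy, hy0⟩
      have h1 : tildeDiag (ind 0) y = 0 := by
        change y ∈ Submodule.span ℝ s at hy
        clear hy0
        induction hy using Submodule.span_induction with
        | zero => simp
        | add a b _ _ ha hb => rw [map_add, ha, hb, add_zero]
        | smul c a _ ha => rw [map_smul, ha, smul_zero]
        | mem y hy =>
          obtain ⟨α, hα, hy', -⟩ := hy
          rw [tildeDiag_of_mem _ hy']
          simp [ind, hα]
      rw [tildeDiag_of_mem _ (tildeCartan_le hy0)] at h1
      simpa [ind] using h1
  exact hJ (Submodule.subset_span ⟨α, hα, hx, hmem α x hx h⟩)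

/-- Only the component of y of degree −α contributes, and its parity is that of α. -/
theorem tildeForm_symm_of_mem (hA : ∀ i k, A i k = A k i) {α : ι → ℤ} {x : Tilde A odd}
    (hx : x ∈ tildeWeight A odd α) (y : Tilde A odd) :
    tildeForm A odd x y = koszul (par odd α) (par odd α) * tildeForm A odd y x := by
  induction y using tilde_induction with
  | h0 => simp
  | hadd a b ha hb => rw [map_add, map_add, LinearMap.add_apply, ha, hb]; ring
  | hsmul c a ha =>
    rw [map_smul, map_smul, LinearMap.smul_apply, ha, smul_eq_mul, smul_eq_mul]; ring
  | hmon u =>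
    by_cases h : α + monWeight u = 0
    · have hu := tm_mem (A := A) (odd := odd) u (eq_neg_of_add_eq_zero_right h)
      rw [tildeForm_symm hA hx hu, par_neg]
    · rw [tildeForm_of_ne h hx (tm_mem u rfl),
        tildeForm_of_ne (by rwa [add_comm]) (tm_mem u rfl) hx, mul_zero]

theorem tildeForm_eq_zero_of_mem_maxIdeal' (hA : ∀ i k, A i k = A k i) {x : Tilde A odd}
    (hx : x ∈ maxIdeal A odd) (y : Tilde A odd) : tildeForm A odd y x = 0 := by
  induction y using tilde_induction with
  | h0 => simp
  | hadd a b ha hb => rw [map_add, LinearMap.add_apply, ha, hb, add_zero]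
  | hsmul c a ha => rw [map_smul, LinearMap.smul_apply, ha, smul_zero]
  | hmon u =>
    rw [tildeForm_symm_of_mem hA (tm_mem u rfl), tildeForm_eq_zero_of_mem_maxIdeal hA hx, mul_zero]

/-- The invariant form on `Borcherds A odd`. -/
def borcherdsForm (hA : ∀ i k, A i k = A k i) :
    Borcherds A odd →ₗ[ℝ] Borcherds A odd →ₗ[ℝ] ℝ :=
  (maxIdeal A odd).liftQ
    { toFun := fun x => (maxIdeal A odd).liftQ (tildeForm A odd x) fun y hy =>
        tildeForm_eq_zero_of_mem_maxIdeal' hA hy x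
      map_add' := fun x y => Submodule.linearMap_qext _ (LinearMap.ext fun z =>
        LinearMap.congr_fun (map_add (tildeForm A odd) x y) z)
      map_smul' := fun c x => Submodule.linearMap_qext _ (LinearMap.ext fun z =>
        LinearMap.congr_fun (map_smul (tildeForm A odd) c x) z) }
    fun x hx => LinearMap.mem_ker.2 (Submodule.linearMap_qext _ (LinearMap.ext fun y =>
      tildeForm_eq_zero_of_mem_maxIdeal hA hx y))

theorem borcherdsForm_mk (hA : ∀ i k, A i k = A k i) (x y : Tilde A odd) :
    borcherdsForm hA ((maxIdeal A odd).mkQ x) ((maxIdeal A odd).mkQ y) = tildeForm A odd x y := rfl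

theorem proj_mon (u : FreeMagma (Gen ι)) : proj A odd (mon u) = (maxIdeal A odd).mkQ (tm A odd u) :=
  rfl

theorem proj_mem_level {j : ι} {p : ℤ} {u : FreeMagma (Gen ι)} (h : monWeight u j = -p) :
    proj A odd (mon u) ∈ level A odd j p := Submodule.subset_span ⟨u, h, rfl⟩

theorem level_induction {j : ι} {k : ℤ} {p : (a : Borcherds A odd) → a ∈ level A odd j k → Prop}
    {a : Borcherds A odd}
    (ha : a ∈ level A odd j k) (h0 : p 0 (zero_mem _))
    (hadd : ∀ a b ha hb, p a ha → p b hb → p (a + b) (add_mem ha hb))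
    (hsmul : ∀ (c : ℝ) a ha, p a ha → p (c • a) (Submodule.smul_mem _ c ha))
    (hmon : ∀ u (hu : monWeight u j = -k), p (proj A odd (mon u)) (proj_mem_level hu)) : p a ha := by
  induction ha using Submodule.span_induction with
  | zero => exact h0
  | add x y _ _ hx hy => exact hadd _ _ _ _ hx hy
  | smul c x _ hx => exact hsmul _ _ _ hx
  | mem x hx => obtain ⟨u, hu, rfl⟩ := hx; exact hmon u hu

theorem parityPart_induction {s : Bool}
    {p : (a : Borcherds A odd) → a ∈ parityPart A odd s → Prop} {a : Borcherds A odd}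
    (ha : a ∈ parityPart A odd s) (h0 : p 0 (zero_mem _))
    (hadd : ∀ a b ha hb, p a ha → p b hb → p (a + b) (add_mem ha hb))
    (hsmul : ∀ (c : ℝ) a ha, p a ha → p (c • a) (Submodule.smul_mem _ c ha))
    (hmon : ∀ u (hu : monParity odd u = s),
      p (proj A odd (mon u)) (Submodule.subset_span ⟨u, hu, rfl⟩)) : p a ha := by
  induction ha using Submodule.span_induction with
  | zero => exact h0
  | add x y _ _ hx hy => exact hadd _ _ _ _ hx hy
  | smul c x _ hx => exact hsmul _ _ _ hx
  | mem x hx => obtain ⟨u, hu, rfl⟩ := hx; exact hmon u hu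

theorem borcherdsForm_standard (hA : ∀ i k, A i k = A k i) (j : ι) :
    IsStandardForm A odd j (borcherdsForm hA) where
  hh i k := tildeForm_th_th i k
  ef i k := by
    change tildeForm A odd (tg A odd true i) (tg A odd false k) = _
    split_ifs with h
    · subst h
      have := tildeForm_tg_tg (A := A) (odd := odd) true i
      simpa [sg, kap] using this
    · refine tildeForm_of_ne (fun h' => ?_) (tg_mem_rt true i) (tg_mem_rt false k)
      have := congrFun h' i
      simp [rt, sg, h] at this
  ee i k := by
    refine tildeForm_of_ne (fun h' => ?_) (tg_mem_rt true i) (tg_mem_rt true k)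
    have := congrArg ht h'
    rw [ht_add, ht_rt, ht_rt] at this
    simp [sg, ht] at this
  ff i k := by
    refine tildeForm_of_ne (fun h' => ?_) (tg_mem_rt false i) (tg_mem_rt false k)
    have := congrArg ht h'
    rw [ht_add, ht_rt, ht_rt] at this
    simp [sg, ht] at this
  invariant x y z := by
    obtain ⟨x, rfl⟩ := Submodule.mkQ_surjective _ x
    obtain ⟨y, rfl⟩ := Submodule.mkQ_surjective _ y
    obtain ⟨z, rfl⟩ := Submodule.mkQ_surjective _ z
    exact tildeForm_invariant hA x y z
  supersymm s t x hx y hy := by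
    induction hx using parityPart_induction with
    | h0 => simp
    | hadd a b _ _ ha hb => rw [map_add, LinearMap.add_apply, map_add, ha, hb, mul_add]
    | hsmul c a _ ha =>
      rw [map_smul, LinearMap.smul_apply, map_smul, ha, smul_eq_mul, smul_eq_mul]; ring
    | hmon u hu =>
      induction hy using parityPart_induction with
      | h0 => simp
      | hadd a b _ _ ha hb => rw [map_add, map_add, LinearMap.add_apply, ha, hb, mul_add]
      | hsmul c a _ ha =>
        rw [map_smul, map_smul, LinearMap.smul_apply, ha, smul_eq_mul, smul_eq_mul]; ring
      | hmon v hv =>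
        rw [← hu, ← hv, monParity_eq, monParity_eq]
        exact tildeForm_symm hA (tm_mem u rfl) (tm_mem v rfl)
  graded p q hpq x hx y hy := by
    induction hx using level_induction with
    | h0 => simp
    | hadd a b _ _ ha hb => rw [map_add, LinearMap.add_apply, ha, hb, add_zero]
    | hsmul c a _ ha => rw [map_smul, LinearMap.smul_apply, ha, smul_zero]
    | hmon u hu =>
      induction hy using level_induction with
      | h0 => simp
      | hadd a b _ _ ha hb => rw [map_add, ha, hb, add_zero]
      | hsmul c a _ ha => rw [map_smul, ha, smul_zero]
      | hmon v hv =>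
        refine tildeForm_of_ne (fun h => hpq ?_) (tm_mem u rfl) (tm_mem v rfl)
        have := congrFun h j
        rw [Pi.add_apply, hu, hv, Pi.zero_apply] at this
        omega

/-- A lift of x to `Tilde` can be chosen with components only in degrees α with α_j = −p. These are
nonzero degrees because p ≠ 0, so orthogonality puts each component into the maximal ideal. -/
theorem eq_zero_of_borcherdsForm (hA : ∀ i k, A i k = A k i) {j : ι} {p : ℤ} (hp : p ≠ 0)
    {x : Borcherds A odd} (hx : x ∈ level A odd j p)
    (h : ∀ y ∈ level A odd j (-p), borcherdsForm hA x y = 0) : x = 0 := by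
  have hlift : ∃ x' : Tilde A odd, (maxIdeal A odd).mkQ x' = x ∧
      ∀ α : ι → ℤ, α j ≠ -p → tildeDiag (ind α) x' = 0 := by
    clear h
    induction hx using level_induction with
    | h0 => exact ⟨0, by simp⟩
    | hadd a b _ _ ha hb =>
      obtain ⟨a', rfl, ha⟩ := ha
      obtain ⟨b', rfl, hb⟩ := hb
      exact ⟨a' + b', map_add _ _ _, fun α hα => by rw [map_add, ha α hα, hb α hα, add_zero]⟩
    | hsmul c a _ ha =>
      obtain ⟨a', rfl, ha⟩ := ha
      exact ⟨c • a', map_smul _ _ _, fun α hα => by rw [map_smul, ha α hα, smul_zero]⟩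
    | hmon u hu =>
      refine ⟨tm A odd u, rfl, fun α hα => ?_⟩
      have : monWeight u ≠ α := by rintro rfl; exact hα hu
      simp [ind, this]
  obtain ⟨x', rfl, hx'⟩ := hlift
  obtain ⟨T, hT⟩ := tilde_eq_sum x'
  have hmem : ∀ α, tildeDiag (ind α) x' ∈ maxIdeal A odd := by
    intro α
    by_cases hα : α j = -p
    · refine mem_maxIdeal hA (α := α) ?_ (tildeDiag_ind_mem α x') fun y hy => ?_
      · rintro rfl; rw [Pi.zero_apply] at hα; omega
      · have h1 : ∀ z, tildeForm A odd (tildeDiag (ind α) z) y = tildeForm A odd z y := by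
          intro z
          induction z using tilde_induction with
          | h0 => simp
          | hadd a b ha hb => simp only [map_add, LinearMap.add_apply, ha, hb]
          | hsmul c a ha => simp only [map_smul, LinearMap.smul_apply, ha]
          | hmon u =>
            rw [tildeDiag_tm, ind]
            split_ifs with hu
            · rw [one_smul]
            · rw [zero_smul, map_zero, LinearMap.zero_apply, tildeForm_of_ne _ (tm_mem u rfl) hy]
              rwa [← sub_eq_add_neg, sub_ne_zero]
        rw [h1, ← borcherdsForm_mk hA]
        refine h _ ?_
        clear h1
        induction hy using tildeWeight_induction with
        | h0 => simp
        | hadd a b _ _ ha hb => rw [map_add]; exact add_mem ha hb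
        | hsmul c a _ ha => rw [map_smul]; exact Submodule.smul_mem _ _ ha
        | hmon u hu => exact proj_mem_level (by rw [hu, Pi.neg_apply, hα])
    · rw [hx' α hα]; exact zero_mem _
  rw [hT]
  exact (Submodule.Quotient.mk_eq_zero _).2 (sum_mem fun α _ => hmem α)

/-! ### Identities in `Borcherds` -/

theorem add_bracket (x y z : Borcherds A odd) : ⁅x + y, z⁆ = ⁅x, z⁆ + ⁅y, z⁆ := by
  simp only [bracket_def, map_add, LinearMap.add_apply]

theorem bracket_add (x y z : Borcherds A odd) : ⁅x, y + z⁆ = ⁅x, y⁆ + ⁅x, z⁆ := by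
  simp only [bracket_def, map_add]

theorem smul_bracket (c : ℝ) (x y : Borcherds A odd) : ⁅c • x, y⁆ = c • ⁅x, y⁆ := by
  simp only [bracket_def, map_smul, LinearMap.smul_apply]

theorem bracket_smul (c : ℝ) (x y : Borcherds A odd) : ⁅x, c • y⁆ = c • ⁅x, y⁆ := by
  simp only [bracket_def, map_smul]

theorem zero_bracket (x : Borcherds A odd) : ⁅(0 : Borcherds A odd), x⁆ = 0 := by
  simp only [bracket_def, map_zero, LinearMap.zero_apply]

theorem bracket_zero (x : Borcherds A odd) : ⁅x, (0 : Borcherds A odd)⁆ = 0 := by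
  simp only [bracket_def, map_zero]

theorem neg_bracket (x y : Borcherds A odd) : ⁅-x, y⁆ = -⁅x, y⁆ := by
  simp only [bracket_def, map_neg, LinearMap.neg_apply]

theorem borcherds_induction {p : Borcherds A odd → Prop} (a : Borcherds A odd) (h0 : p 0)
    (hadd : ∀ a b, p a → p b → p (a + b)) (hsmul : ∀ (c : ℝ) a, p a → p (c • a))
    (hmon : ∀ u, p (proj A odd (mon u))) : p a := by
  obtain ⟨a, rfl⟩ := proj_surjective a
  induction a using free_induction with
  | h0 => rwa [map_zero]
  | hadd a b ha hb => rw [map_add]; exact hadd _ _ ha hb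
  | hsmul c a ha => rw [map_smul]; exact hsmul _ _ ha
  | hmon u => exact hmon u

theorem super_skew {s t : Bool} {x y : Borcherds A odd} (hx : x ∈ parityPart A odd s)
    (hy : y ∈ parityPart A odd t) : ⁅x, y⁆ = -(koszul s t • ⁅y, x⁆) := by
  induction hx using parityPart_induction with
  | h0 => simp [zero_bracket, bracket_zero]
  | hadd a b _ _ ha hb => rw [add_bracket, bracket_add, ha, hb]; module
  | hsmul c a _ ha => rw [smul_bracket, bracket_smul, ha]; module
  | hmon u hu =>
    induction hy using parityPart_induction with
    | h0 => simp [zero_bracket, bracket_zero]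
    | hadd a b _ _ ha hb => rw [add_bracket, bracket_add, ha, hb]; module
    | hsmul c a _ ha => rw [smul_bracket, bracket_smul, ha]; module
    | hmon v hv =>
      have := proj_rel (Rel.skew (A := A) (odd := odd) u v)
      rw [map_add, map_smul, hu, hv] at this
      rw [proj_mon_bracket, proj_mon_bracket]
      exact eq_neg_of_add_eq_zero_left this

theorem super_jacobi {s t : Bool} {x y : Borcherds A odd} (hx : x ∈ parityPart A odd s)
    (hy : y ∈ parityPart A odd t) (z : Borcherds A odd) :
    ⁅⁅x, y⁆, z⁆ = ⁅x, ⁅y, z⁆⁆ - koszul s t • ⁅y, ⁅x, z⁆⁆ := by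
  induction hx using parityPart_induction with
  | h0 => simp [zero_bracket, bracket_zero]
  | hadd a b _ _ ha hb => simp only [add_bracket, bracket_add, ha, hb]; module
  | hsmul c a _ ha => simp only [smul_bracket, bracket_smul, ha]; module
  | hmon u hu =>
    induction hy using parityPart_induction with
    | h0 => simp [zero_bracket, bracket_zero]
    | hadd a b _ _ ha hb => simp only [add_bracket, bracket_add, ha, hb]; module
    | hsmul c a _ ha => simp only [smul_bracket, bracket_smul, ha]; module
    | hmon v hv =>
      induction z using borcherds_induction with
      | h0 => simp [bracket_zero]
      | hadd a b ha hb => simp only [bracket_add, ha, hb]; module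
      | hsmul c a ha => simp only [bracket_smul, ha]; module
      | hmon w =>
        have := proj_rel (Rel.jacobi (A := A) (odd := odd) u v w)
        rw [map_sub, map_sub, map_smul, hu, hv] at this
        simp only [proj_mon_bracket]
        exact sub_eq_zero.1 this

theorem mem_parity_sup (x : Borcherds A odd) :
    ∃ a ∈ parityPart A odd false, ∃ b ∈ parityPart A odd true, x = a + b := by
  induction x using borcherds_induction with
  | h0 => exact ⟨0, zero_mem _, 0, zero_mem _, by simp⟩
  | hadd x y hx hy =>
    obtain ⟨a, ha, b, hb, rfl⟩ := hx
    obtain ⟨a', ha', b', hb', rfl⟩ := hy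
    exact ⟨a + a', add_mem ha ha', b + b', add_mem hb hb', by abel⟩
  | hsmul c x hx =>
    obtain ⟨a, ha, b, hb, rfl⟩ := hx
    exact ⟨c • a, Submodule.smul_mem _ _ ha, c • b, Submodule.smul_mem _ _ hb, smul_add _ _ _⟩
  | hmon u =>
    cases h : monParity odd u
    · exact ⟨_, Submodule.subset_span ⟨u, h, rfl⟩, 0, zero_mem _, (add_zero _).symm⟩
    · exact ⟨0, zero_mem _, _, Submodule.subset_span ⟨u, h, rfl⟩, (zero_add _).symm⟩

/-- Even elements act by derivations. -/
theorem even_leibniz {z : Borcherds A odd} (hz : z ∈ parityPart A odd false)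
    (x y : Borcherds A odd) : ⁅z, ⁅x, y⁆⁆ = ⁅⁅z, x⁆, y⁆ + ⁅x, ⁅z, y⁆⁆ := by
  obtain ⟨a, ha, b, hb, rfl⟩ := mem_parity_sup x
  have h1 := super_jacobi hz ha y
  have h2 := super_jacobi hz hb y
  rw [koszul_false_left, one_smul, eq_sub_iff_add_eq] at h1 h2
  rw [add_bracket, bracket_add, ← h1, ← h2, bracket_add, add_bracket, add_bracket]
  abel

theorem even_skew {z : Borcherds A odd} (hz : z ∈ parityPart A odd false)
    (x : Borcherds A odd) : ⁅x, z⁆ = -⁅z, x⁆ := by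
  obtain ⟨a, ha, b, hb, rfl⟩ := mem_parity_sup x
  rw [add_bracket, bracket_add, super_skew ha hz, super_skew hb hz, koszul_false_right,
    koszul_false_right, one_smul, one_smul, neg_add]

end BorcherdsForm

end TensorHierarchy
end

noncomputable section
set_option linter.unusedSectionVars false
namespace TensorHierarchy
open scoped TensorProduct

/-! ### Generation of the levels and uniqueness of the form -/

section Levels

variable {ι : Type} [DecidableEq ι] [Fintype ι] {A : Matrix ι ι ℤ} {odd : ι → Bool}

variable (A odd) in
/-- The generator `e_i` (`s = true`) or `f_i` (`s = false`) of `Borcherds A odd`. -/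
def bg (s : Bool) (i : ι) : Borcherds A odd := proj A odd (gen (ef s i))

theorem bg_true (i : ι) : bg A odd true i = gE A odd i := rfl

theorem bg_mem_level_self (s : Bool) (j : ι) : bg A odd s j ∈ level A odd j (-sg s) :=
  proj_mem_level (by rw [monWeight_ef]; simp)

theorem bg_mem_level_zero (s : Bool) {i j : ι} (h : i ≠ j) : bg A odd s i ∈ level A odd j 0 :=
  proj_mem_level (by rw [monWeight_ef]; simp [h.symm])

theorem bg_mem_parity (s : Bool) (i : ι) : bg A odd s i ∈ parityPart A odd (odd i) :=
  Submodule.subset_span ⟨_, by cases s <;> rfl, rfl⟩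

theorem gH_mem_parity (i : ι) : gH A odd i ∈ parityPart A odd false :=
  Submodule.subset_span ⟨_, rfl, rfl⟩

theorem gH_mem_level (i j : ι) : gH A odd i ∈ level A odd j 0 :=
  proj_mem_level rfl

theorem gE_gF (i k : ι) : ⁅gE A odd i, gF A odd k⁆ = if i = k then gH A odd k else 0 := by
  have := proj_rel (Rel.ef (A := A) (odd := odd) i k)
  rw [map_sub, sub_eq_zero] at this
  rw [gE, gF, proj_bracket, this]
  split_ifs <;> simp [gH]

theorem gH_gE (i k : ι) : ⁅gH A odd i, gE A odd k⁆ = (A i k : ℝ) • gE A odd k := by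
  have := proj_rel (Rel.he (A := A) (odd := odd) i k)
  rwa [map_sub, sub_eq_zero, map_smul] at this

theorem gH_gF (i k : ι) : ⁅gH A odd i, gF A odd k⁆ = -((A i k : ℝ) • gF A odd k) := by
  have := proj_rel (Rel.hf (A := A) (odd := odd) i k)
  rwa [map_add, map_smul, add_eq_zero_iff_eq_neg] at this

theorem proj_word_cons (s : Bool) (i : ι) (w : FreeMagma (Gen ι)) :
    proj A odd (mon (.of (ef s i) * w)) = ⁅bg A odd s i, proj A odd (mon w)⁆ :=
  (proj_mon_bracket _ _).symm

/-- In the triangular decomposition the words of the opposite type contribute the wrong sign at the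
node j, and the h_i contribute 0. -/
theorem level_le_of_word {s : Bool} {j : ι} {k : ℤ} (hk : 0 < k) {P : Submodule ℝ (Borcherds A odd)}
    (h : ∀ u, IsWord s u → monWeight u j = sg s * k → proj A odd (mon u) ∈ P) :
    level A odd j (-(sg s * k)) ≤ P := by
  refine Submodule.span_le.2 ?_
  rintro _ ⟨u, hu, rfl⟩
  rw [neg_neg] at hu
  have key : ∀ t, wordSpan A odd t (monWeight u) ≤ P.comap (maxIdeal A odd).mkQ := by
    intro t
    refine Submodule.span_le.2 ?_
    rintro _ ⟨v, hv | ⟨i, rfl⟩, hvu, rfl⟩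
    · by_cases hts : t = s
      · subst hts
        exact h v hv (by rw [hvu, hu])
      · have h1 := hv.weight_nonneg j
        have h2 : t = !s := by cases s <;> cases t <;> simp_all
        rw [hvu, hu, h2, sg_not, neg_mul, ← mul_assoc, sg_mul_self, one_mul] at h1
        omega
    · have h1 := congrFun hvu j
      rw [hu] at h1
      have h2 : sg s * k ≠ 0 := mul_ne_zero (by cases s <;> simp [sg]) hk.ne'
      exact absurd h1.symm h2
  exact sup_le (key true) (key false) (tm_mem_wordSpan u)

/-- The level `±1` subspace is generated by `e_j` or `f_j` under the subalgebra of level `0`. -/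
theorem level_one_le {s : Bool} {j : ι} {P : Submodule ℝ (Borcherds A odd)}
    (h1 : bg A odd s j ∈ P) (h2 : ∀ i, i ≠ j → ∀ x ∈ P, ⁅bg A odd s i, x⁆ ∈ P) :
    level A odd j (-sg s) ≤ P := by
  -- Words not involving j preserve `P`. This handles the case where j is the outermost letter: by
  -- skew symmetry, the rest of the word then acts on the generator of node j.
  have h0 : ∀ w, IsWord s w → monWeight w j = 0 → ∀ x ∈ P, ⁅proj A odd (mon w), x⁆ ∈ P := by
    intro w hw
    induction hw with
    | of i =>
      intro hi
      refine h2 i ?_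
      rintro rfl
      rw [monWeight_ef] at hi
      cases s <;> simp [sg] at hi
    | cons i w hw ih =>
      intro hi x hx
      have hw1 := hw.weight_nonneg j
      rw [monWeight_mul, monWeight_ef, Pi.add_apply, Pi.smul_apply, smul_eq_mul] at hi
      have hij : i ≠ j := by
        rintro rfl
        rw [Pi.single_eq_same] at hi
        cases s <;> simp [sg] at hi hw1 <;> omega
      rw [Pi.single_eq_of_ne hij.symm, mul_zero, zero_add] at hi
      rw [proj_word_cons, super_jacobi (bg_mem_parity s i) (t := monParity odd w)
        (Submodule.subset_span ⟨w, rfl, rfl⟩)]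
      exact sub_mem (h2 i hij _ (ih hi x hx))
        (Submodule.smul_mem _ _ (ih hi _ (h2 i hij x hx)))
  have h3 := level_le_of_word (A := A) (odd := odd) (s := s) (j := j) (k := 1) one_pos (P := P) ?_
  · rwa [mul_one] at h3
  intro u hu
  rw [mul_one]
  induction hu with
  | of i =>
    intro hi
    obtain rfl : i = j := by
      by_contra hij
      rw [monWeight_ef, Pi.smul_apply, Pi.single_eq_of_ne (Ne.symm hij), smul_zero] at hi
      cases s <;> simp [sg] at hi
    exact h1
  | cons i w hw ih =>
    intro hi
    rw [monWeight_mul, monWeight_ef, Pi.add_apply, Pi.smul_apply, smul_eq_mul] at hi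
    rw [proj_word_cons]
    by_cases hij : i = j
    · subst hij
      rw [Pi.single_eq_same, mul_one, add_eq_left] at hi
      rw [super_skew (bg_mem_parity s i) (t := monParity odd w)
        (Submodule.subset_span ⟨w, rfl, rfl⟩)]
      exact neg_mem (Submodule.smul_mem _ _ (h0 w hw hi _ h1))
    · rw [Pi.single_eq_of_ne (Ne.symm hij), mul_zero, zero_add] at hi
      exact h2 i hij _ (ih hi)

theorem level_neg_one_le {j : ι} {P : Submodule ℝ (Borcherds A odd)}
    (h1 : gE A odd j ∈ P) (h2 : ∀ i, i ≠ j → ∀ x ∈ P, ⁅gE A odd i, x⁆ ∈ P) :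
    level A odd j (-1) ≤ P := level_one_le (s := true) h1 h2

theorem level_pos_one_le {j : ι} {P : Submodule ℝ (Borcherds A odd)}
    (h1 : gF A odd j ∈ P) (h2 : ∀ i, i ≠ j → ∀ x ∈ P, ⁅gF A odd i, x⁆ ∈ P) :
    level A odd j 1 ≤ P := level_one_le (s := false) h1 h2

/-- A derivation acts on a nested bracket by the Leibniz rule. -/
theorem nest_leibniz {z : Borcherds A odd} (hz : z ∈ parityPart A odd false) (p : ℕ)
    (x : Fin p → Borcherds A odd) :
    ⁅z, nest p x⁆ = ∑ k, nest p (Function.update x k ⁅z, x k⁆) := by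
  induction p with
  | zero => simp [nest, bracket_zero]
  | succ p ih =>
    cases p with
    | zero => simp [nest]
    | succ p =>
      rw [Fin.sum_univ_succ]
      simp only [nest]
      rw [even_leibniz hz, ih]
      congr 1
      simp only [bracket_def, map_sum]
      refine Finset.sum_congr rfl fun k _ => ?_
      congr 2
      funext i
      by_cases h : i = k
      · subst h; simp
      · rw [Function.update_of_ne h, Function.update_of_ne (fun h' => h (Fin.succ_inj.1 h'))]

variable (A odd) in
/-- The span of the `p`-fold nested brackets of elements of level `q`. -/
def nestSpan (j : ι) (q : ℤ) (p : ℕ) : Submodule ℝ (Borcherds A odd) :=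
  Submodule.span ℝ {w | ∃ x : Fin p → Borcherds A odd, (∀ i, x i ∈ level A odd j q) ∧ w = nest p x}

theorem bracket_nestSpan {j : ι} {q : ℤ} {z : Borcherds A odd}
    (hz : z ∈ parityPart A odd false) (hz' : z ∈ level A odd j 0) {p : ℕ} {w : Borcherds A odd}
    (hw : w ∈ nestSpan A odd j q p) : ⁅z, w⁆ ∈ nestSpan A odd j q p := by
  induction hw using Submodule.span_induction with
  | zero => rw [bracket_zero]; exact zero_mem _
  | add a b _ _ ha hb => rw [bracket_add]; exact add_mem ha hb
  | smul c a _ ha => rw [bracket_smul]; exact Submodule.smul_mem _ _ ha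
  | mem w hw =>
    obtain ⟨x, hx, rfl⟩ := hw
    rw [nest_leibniz hz]
    refine sum_mem fun k _ => Submodule.subset_span ⟨_, fun i => ?_, rfl⟩
    by_cases h : i = k
    · subst h
      rw [Function.update_self]
      simpa using level_bracket hz' (hx i)
    · rw [Function.update_of_ne h]; exact hx i

/-- In a word, a letter j adds one entry to the nested bracket, while any other letter is even of
level 0 and acts on the existing entries by the Leibniz rule. -/
theorem level_mul_le_nestSpan {s : Bool} {j : ι} (hodd : ∀ i, i ≠ j → odd i = false) {p : ℕ}
    (hp : 1 ≤ p) : level A odd j (-(sg s * p)) ≤ nestSpan A odd j (-sg s) p := by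
  refine level_le_of_word (by exact_mod_cast hp) ?_
  have h1 : level A odd j (-sg s) ≤ nestSpan A odd j (-sg s) 1 := fun x hx =>
    Submodule.subset_span ⟨fun _ => x, fun _ => hx, rfl⟩
  intro u hu
  induction hu generalizing p with
  | of i =>
    intro hi
    by_cases hij : i = j
    · subst hij
      rw [monWeight_ef, Pi.smul_apply, Pi.single_eq_same] at hi
      have : p = 1 := by cases s <;> simp [sg] at hi <;> omega
      subst this
      exact h1 (bg_mem_level_self s i)
    · rw [monWeight_ef, Pi.smul_apply, Pi.single_eq_of_ne (Ne.symm hij), smul_zero] at hi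
      cases s <;> simp [sg] at hi <;> omega
  | cons i w hw ih =>
    intro hi
    by_cases hij : i = j
    · subst hij
      -- For p = 1 the remaining word has level 0 and the induction hypothesis says nothing, but the
      -- whole word is then itself an element of level ±1.
      obtain rfl | ⟨p, rfl⟩ : p = 1 ∨ ∃ q, p = q + 2 := by
        by_cases h : p = 1
        · exact Or.inl h
        · exact Or.inr ⟨p - 2, by omega⟩
      · exact h1 (proj_mem_level (by rw [hi]; simp))
      · rw [monWeight_mul, monWeight_ef, Pi.add_apply, Pi.smul_apply, Pi.single_eq_same] at hi
        have hw' := ih (p := p + 1) (by omega) (by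
          rw [smul_eq_mul, mul_one] at hi
          have : sg s * ((p + 2 : ℕ) : ℤ) = sg s + sg s * ((p + 1 : ℕ) : ℤ) := by
            push_cast; ring
          rw [this] at hi
          exact add_left_cancel hi)
        rw [proj_word_cons]
        clear ih hi
        generalize proj A odd (mon w) = w' at hw'
        induction hw' using Submodule.span_induction with
        | zero => rw [bracket_zero]; exact zero_mem _
        | add a b _ _ ha hb => rw [bracket_add]; exact add_mem ha hb
        | smul c a _ ha => rw [bracket_smul]; exact Submodule.smul_mem _ _ ha
        | mem w hw =>
          obtain ⟨x, hx, rfl⟩ := hw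
          exact Submodule.subset_span ⟨Fin.cons (bg A odd s i) x,
            Fin.cases (bg_mem_level_self s i) hx, rfl⟩
    · rw [monWeight_mul, monWeight_ef, Pi.add_apply, Pi.smul_apply,
        Pi.single_eq_of_ne (Ne.symm hij), smul_zero, zero_add] at hi
      rw [proj_word_cons]
      exact bracket_nestSpan (by rw [← hodd i hij]; exact bg_mem_parity s i)
        (bg_mem_level_zero s hij) (ih hp hi)

theorem level_neg_le_nestSpan {j : ι} (hodd : ∀ i, i ≠ j → odd i = false) {p : ℕ}
    (hp : 1 ≤ p) : level A odd j (-p) ≤ nestSpan A odd j (-1) p := by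
  have := level_mul_le_nestSpan (A := A) (s := true) hodd hp
  simpa [sg] using this

theorem level_pos_le_nestSpan {j : ι} (hodd : ∀ i, i ≠ j → odd i = false) {p : ℕ}
    (hp : 1 ≤ p) : level A odd j p ≤ nestSpan A odd j 1 p := by
  have := level_mul_le_nestSpan (A := A) (s := false) hodd hp
  simpa [sg] using this

/-- The levels ∓1 are generated from e_j and f_j by even generators at the other nodes, so the value
⟨e_j|f_j⟩ = 1 and invariance determine the pairing. -/
theorem IsStandardForm.eq_on_level_one {j : ι} (hodd : ∀ i, i ≠ j → odd i = false)
    {B B' : Borcherds A odd →ₗ[ℝ] Borcherds A odd →ₗ[ℝ] ℝ} (hB : IsStandardForm A odd j B)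
    (hB' : IsStandardForm A odd j B') {x y : Borcherds A odd} (hx : x ∈ level A odd j (-1))
    (hy : y ∈ level A odd j 1) : B x y = B' x y := by
  let P : Submodule ℝ (Borcherds A odd) :=
    { carrier := {x | ∀ y ∈ level A odd j 1, B x y = B' x y}
      add_mem' := fun ha hb y hy => by
        rw [map_add, map_add, LinearMap.add_apply, LinearMap.add_apply, ha y hy, hb y hy]
      zero_mem' := fun y _ => by rw [map_zero, map_zero]
      smul_mem' := fun c a ha y hy => by
        rw [map_smul, map_smul, LinearMap.smul_apply, LinearMap.smul_apply, ha y hy] }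
  refine level_neg_one_le (P := P) ?_ ?_ hx y hy
  · intro y hy
    have h : level A odd j 1 ≤ LinearMap.ker (B (gE A odd j) - B' (gE A odd j)) := by
      refine level_pos_one_le ?_ ?_
      · rw [LinearMap.mem_ker, LinearMap.sub_apply, hB.ef, hB'.ef, sub_self]
      · intro i hij y _
        rw [LinearMap.mem_ker, LinearMap.sub_apply, ← hB.invariant, ← hB'.invariant, gE_gF,
          if_neg hij.symm, map_zero, map_zero, sub_self]
    exact sub_eq_zero.1 (h hy)
  · intro i hij x hx y hy
    have he : gE A odd i ∈ parityPart A odd false := by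
      rw [← hodd i hij]; exact bg_mem_parity true i
    have : ⁅gE A odd i, x⁆ = -⁅x, gE A odd i⁆ := by rw [even_skew he, neg_neg]
    rw [this, map_neg, map_neg, LinearMap.neg_apply, LinearMap.neg_apply, hB.invariant,
      hB'.invariant, hx]
    simpa [bg_true] using level_bracket (bg_mem_level_zero (A := A) (odd := odd) true hij) hy

/-- Invariance moves all entries of the nested bracket but the first to the other side, which
reduces the claim to the levels ∓1. This transfers nondegeneracy from the constructed form to any
standard one. -/
theorem IsStandardForm.eq_on_level {j : ι} (hodd : ∀ i, i ≠ j → odd i = false)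
    {B B' : Borcherds A odd →ₗ[ℝ] Borcherds A odd →ₗ[ℝ] ℝ} (hB : IsStandardForm A odd j B)
    (hB' : IsStandardForm A odd j B') {p : ℕ} (hp : 1 ≤ p) {x y : Borcherds A odd}
    (hx : x ∈ level A odd j (-p)) (hy : y ∈ level A odd j p) : B x y = B' x y := by
  have hx' := level_neg_le_nestSpan hodd hp hx
  clear hx
  induction hx' using Submodule.span_induction with
  | zero => rw [map_zero, map_zero]
  | add a b _ _ ha hb =>
    rw [map_add, map_add, LinearMap.add_apply, LinearMap.add_apply, ha, hb]
  | smul c a _ ha => rw [map_smul, map_smul, LinearMap.smul_apply, LinearMap.smul_apply, ha]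
  | mem w hw =>
    obtain ⟨x, hx, rfl⟩ := hw
    obtain _ | _ | p := p
    · omega
    · exact hB.eq_on_level_one hodd hB' (hx 0) (by simpa using hy)
    · simp only [nest]
      rw [hB.invariant, hB'.invariant]
      refine hB.eq_on_level_one hodd hB' (hx 0) ?_
      have h1 := level_bracket (nest_mem_level A odd j (-1) (p + 1) _ fun i => hx i.succ) hy
      have h2 : ((p + 1 : ℕ) : ℤ) * -1 + ((p + 1 + 1 : ℕ) : ℤ) = 1 := by push_cast; ring
      rwa [h2] at h1

/-- Any standard form is nondegenerate. -/
theorem IsStandardForm.eq_zero {j : ι} (hodd : ∀ i, i ≠ j → odd i = false)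
    (hA : ∀ i k, A i k = A k i)
    {B : Borcherds A odd →ₗ[ℝ] Borcherds A odd →ₗ[ℝ] ℝ} (hB : IsStandardForm A odd j B)
    {p : ℕ} (hp : 1 ≤ p) {x : Borcherds A odd} (hx : x ∈ level A odd j (-p))
    (h : ∀ y : Fin p → Borcherds A odd, (∀ i, y i ∈ level A odd j 1) → B x (nest p y) = 0) :
    x = 0 := by
  refine eq_zero_of_borcherdsForm hA (by omega) hx fun y hy => ?_
  rw [neg_neg] at hy
  rw [← hB.eq_on_level hodd (borcherdsForm_standard hA j) hp hx hy]
  have : nestSpan A odd j 1 p ≤ LinearMap.ker (B x) := by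
    refine Submodule.span_le.2 ?_
    rintro _ ⟨y, hy, rfl⟩
    exact h y hy
  exact this (level_pos_le_nestSpan hodd hp hy)

end Levels

end TensorHierarchy
end

noncomputable section
set_option linter.unusedSectionVars false
namespace TensorHierarchy
open scoped TensorProduct

/-! ### Subdiagrams -/

section Subdiagram

variable {ι κ : Type} [DecidableEq ι] [Fintype ι] [DecidableEq κ] [Fintype κ]
  {A : Matrix ι ι ℤ} {odd : ι → Bool} {A' : Matrix κ κ ℤ} {odd' : κ → Bool} {σ : ι → κ}

/-- The map of generators induced by a map of nodes. -/
def Gen.map (σ : ι → κ) : Gen ι → Gen κ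
  | .e i => .e (σ i)
  | .f i => .f (σ i)
  | .h i => .h (σ i)

/-- The map of monomials induced by a map of nodes. -/
def monMap (σ : ι → κ) : FreeMagma (Gen ι) →ₙ* FreeMagma (Gen κ) := FreeMagma.map (Gen.map σ)

theorem map_ef (s : Bool) (i : ι) : Gen.map σ (ef s i) = ef s (σ i) := by cases s <;> rfl

/-- The push-forward of a degree. -/
def wtMap (σ : ι → κ) (α : ι → ℤ) : κ → ℤ := fun k => ∑ i, if σ i = k then α i else 0

theorem wtMap_add (α β : ι → ℤ) : wtMap σ (α + β) = wtMap σ α + wtMap σ β := by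
  funext k
  simp only [wtMap, Pi.add_apply, ← Finset.sum_add_distrib]
  exact Finset.sum_congr rfl fun i _ => by split_ifs <;> simp

theorem wtMap_neg (α : ι → ℤ) : wtMap σ (-α) = -wtMap σ α := by
  funext k
  simp only [wtMap, Pi.neg_apply, ← Finset.sum_neg_distrib]
  exact Finset.sum_congr rfl fun i _ => by split_ifs <;> simp

theorem wtMap_zero : wtMap σ 0 = 0 := by
  funext k
  simp [wtMap]

theorem wtMap_single (i : ι) : wtMap σ (Pi.single i 1) = Pi.single (σ i) 1 := by
  funext k
  rw [wtMap, Finset.sum_eq_single i]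
  · by_cases h : σ i = k
    · subst h; simp
    · rw [if_neg h, Pi.single_eq_of_ne (Ne.symm h)]
  · intro j _ hj
    rw [Pi.single_eq_of_ne hj, ite_self]
  · simp

theorem wtMap_apply (hσ : Function.Injective σ) (α : ι → ℤ) (i : ι) : wtMap σ α (σ i) = α i := by
  rw [wtMap, Finset.sum_eq_single i]
  · simp
  · intro j _ hj
    rw [if_neg fun h => hj (hσ h)]
  · simp

theorem wtMap_of_notMem (α : ι → ℤ) {k : κ} (h : ∀ i, σ i ≠ k) : wtMap σ α k = 0 := by
  rw [wtMap]
  exact Finset.sum_eq_zero fun i _ => if_neg (h i)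

theorem ht_wtMap (α : ι → ℤ) : ht (wtMap σ α) = ht α := by
  simp only [ht, wtMap]
  rw [Finset.sum_comm]
  simp

theorem monWeight_map (u : FreeMagma (Gen ι)) :
    monWeight (monMap σ u) = wtMap σ (monWeight u) := by
  induction u with
  | ih1 x =>
    cases x
    · exact (wtMap_single _).symm
    · exact ((wtMap_neg _).trans (congrArg _ (wtMap_single _))).symm
    · exact wtMap_zero.symm
  | ih2 u v hu hv =>
    rw [map_mul, monWeight_mul, monWeight_mul, hu, hv, wtMap_add]

theorem monParity_map (ho : ∀ i, odd' (σ i) = odd i) (u : FreeMagma (Gen ι)) :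
    monParity odd' (monMap σ u) = monParity odd u := by
  induction u with
  | ih1 x =>
    cases x
    · exact ho _
    · exact ho _
    · rfl
  | ih2 u v hu hv =>
    rw [map_mul]
    change xor _ _ = xor _ _
    rw [hu, hv]

/-- All letters of a word contribute to the degree with the same sign, so a letter outside the
subdiagram could not be cancelled. -/
theorem IsWord.exists_map {s : Bool} {u : FreeMagma (Gen κ)} (hu : IsWord s u)
    (h : ∀ k, (∀ i, σ i ≠ k) → monWeight u k = 0) : ∃ u', monMap σ u' = u := by
  induction hu with
  | of k =>
    by_cases hk : ∀ i, σ i ≠ k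
    · have := h k hk
      rw [monWeight_ef, Pi.smul_apply, Pi.single_eq_same] at this
      cases s <;> simp [sg] at this
    · push Not at hk
      obtain ⟨i, rfl⟩ := hk
      exact ⟨.of (ef s i), congrArg FreeMagma.of (map_ef s i)⟩
  | cons k w hw ih =>
    have key : ∀ l, (∀ i, σ i ≠ l) → l ≠ k ∧ monWeight w l = 0 := by
      intro l hl
      have h1 := h l hl
      have h2 := hw.weight_nonneg l
      rw [monWeight_mul, monWeight_ef, Pi.add_apply, Pi.smul_apply, smul_eq_mul] at h1
      by_cases hlk : l = k
      · subst hlk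
        rw [Pi.single_eq_same] at h1
        cases s <;> simp [sg] at h1 h2 <;> omega
      · rw [Pi.single_eq_of_ne hlk, mul_zero, zero_add] at h1
        exact ⟨hlk, h1⟩
    obtain ⟨w', rfl⟩ := ih fun l hl => (key l hl).2
    by_cases hk : ∀ i, σ i ≠ k
    · exact absurd rfl (key k hk).1
    · push Not at hk
      obtain ⟨i, rfl⟩ := hk
      refine ⟨.of (ef s i) * w', ?_⟩
      rw [map_mul]
      exact congrArg (· * _) (congrArg FreeMagma.of (map_ef s i))

/-- The homomorphism of free algebras induced by a map of nodes. -/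
def freeMap (σ : ι → κ) : FreeAlg ι →ₗ[ℝ] FreeAlg κ := liftMon fun u => mon (monMap σ u)

theorem freeMap_mon (u : FreeMagma (Gen ι)) : freeMap σ (mon u) = mon (monMap σ u) :=
  liftMon_mon _ u

theorem freeMap_mul (a b : FreeAlg ι) : freeMap σ (a * b) = freeMap σ a * freeMap σ b := by
  induction a using free_induction with
  | h0 => simp
  | hadd a a' ha ha' => rw [add_mul, map_add, map_add, add_mul, ha, ha']
  | hsmul c a ha => rw [smul_mul_assoc, map_smul, map_smul, smul_mul_assoc, ha]
  | hmon u =>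
    induction b using free_induction with
    | h0 => simp
    | hadd a a' ha ha' => rw [mul_add, map_add, map_add, mul_add, ha, ha']
    | hsmul c a ha => rw [mul_smul_comm, map_smul, map_smul, mul_smul_comm, ha]
    | hmon v => rw [mon_mul, freeMap_mon, freeMap_mon, freeMap_mon, map_mul, mon_mul]

theorem relIdeal_le_comap_freeMap (hσ : Function.Injective σ)
    (hA : ∀ i k, A' (σ i) (σ k) = A i k) (ho : ∀ i, odd' (σ i) = odd i) :
    relIdeal A odd ≤ (relIdeal A' odd').comap (freeMap σ) := by
  refine sInf_le ⟨fun x y hy => ?_, fun x hx => ?_⟩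
  · rw [Submodule.mem_comap, Submodule.mem_comap, LinearMap.mul_apply', LinearMap.mul_apply',
      freeMap_mul, freeMap_mul]
    exact relIdeal_isIdeal A' odd' (freeMap σ x) (freeMap σ y) hy
  · have hr : ∀ y, Rel A' odd' y → y ∈ relIdeal A' odd' := fun y hy =>
      Submodule.mem_sInf.2 fun I hI => hI.2 y hy
    have hg : ∀ g : Gen ι, freeMap σ (gen g) = gen (g.map σ) := fun g => freeMap_mon _
    rw [Submodule.mem_comap]
    refine hr _ ?_
    cases hx with
    | skew u v =>
      rw [map_add, map_smul, freeMap_mon, freeMap_mon, map_mul, map_mul, ← monParity_map ho u,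
        ← monParity_map ho v]
      exact Rel.skew _ _
    | jacobi u v w =>
      rw [map_sub, map_sub, map_smul, freeMap_mon, freeMap_mon, freeMap_mon]
      simp only [map_mul]
      rw [← monParity_map ho u, ← monParity_map ho v]
      exact Rel.jacobi _ _ _
    | he i j =>
      rw [map_sub, map_smul, freeMap_mul, hg, hg, ← hA]
      exact Rel.he _ _
    | hf i j =>
      rw [map_add, map_smul, freeMap_mul, hg, hg, ← hA]
      exact Rel.hf _ _
    | ef i j =>
      have := Rel.ef (A := A') (odd := odd') (σ i) (σ j)
      rw [map_sub, freeMap_mul, hg, hg]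
      by_cases h : i = j
      · subst h
        rw [if_pos rfl] at this ⊢
        rw [hg]
        exact this
      · rw [if_neg h, map_zero]
        rw [if_neg fun h' => h (hσ h')] at this
        exact this
    | hh i j =>
      rw [freeMap_mul, hg, hg]
      exact Rel.hh _ _

/-- The data of an embedding of Dynkin diagrams. -/
structure IsSubdiagram (A : Matrix ι ι ℤ) (odd : ι → Bool) (A' : Matrix κ κ ℤ) (odd' : κ → Bool)
    (σ : ι → κ) : Prop where
  injective : Function.Injective σ
  cartan : ∀ i k, A' (σ i) (σ k) = A i k
  parity : ∀ i, odd' (σ i) = odd i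
  symm : ∀ i k, A' i k = A' k i

variable (h : IsSubdiagram A odd A' odd' σ)

/-- The homomorphism induced by an embedding of Dynkin diagrams. -/
def tildeMap : Tilde A odd →ₗ[ℝ] Tilde A' odd' :=
  (relIdeal A odd).mapQ (relIdeal A' odd') (freeMap σ)
    (relIdeal_le_comap_freeMap h.injective h.cartan h.parity)

theorem tildeMap_tm (u : FreeMagma (Gen ι)) :
    tildeMap h (tm A odd u) = tm A' odd' (monMap σ u) := by
  rw [tildeMap, tm, Submodule.mkQ_apply, Submodule.mapQ_apply, freeMap_mon]
  rfl

theorem tildeMap_br (x y : Tilde A odd) :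
    tildeMap h (tildeBr A odd x y) = tildeBr A' odd' (tildeMap h x) (tildeMap h y) := by
  induction x using tilde_induction with
  | h0 => simp
  | hadd a b ha hb => simp only [map_add, LinearMap.add_apply, ha, hb]
  | hsmul c a ha => simp only [map_smul, LinearMap.smul_apply, ha]
  | hmon u =>
    induction y using tilde_induction with
    | h0 => simp
    | hadd a b ha hb => simp only [map_add, ha, hb]
    | hsmul c a ha => simp only [map_smul, ha]
    | hmon v => rw [tildeBr_tm, tildeMap_tm, tildeMap_tm, tildeMap_tm, tildeBr_tm, map_mul]

theorem tildeMap_mem {α : ι → ℤ} {x : Tilde A odd} (hx : x ∈ tildeWeight A odd α) :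
    tildeMap h x ∈ tildeWeight A' odd' (wtMap σ α) := by
  induction hx using tildeWeight_induction with
  | h0 => rw [map_zero]; exact zero_mem _
  | hadd a b _ _ ha hb => rw [map_add]; exact add_mem ha hb
  | hsmul c a _ ha => rw [map_smul]; exact Submodule.smul_mem _ _ ha
  | hmon u hu => rw [tildeMap_tm]; exact tm_mem _ (by rw [monWeight_map, hu])

theorem hsum_tildeMap {x : Tilde A odd} (hx : x ∈ tildeWeight A odd 0) :
    hsum A' odd' (tildeMap h x) = hsum A odd x := by
  rw [eq_sum_hcoef hx]
  simp only [map_sum, map_smul, hsum_th]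
  refine Finset.sum_congr rfl fun i _ => ?_
  congr 1
  exact (congrArg _ (tildeMap_tm h _)).trans (hsum_th (σ i))

/-- In degrees of nonzero height the form depends only on the height, the bracket and the
coefficient sum of the h_i, all of which the embedding preserves. -/
theorem tildeForm_tildeMap {α : ι → ℤ} (hα : ht α ≠ 0) {x y : Tilde A odd}
    (hx : x ∈ tildeWeight A odd α) (hy : y ∈ tildeWeight A odd (-α)) :
    tildeForm A' odd' (tildeMap h x) (tildeMap h y) = tildeForm A odd x y := by
  rw [tildeForm_of_ht hα hx hy, tildeForm_of_ht (by rwa [ht_wtMap]) (tildeMap_mem h hx)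
    (by rw [← wtMap_neg]; exact tildeMap_mem h hy), ht_wtMap, ← tildeMap_br, hsum_tildeMap]
  exact tildeBr_mem hx hy (add_neg_cancel α)

theorem exists_tildeMap_eq {α : ι → ℤ} (hα : ht α ≠ 0) {y : Tilde A' odd'}
    (hy : y ∈ tildeWeight A' odd' (wtMap σ α)) :
    ∃ x ∈ tildeWeight A odd α, tildeMap h x = y := by
  obtain ⟨s, hs⟩ : ∃ s : Bool, 0 < sg s * ht (wtMap σ α) := by
    rw [ht_wtMap]
    rcases lt_or_gt_of_ne hα with h1 | h1
    · exact ⟨false, by simp [sg, h1]⟩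
    · exact ⟨true, by simp [sg, h1]⟩
  rw [tildeWeight_eq_wordSpan hs] at hy
  induction hy using Submodule.span_induction with
  | zero => exact ⟨0, zero_mem _, map_zero _⟩
  | add a b _ _ ha hb =>
    obtain ⟨a', ha, rfl⟩ := ha
    obtain ⟨b', hb, rfl⟩ := hb
    exact ⟨a' + b', add_mem ha hb, map_add _ _ _⟩
  | smul c a _ ha =>
    obtain ⟨a', ha, rfl⟩ := ha
    exact ⟨c • a', Submodule.smul_mem _ _ ha, map_smul _ _ _⟩
  | mem y hy =>
    obtain ⟨u, hu | ⟨k, rfl⟩, hw, rfl⟩ := hy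
    · obtain ⟨u', rfl⟩ := hu.exists_map (σ := σ) fun k hk => by
        rw [hw, wtMap_of_notMem α hk]
      refine ⟨tm A odd u', tm_mem _ ?_, tildeMap_tm h u'⟩
      funext i
      rw [monWeight_map] at hw
      have := congrFun hw (σ i)
      rwa [wtMap_apply h.injective, wtMap_apply h.injective] at this
    · rw [← hw] at hs
      exact absurd hs (by simp [monWeight, Gen.weight, ht])

/-- In degrees supported on the subdiagram the larger algebra has only elements coming from the
smaller one. So an element orthogonal to its opposite degree stays so after the embedding, and
`mem_maxIdeal` applies. -/
theorem maxIdeal_le_comap_tildeMap :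
    maxIdeal A odd ≤ (maxIdeal A' odd').comap (tildeMap h) := by
  have hA : ∀ i k, A i k = A k i := fun i k => by rw [← h.cartan, h.symm, h.cartan]
  refine sSup_le fun I hI => ?_
  refine hI.2.1.trans (iSup_le fun α x hx => ?_)
  rw [Submodule.mem_comap]
  by_cases hα : α = 0
  · subst hα
    have h1 : x ∈ I ⊓ tildeCartan A odd := ⟨hx.1, tildeWeight_zero_le hx.2⟩
    rw [hI.2.2, Submodule.mem_bot] at h1
    rw [h1, map_zero]
    exact zero_mem _
  · by_cases hht : ht α = 0
    · rw [eq_zero_of_ht_eq_zero hht hα hx.2, map_zero]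
      exact zero_mem _
    · refine mem_maxIdeal h.symm (α := wtMap σ α) ?_ (tildeMap_mem h hx.2) fun y hy => ?_
      · intro h0
        apply hα
        funext i
        rw [← wtMap_apply h.injective α i, h0]
        rfl
      · rw [← wtMap_neg] at hy
        obtain ⟨y, hy', rfl⟩ := exists_tildeMap_eq h (by rwa [ht_neg, neg_ne_zero]) hy
        rw [tildeForm_tildeMap h hht hx.2 hy']
        exact tildeForm_eq_zero_of_mem_maxIdeal hA (le_sSup hI hx.1) y

/-- The homomorphism induced by an embedding of Dynkin diagrams. -/
def borcherdsMap : Borcherds A odd →ₗ[ℝ] Borcherds A' odd' :=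
  (maxIdeal A odd).mapQ (maxIdeal A' odd') (tildeMap h) (maxIdeal_le_comap_tildeMap h)

theorem borcherdsMap_proj (u : FreeMagma (Gen ι)) :
    borcherdsMap h (proj A odd (mon u)) = proj A' odd' (mon (monMap σ u)) := by
  rw [proj_mon, borcherdsMap, Submodule.mkQ_apply, Submodule.mapQ_apply, tildeMap_tm]
  rfl

theorem borcherdsMap_bracket (x y : Borcherds A odd) :
    borcherdsMap h ⁅x, y⁆ = ⁅borcherdsMap h x, borcherdsMap h y⁆ := by
  induction x using borcherds_induction with
  | h0 => simp [zero_bracket]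
  | hadd a b ha hb => simp only [map_add, add_bracket, ha, hb]
  | hsmul c a ha => simp only [map_smul, smul_bracket, ha]
  | hmon u =>
    induction y using borcherds_induction with
    | h0 => simp [bracket_zero]
    | hadd a b ha hb => simp only [map_add, bracket_add, ha, hb]
    | hsmul c a ha => simp only [map_smul, bracket_smul, ha]
    | hmon v =>
      rw [proj_mon_bracket, borcherdsMap_proj, borcherdsMap_proj, borcherdsMap_proj,
        proj_mon_bracket, map_mul]

theorem borcherdsMap_mem_level {j : κ} (hj : ∀ i, σ i ≠ j) (x : Borcherds A odd) :
    borcherdsMap h x ∈ level A' odd' j 0 := by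
  induction x using borcherds_induction with
  | h0 => rw [map_zero]; exact zero_mem _
  | hadd a b ha hb => rw [map_add]; exact add_mem ha hb
  | hsmul c a ha => rw [map_smul]; exact Submodule.smul_mem _ _ ha
  | hmon u =>
    rw [borcherdsMap_proj]
    exact proj_mem_level (by rw [monWeight_map, wtMap_of_notMem _ hj, neg_zero])

end Subdiagram

end TensorHierarchy
end

noncomputable section
set_option linter.unusedSectionVars false
namespace TensorHierarchy
open scoped TensorProduct

/-! ### Pairs of dual lowest and highest weight modules -/

section DualPair

variable {K : Type} [DecidableEq K]

/-- A lowest weight module `V` and a highest weight module `V'` of a Kac-Moody algebra with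
Cartan matrix `A`, with a nondegenerate contravariant pairing; `lam` is the weight of the generating
vector `v'` of `V'`. -/
structure DualPair (A : Matrix K K ℤ) (lam : K → ℝ) (V V' : Type) [AddCommGroup V] [Module ℝ V]
    [AddCommGroup V'] [Module ℝ V'] where
  e : K → V →ₗ[ℝ] V
  f : K → V →ₗ[ℝ] V
  e' : K → V' →ₗ[ℝ] V'
  f' : K → V' →ₗ[ℝ] V'
  h' : K → V' →ₗ[ℝ] V'
  b : V →ₗ[ℝ] V' →ₗ[ℝ] ℝ
  v : V
  v' : V'
  b_e : ∀ i x y, b (e i x) y = -b x (e' i y)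
  b_f : ∀ i x y, b (f i x) y = -b x (f' i y)
  f_v : ∀ i, f i v = 0
  e_v' : ∀ i, e' i v' = 0
  h_v' : ∀ i, h' i v' = lam i • v'
  e_f' : ∀ i j y, e' i (f' j y) = f' j (e' i y) + if i = j then h' i y else 0
  h_f' : ∀ i j y, h' i (f' j y) = f' j (h' i y) - (A i j : ℝ) • f' j y
  b_v : b v v' = 1
  generate : ∀ P : Submodule ℝ V, v ∈ P → (∀ i, ∀ x ∈ P, e i x ∈ P) → P = ⊤
  generate' : ∀ P : Submodule ℝ V', v' ∈ P → (∀ i, ∀ x ∈ P, f' i x ∈ P) → P = ⊤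
  nondegenerate : ∀ x, (∀ y, b x y = 0) → x = 0
  nondegenerate' : ∀ y, (∀ x, b x y = 0) → y = 0

namespace DualPair

variable {A : Matrix K K ℤ} {lam : K → ℝ} {V V' : Type} [AddCommGroup V] [Module ℝ V]
  [AddCommGroup V'] [Module ℝ V'] (L : DualPair A lam V V')

/-- The vector obtained by acting on `v` with a word in the `e i`. -/
def word (l : List K) : V := l.foldr (fun i x => L.e i x) L.v

/-- The vector obtained by acting on `v'` with a word in the `f' i`. -/
def word' (l : List K) : V' := l.foldr (fun i y => L.f' i y) L.v'

/-- `vermaF i` just prepends the letter i to a word. Here it models `L.e i`, so that both V and V'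
are quotients of the same space of words. -/
theorem range_word : LinearMap.range (wordLift L.word) = ⊤ := by
  refine L.generate _ ⟨wordVec [], wordLift_wordVec _ _⟩ ?_
  rintro i _ ⟨s, rfl⟩
  refine ⟨vermaF i s, ?_⟩
  have : wordLift L.word ∘ₗ vermaF i = L.e i ∘ₗ wordLift L.word :=
    Finsupp.lhom_ext' (R := ℝ) (M := ℝ) fun l => LinearMap.ext_ring <| by
      change wordLift L.word (vermaF i (wordVec l)) = L.e i (wordLift L.word (wordVec l))
      rw [vermaF_single, wordLift_wordVec, wordLift_wordVec]
      rfl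
  exact LinearMap.congr_fun this s

theorem wordLift_vermaF (i : K) (s : WordModule K) :
    wordLift L.word' (vermaF i s) = L.f' i (wordLift L.word' s) := by
  have : wordLift L.word' ∘ₗ vermaF i = L.f' i ∘ₗ wordLift L.word' :=
    Finsupp.lhom_ext' (R := ℝ) (M := ℝ) fun l => LinearMap.ext_ring <| by
      change wordLift L.word' (vermaF i (wordVec l)) = L.f' i (wordLift L.word' (wordVec l))
      rw [vermaF_single, wordLift_wordVec, wordLift_wordVec]
      rfl
  exact LinearMap.congr_fun this s

theorem range_word' : LinearMap.range (wordLift L.word') = ⊤ := by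
  refine L.generate' _ ⟨wordVec [], wordLift_wordVec _ _⟩ ?_
  rintro i _ ⟨s, rfl⟩
  exact ⟨vermaF i s, L.wordLift_vermaF i s⟩

theorem h'_word' (i : K) (l : List K) : L.h' i (L.word' l) = vermaWeight A lam i l • L.word' l := by
  induction l with
  | nil => simp [word', L.h_v', vermaWeight]
  | cons j l ih =>
    change L.h' i (L.f' j (L.word' l)) = _ • L.f' j (L.word' l)
    rw [L.h_f', ih, map_smul, vermaWeight_cons, sub_smul]

theorem wordLift_vermaE (i : K) (s : WordModule K) :
    wordLift L.word' (vermaE A (fun _ => false) lam i s) = L.e' i (wordLift L.word' s) := by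
  have : wordLift L.word' ∘ₗ vermaE A (fun _ => false) lam i = L.e' i ∘ₗ wordLift L.word' :=
    Finsupp.lhom_ext' (R := ℝ) (M := ℝ) fun l => LinearMap.ext_ring <| by
      change wordLift L.word' (vermaE A (fun _ => false) lam i (wordVec l)) =
        L.e' i (wordLift L.word' (wordVec l))
      rw [vermaE_single, wordLift_wordVec]
      induction l with
      | nil => simp [vermaEWord, word', L.e_v']
      | cons j l ih =>
        change _ = L.e' i (L.f' j (L.word' l))
        rw [vermaEWord, map_add, map_smul, wordLift_vermaF, ih, L.e_f', koszul_false_left, one_smul,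
          add_comm]
        congr 1
        split_ifs
        · rw [map_smul, wordLift_wordVec, h'_word']
        · rw [map_zero]
  exact LinearMap.congr_fun this s

theorem b_v_word' (l : List K) : L.b L.v (L.word' l) = if l = [] then 1 else 0 := by
  cases l with
  | nil => simp [word', L.b_v]
  | cons i l =>
    change L.b L.v (L.f' i (L.word' l)) = _
    have := L.b_f i L.v (L.word' l)
    rw [L.f_v, map_zero, LinearMap.zero_apply] at this
    rw [← neg_eq_zero.1 this.symm]
    simp

variable {W W' : Type} [AddCommGroup W] [Module ℝ W] [AddCommGroup W'] [Module ℝ W']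
  (M : DualPair A lam W W')

/-- The raising operators are moved one by one to the other side, where they act on words by the
Verma formulas. The value therefore depends on the Cartan matrix and the weight only; this is the
Shapovalov form. -/
theorem b_word (l : List K) (s : WordModule K) :
    L.b (L.word l) (wordLift L.word' s) = M.b (M.word l) (wordLift M.word' s) := by
  induction l generalizing s with
  | nil =>
    have : L.b L.v ∘ₗ wordLift L.word' = M.b M.v ∘ₗ wordLift M.word' :=
      Finsupp.lhom_ext' (R := ℝ) (M := ℝ) fun l => LinearMap.ext_ring <| by
        change L.b L.v (wordLift L.word' (wordVec l)) = M.b M.v (wordLift M.word' (wordVec l))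
        rw [wordLift_wordVec, wordLift_wordVec, b_v_word', b_v_word']
    exact LinearMap.congr_fun this s
  | cons i l ih =>
    change L.b (L.e i (L.word l)) _ = M.b (M.e i (M.word l)) _
    rw [L.b_e, M.b_e, ← wordLift_vermaE, ← wordLift_vermaE, ih]

theorem b_wordLift (t s : WordModule K) :
    L.b (wordLift L.word t) (wordLift L.word' s) = M.b (wordLift M.word t) (wordLift M.word' s) := by
  have : (L.b.flip (wordLift L.word' s)) ∘ₗ wordLift L.word =
      (M.b.flip (wordLift M.word' s)) ∘ₗ wordLift M.word :=
    Finsupp.lhom_ext' (R := ℝ) (M := ℝ) fun l => LinearMap.ext_ring <| by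
      change L.b (wordLift L.word (wordVec l)) (wordLift L.word' s) =
        M.b (wordLift M.word (wordVec l)) (wordLift M.word' s)
      rw [wordLift_wordVec, wordLift_wordVec, L.b_word M]
  exact LinearMap.congr_fun this t

/-- By nondegeneracy the kernel of the word map is the radical of a pairing that is common to all
dual pairs with these data. -/
theorem ker_word_le : LinearMap.ker (wordLift L.word) ≤ LinearMap.ker (wordLift M.word) := by
  intro t ht
  rw [LinearMap.mem_ker] at ht ⊢
  refine M.nondegenerate _ fun y => ?_
  obtain ⟨s, rfl⟩ := LinearMap.range_eq_top.1 M.range_word' y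
  rw [← L.b_wordLift M, ht, map_zero, LinearMap.zero_apply]

theorem ker_word'_le : LinearMap.ker (wordLift L.word') ≤ LinearMap.ker (wordLift M.word') := by
  intro s hs
  rw [LinearMap.mem_ker] at hs ⊢
  refine M.nondegenerate' _ fun y => ?_
  obtain ⟨t, rfl⟩ := LinearMap.range_eq_top.1 M.range_word y
  rw [← L.b_wordLift M, hs, map_zero]

end DualPair

/-- Surjections with the same kernel differ by an isomorphism. -/
theorem exists_equiv_of_ker_eq {X V W : Type} [AddCommGroup X] [Module ℝ X] [AddCommGroup V]
    [Module ℝ V] [AddCommGroup W] [Module ℝ W] {S : X →ₗ[ℝ] V} {T : X →ₗ[ℝ] W}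
    (hS : LinearMap.range S = ⊤) (hT : LinearMap.range T = ⊤)
    (h : LinearMap.ker S = LinearMap.ker T) : ∃ Φ : V ≃ₗ[ℝ] W, ∀ x, Φ (S x) = T x := by
  refine ⟨(S.quotKerEquivOfSurjective (LinearMap.range_eq_top.1 hS)).symm ≪≫ₗ
    Submodule.quotEquivOfEq _ _ h ≪≫ₗ
      T.quotKerEquivOfSurjective (LinearMap.range_eq_top.1 hT), fun x => ?_⟩
  have : (S.quotKerEquivOfSurjective (LinearMap.range_eq_top.1 hS)).symm (S x) =
      Submodule.Quotient.mk x := by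
    rw [LinearEquiv.symm_apply_eq]
    rfl
  rw [LinearEquiv.trans_apply, LinearEquiv.trans_apply, this]
  rfl

/-- Dual pairs with the same Cartan matrix and weights are isomorphic. -/
theorem DualPair.exists_equiv {A B : Matrix K K ℤ} {lam mu : K → ℝ} {V V' W W' : Type}
    [AddCommGroup V] [Module ℝ V] [AddCommGroup V'] [Module ℝ V'] [AddCommGroup W] [Module ℝ W]
    [AddCommGroup W'] [Module ℝ W'] (hA : A = B) (hlam : lam = mu) (L : DualPair A lam V V')
    (M : DualPair B mu W W') :
    ∃ (Φ : V ≃ₗ[ℝ] W) (Φ' : V' ≃ₗ[ℝ] W'),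
      (∀ i x, Φ (L.e i x) = M.e i (Φ x)) ∧ (∀ i x, Φ (L.f i x) = M.f i (Φ x)) ∧
      (∀ i y, Φ' (L.e' i y) = M.e' i (Φ' y)) ∧ (∀ i y, Φ' (L.f' i y) = M.f' i (Φ' y)) ∧
      ∀ x y, M.b (Φ x) (Φ' y) = L.b x y := by
  subst hA hlam
  obtain ⟨Φ, hΦ⟩ := exists_equiv_of_ker_eq L.range_word M.range_word
    (le_antisymm (L.ker_word_le M) (M.ker_word_le L))
  obtain ⟨Φ', hΦ'⟩ := exists_equiv_of_ker_eq L.range_word' M.range_word'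
    (le_antisymm (L.ker_word'_le M) (M.ker_word'_le L))
  have hb : ∀ x y, M.b (Φ x) (Φ' y) = L.b x y := by
    intro x y
    obtain ⟨t, rfl⟩ := LinearMap.range_eq_top.1 L.range_word x
    obtain ⟨s, rfl⟩ := LinearMap.range_eq_top.1 L.range_word' y
    rw [hΦ, hΦ', M.b_wordLift L]
  have he' : ∀ i y, Φ' (L.e' i y) = M.e' i (Φ' y) := by
    intro i y
    obtain ⟨s, rfl⟩ := LinearMap.range_eq_top.1 L.range_word' y
    rw [← L.wordLift_vermaE, hΦ', hΦ', M.wordLift_vermaE]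
  have hf' : ∀ i y, Φ' (L.f' i y) = M.f' i (Φ' y) := by
    intro i y
    obtain ⟨s, rfl⟩ := LinearMap.range_eq_top.1 L.range_word' y
    rw [← L.wordLift_vermaF, hΦ', hΦ', M.wordLift_vermaF]
  refine ⟨Φ, Φ', fun i x => ?_, fun i x => ?_, he', hf', hb⟩
  · refine sub_eq_zero.1 (M.nondegenerate _ fun y => ?_)
    obtain ⟨y, rfl⟩ := Φ'.surjective y
    rw [map_sub, LinearMap.sub_apply, hb, M.b_e, L.b_e, ← he', hb, sub_self]
  · refine sub_eq_zero.1 (M.nondegenerate _ fun y => ?_)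
    obtain ⟨y, rfl⟩ := Φ'.surjective y
    rw [map_sub, LinearMap.sub_apply, hb, M.b_f, L.b_f, ← hf', hb, sub_self]

end DualPair

/-! ### The dual pairs of level `±1` -/

section LevelPair

variable {ι : Type} [DecidableEq ι] [Fintype ι] {A : Matrix ι ι ℤ} {odd : ι → Bool}

theorem level_le_parity {j : ι} (hodd : ∀ i, i ≠ j → odd i = false) (p : ℤ) :
    level A odd j p ≤ parityPart A odd (odd j && !decide (Even p)) := by
  refine Submodule.span_le.2 ?_
  rintro _ ⟨u, hu, rfl⟩
  refine Submodule.subset_span ⟨u, ?_, rfl⟩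
  rw [monParity_eq, par, Finset.sum_eq_single j]
  · rw [hu]
    cases odd j <;> simp
  · intro i _ hij
    rw [hodd i hij]
    simp
  · simp

/-- The action of an element of level `0` on the level `p` subspace. -/
def adLevel {j : ι} {z : Borcherds A odd} (hz : z ∈ level A odd j 0) (p : ℤ) :
    level A odd j p →ₗ[ℝ] level A odd j p :=
  (superBr A odd z).restrict fun x hx => by simpa using! level_bracket hz hx

theorem adLevel_coe {j : ι} {z : Borcherds A odd} (hz : z ∈ level A odd j 0) (p : ℤ)
    (x : level A odd j p) : (adLevel hz p x : Borcherds A odd) = ⁅z, (x : Borcherds A odd)⁆ := rfl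

theorem IsStandardForm.skew_even {j : ι} {B : Borcherds A odd →ₗ[ℝ] Borcherds A odd →ₗ[ℝ] ℝ}
    (hB : IsStandardForm A odd j B) {z : Borcherds A odd} (hz : z ∈ parityPart A odd false)
    (x y : Borcherds A odd) : B ⁅z, x⁆ y = -B x ⁅z, y⁆ := by
  have h1 := hB.invariant x z y
  rw [even_skew hz x, map_neg, LinearMap.neg_apply] at h1
  rw [← h1, neg_neg]

/-- The dual pair formed by the level `∓1` subspaces associated to a node `j`. -/
def levelPair {K : Type} [DecidableEq K] (hA : ∀ i k, A i k = A k i) (j : ι) (σ : K → ι)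
    (hσ : Function.Injective σ) (hj : ∀ i, σ i ≠ j) (hr : ∀ i, i ≠ j → ∃ k, σ k = i)
    (hodd : ∀ i, i ≠ j → odd i = false) :
    DualPair (fun i k => A (σ i) (σ k)) (fun i => -(A (σ i) j : ℝ)) (level A odd j (-1))
      (level A odd j 1) where
  e i := adLevel (bg_mem_level_zero true (hj i)) (-1)
  f i := adLevel (bg_mem_level_zero false (hj i)) (-1)
  e' i := adLevel (bg_mem_level_zero true (hj i)) 1
  f' i := adLevel (bg_mem_level_zero false (hj i)) 1
  h' i := adLevel (gH_mem_level (σ i) j) 1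
  b := ((borcherdsForm hA).domRestrict (level A odd j (-1))).compl₂ (level A odd j 1).subtype
  v := ⟨gE A odd j, bg_mem_level_self true j⟩
  v' := ⟨gF A odd j, bg_mem_level_self false j⟩
  b_e i x y := (borcherdsForm_standard hA j).skew_even
    (by rw [← hodd _ (hj i)]; exact bg_mem_parity true (σ i)) x y
  b_f i x y := (borcherdsForm_standard hA j).skew_even
    (by rw [← hodd _ (hj i)]; exact bg_mem_parity false (σ i)) x y
  f_v i := by
    refine Subtype.ext ?_
    have hf : gF A odd (σ i) ∈ parityPart A odd false := by
      rw [← hodd _ (hj i)]; exact bg_mem_parity false (σ i)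
    change ⁅gF A odd (σ i), gE A odd j⁆ = 0
    rw [← neg_eq_zero, ← even_skew hf, gE_gF, if_neg (hj i).symm]
  e_v' i := by
    refine Subtype.ext ?_
    change ⁅gE A odd (σ i), gF A odd j⁆ = 0
    rw [gE_gF, if_neg (hj i)]
  h_v' i := by
    refine Subtype.ext ?_
    change ⁅gH A odd (σ i), gF A odd j⁆ = (-(A (σ i) j : ℝ)) • gF A odd j
    rw [gH_gF, neg_smul]
  e_f' i k y := by
    refine Subtype.ext ?_
    have he : gE A odd (σ i) ∈ parityPart A odd false := by
      rw [← hodd _ (hj i)]; exact bg_mem_parity true (σ i)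
    change ⁅gE A odd (σ i), ⁅gF A odd (σ k), (y : Borcherds A odd)⁆⁆ = _
    rw [even_leibniz he, gE_gF, add_comm, Submodule.coe_add]
    congr 1
    by_cases h : i = k
    · subst h
      rw [if_pos rfl, if_pos rfl]
      rfl
    · rw [if_neg h, if_neg fun h' => h (hσ h'), zero_bracket]
      rfl
  h_f' i k y := by
    refine Subtype.ext ?_
    change ⁅gH A odd (σ i), ⁅gF A odd (σ k), (y : Borcherds A odd)⁆⁆ =
      ⁅gF A odd (σ k), ⁅gH A odd (σ i), (y : Borcherds A odd)⁆⁆ -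
        (A (σ i) (σ k) : ℝ) • ⁅gF A odd (σ k), (y : Borcherds A odd)⁆
    rw [even_leibniz (gH_mem_parity _), gH_gF, neg_bracket, smul_bracket, neg_add_eq_sub]
  b_v := by
    refine ((borcherdsForm_standard hA j).ef j j).trans ?_
    rw [if_pos rfl]
  generate P hv he := by
    have h1 : level A odd j (-1) ≤ P.map (level A odd j (-1)).subtype := by
      refine level_neg_one_le ⟨_, hv, rfl⟩ ?_
      rintro i hi _ ⟨x, hx, rfl⟩
      obtain ⟨k, rfl⟩ := hr i hi
      exact ⟨_, he k x hx, rfl⟩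
    refine eq_top_iff.2 fun x _ => ?_
    obtain ⟨y, hy, hyx⟩ := h1 x.2
    rwa [← Subtype.ext hyx]
  generate' P hv hf := by
    have h1 : level A odd j 1 ≤ P.map (level A odd j 1).subtype := by
      refine level_pos_one_le ⟨_, hv, rfl⟩ ?_
      rintro i hi _ ⟨x, hx, rfl⟩
      obtain ⟨k, rfl⟩ := hr i hi
      exact ⟨_, hf k x hx, rfl⟩
    refine eq_top_iff.2 fun x _ => ?_
    obtain ⟨y, hy, hyx⟩ := h1 x.2
    rwa [← Subtype.ext hyx]
  nondegenerate x hx := Subtype.ext <| eq_zero_of_borcherdsForm hA (p := -1) (by norm_num) x.2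
    fun y hy => hx ⟨y, by simpa using hy⟩
  nondegenerate' y hy := Subtype.ext <| eq_zero_of_borcherdsForm hA (p := 1) (by norm_num) y.2
    fun x hx => by
      rw [(borcherdsForm_standard hA j).supersymm _ _ _ (level_le_parity hodd _ y.2) _
        (level_le_parity hodd _ hx)]
      exact mul_eq_zero_of_right _ (hy ⟨x, hx⟩)

end LevelPair

/-! ### The tensor product with the fundamental representation of `sl_m` -/

section Tensor

variable {V V' : Type} [AddCommGroup V] [Module ℝ V] [AddCommGroup V'] [Module ℝ V']

/-- The matrix unit with the entry `1` at `(a, b)`. -/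
def matUnit (V : Type) [AddCommGroup V] [Module ℝ V] {m : ℕ} (a b : Fin m) :
    (Fin m → V) →ₗ[ℝ] (Fin m → V) := LinearMap.single ℝ (fun _ => V) a ∘ₗ LinearMap.proj b

theorem matUnit_apply {m : ℕ} (a b : Fin m) (x : Fin m → V) :
    matUnit V a b x = Pi.single a (x b) := rfl

theorem matUnit_matUnit {m : ℕ} (a b c d : Fin m) (x : Fin m → V) :
    matUnit V a b (matUnit V c d x) = if b = c then matUnit V a d x else 0 := by
  simp only [matUnit_apply]
  split_ifs with h
  · rw [h, Pi.single_eq_same]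
  · rw [Pi.single_eq_of_ne h, Pi.single_zero]

theorem compLeft_matUnit {m : ℕ} (D : V →ₗ[ℝ] V) (a b : Fin m) (x : Fin m → V) :
    D.compLeft (Fin m) (matUnit V a b x) = matUnit V a b (D.compLeft (Fin m) x) := by
  funext c
  simp only [matUnit_apply, LinearMap.compLeft_apply, Function.comp_apply, Pi.single_apply]
  split_ifs
  · rfl
  · rw [map_zero]

/-- The componentwise pairing. -/
def sumPairing (b : V →ₗ[ℝ] V' →ₗ[ℝ] ℝ) (m : ℕ) :
    (Fin m → V) →ₗ[ℝ] (Fin m → V') →ₗ[ℝ] ℝ :=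
  ∑ a, (b ∘ₗ LinearMap.proj a).compl₂ (LinearMap.proj a)

theorem sumPairing_apply (b : V →ₗ[ℝ] V' →ₗ[ℝ] ℝ) {m : ℕ} (x : Fin m → V) (y : Fin m → V') :
    sumPairing b m x y = ∑ a, b (x a) (y a) := by
  simp [sumPairing]

theorem sumPairing_single_left (b : V →ₗ[ℝ] V' →ₗ[ℝ] ℝ) {m : ℕ} (a : Fin m) (x : V)
    (y : Fin m → V') : sumPairing b m (Pi.single a x) y = b x (y a) := by
  rw [sumPairing_apply, Finset.sum_eq_single a]
  · rw [Pi.single_eq_same]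
  · intro c _ hc
    rw [Pi.single_eq_of_ne hc, map_zero, LinearMap.zero_apply]
  · simp

theorem sumPairing_single_right (b : V →ₗ[ℝ] V' →ₗ[ℝ] ℝ) {m : ℕ} (a : Fin m) (x : Fin m → V)
    (y : V') : sumPairing b m x (Pi.single a y) = b (x a) y := by
  rw [sumPairing_apply, Finset.sum_eq_single a]
  · rw [Pi.single_eq_same]
  · intro c _ hc
    rw [Pi.single_eq_of_ne hc, map_zero]
  · simp

/-- The Cartan matrix of the disjoint union of a diagram with a chain of `m` nodes. -/
def chainSum {K : Type} (A : Matrix K K ℤ) (m : ℕ) : Matrix (Fin m ⊕ K) (Fin m ⊕ K) ℤ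
  | .inl i, .inl j => if i = j then 2 else
      if i.val + 1 = j.val ∨ j.val + 1 = i.val then -1 else 0
  | .inr i, .inr j => A i j
  | _, _ => 0

/-- The weight of the tensor product. -/
def chainWeight {K : Type} (lam : K → ℝ) (m : ℕ) : Fin m ⊕ K → ℝ
  | .inl i => if i.val + 1 = m then 1 else 0
  | .inr i => lam i

theorem eq_top_of_single_mem {m : ℕ} {P : Submodule ℝ (Fin (m + 1) → V)}
    (h1 : ∀ x, Pi.single (Fin.last m) x ∈ P)
    (h2 : ∀ (i : Fin m) x, Pi.single i.succ x ∈ P → Pi.single i.castSucc x ∈ P) : P = ⊤ := by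
  have h3 : ∀ (a : Fin (m + 1)) x, Pi.single a x ∈ P := by
    intro a x
    induction a using Fin.reverseInduction with
    | last => exact h1 x
    | cast i ih => exact h2 i x ih
  refine eq_top_iff.2 fun x _ => ?_
  rw [← Finset.univ_sum_single x]
  exact sum_mem fun a _ => h3 a _

/-- The tensor product of a dual pair with the fundamental representation of `sl_{m+1}`. -/
def DualPair.tensor {K : Type} [DecidableEq K] {A : Matrix K K ℤ} {lam : K → ℝ}
    (L : DualPair A lam V V') (m : ℕ) :
    DualPair (chainSum A m) (chainWeight lam m) (Fin (m + 1) → V) (Fin (m + 1) → V') where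
  e := Sum.elim (fun i => matUnit V i.castSucc i.succ) fun i => (L.e i).compLeft (Fin (m + 1))
  f := Sum.elim (fun i => matUnit V i.succ i.castSucc) fun i => (L.f i).compLeft (Fin (m + 1))
  e' := Sum.elim (fun i => -matUnit V' i.succ i.castSucc) fun i => (L.e' i).compLeft (Fin (m + 1))
  f' := Sum.elim (fun i => -matUnit V' i.castSucc i.succ) fun i => (L.f' i).compLeft (Fin (m + 1))
  h' := Sum.elim (fun i => matUnit V' i.succ i.succ - matUnit V' i.castSucc i.castSucc)
    fun i => (L.h' i).compLeft (Fin (m + 1))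
  b := sumPairing L.b (m + 1)
  -- The matrix units `f` of entry (i + 1, i) kill the last basis vector, so it is the lowest weight
  -- vector of the fundamental representation. It belongs to the end of the chain at which the node
  -- m is attached.
  v := Pi.single (Fin.last m) L.v
  v' := Pi.single (Fin.last m) L.v'
  b_e i x y := by
    rcases i with i | i
    · simp [matUnit_apply, sumPairing_single_left, sumPairing_single_right]
    · simp [sumPairing_apply, L.b_e]
  b_f i x y := by
    rcases i with i | i
    · simp [matUnit_apply, sumPairing_single_left, sumPairing_single_right]
    · simp [sumPairing_apply, L.b_f]
  f_v i := by
    rcases i with i | i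
    · simp [matUnit_apply]
    · funext a
      simp [Pi.single_apply, apply_ite (L.f i), L.f_v]
  e_v' i := by
    rcases i with i | i
    · simp [matUnit_apply]
    · funext a
      simp [Pi.single_apply, apply_ite (L.e' i), L.e_v']
  h_v' i := by
    rcases i with i | i
    · simp only [Sum.elim_inl, LinearMap.sub_apply, matUnit_apply, chainWeight]
      rw [Pi.single_eq_of_ne (Fin.castSucc_lt_last i).ne, Pi.single_zero, sub_zero]
      by_cases h : i.val + 1 = m
      · have : i.succ = Fin.last m := Fin.ext h
        rw [this, Pi.single_eq_same, if_pos h, one_smul]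
      · have : i.succ ≠ Fin.last m := fun h' => h (congrArg Fin.val h')
        rw [Pi.single_eq_of_ne this, Pi.single_zero, if_neg h, zero_smul]
    · funext a
      simp only [Sum.elim_inr, LinearMap.compLeft_apply, Function.comp_apply, Pi.smul_apply,
        chainWeight, Pi.single_apply]
      split_ifs
      · rw [L.h_v']
      · rw [map_zero, smul_zero]
  e_f' i j y := by
    rcases i with i | i <;> rcases j with j | j
    · simp only [Sum.elim_inl, LinearMap.neg_apply, LinearMap.sub_apply, map_neg, neg_neg,
        matUnit_matUnit, Sum.inl.injEq, Fin.castSucc_inj, Fin.succ_inj]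
      by_cases h : i = j
      · subst h; simp
      · rw [if_neg h, if_neg h, if_neg (Ne.symm h), add_zero]
    · simp [compLeft_matUnit]
    · simp [compLeft_matUnit]
    · funext a
      simp only [Sum.elim_inr, LinearMap.compLeft_apply, Function.comp_apply, Pi.add_apply,
        L.e_f', Sum.inr.injEq]
      split_ifs <;> simp
  h_f' i j y := by
    rcases i with i | i <;> rcases j with j | j
    · simp only [Sum.elim_inl, LinearMap.neg_apply, LinearMap.sub_apply, map_neg, map_sub,
        matUnit_matUnit, Fin.castSucc_inj, Fin.succ_inj, chainSum]
      have h1 : (i.succ = j.castSucc) ↔ i.val + 1 = j.val := by simp [Fin.ext_iff]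
      have h2 : (j.succ = i.castSucc) ↔ j.val + 1 = i.val := by simp [Fin.ext_iff]
      by_cases h : i = j
      · subst h
        have h3 : i.succ ≠ i.castSucc := fun h3 => by have := h1.1 h3; omega
        simp [two_smul, h3]
      · have h' := Ne.symm h
        simp only [h, h', h1, h2, if_false]
        by_cases h3 : i.val + 1 = j.val
        · have h4 : ¬ (j.val + 1 = i.val) := by omega
          have h5 : i.succ = j.castSucc := h1.2 h3
          simp [h3, h4, h5]
        · by_cases h4 : j.val + 1 = i.val
          · have h5 : j.succ = i.castSucc := h2.2 h4
            simp [h3, h4, h5]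
          · simp [h3, h4]
    · simp [compLeft_matUnit, chainSum]
    · simp [compLeft_matUnit, chainSum]
    · funext a
      simp [L.h_f', chainSum]
  b_v := by rw [sumPairing_single_left, Pi.single_eq_same, L.b_v]
  generate P hv he := by
    have h1 : P.comap (LinearMap.single ℝ (fun _ => V) (Fin.last m)) = ⊤ := by
      refine L.generate _ hv fun i x hx => ?_
      have := he (.inr i) _ hx
      rw [Submodule.mem_comap]
      convert this using 1
      funext a
      simp [Pi.single_apply, apply_ite (L.e i)]
    refine eq_top_of_single_mem (fun x => ?_) fun i x hx => ?_
    · have : x ∈ P.comap (LinearMap.single ℝ (fun _ => V) (Fin.last m)) := by rw [h1]; trivial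
      exact this
    · have := he (.inl i) _ hx
      simpa [matUnit_apply] using this
  generate' P hv hf := by
    have h1 : P.comap (LinearMap.single ℝ (fun _ => V') (Fin.last m)) = ⊤ := by
      refine L.generate' _ hv fun i x hx => ?_
      have := hf (.inr i) _ hx
      rw [Submodule.mem_comap]
      convert this using 1
      funext a
      simp [Pi.single_apply, apply_ite (L.f' i)]
    refine eq_top_of_single_mem (fun x => ?_) fun i x hx => ?_
    · have : x ∈ P.comap (LinearMap.single ℝ (fun _ => V') (Fin.last m)) := by rw [h1]; trivial
      exact this
    · have := hf (.inl i) _ hx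
      simpa [matUnit_apply] using this
  nondegenerate x hx := funext fun a => L.nondegenerate _ fun y => by
    rw [← sumPairing_single_right, hx]
  nondegenerate' y hy := funext fun a => L.nondegenerate' _ fun x => by
    rw [← sumPairing_single_left, hy]

end Tensor

end TensorHierarchy
end

noncomputable section
set_option linter.unusedSectionVars false
namespace TensorHierarchy
open scoped TensorProduct

/-! ### Existence of the level decomposition -/

section Existence

variable {n m r : ℕ}

theorem cartanE_symm (r : ℕ) (i k : Fin r) : cartanE r i k = cartanE r k i := by
  unfold cartanE
  by_cases h : i = k
  · subst h; rfl
  · rw [if_neg h, if_neg (Ne.symm h)]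
    refine if_congr ?_ rfl rfl
    tauto

theorem cartanU_symm (n : ℕ) (i k : Option (Fin n)) : cartanU n i k = cartanU n k i := by
  rcases i with _ | i <;> rcases k with _ | k
  · rfl
  · rfl
  · rfl
  · exact cartanE_symm n i k

theorem cartanE_nodeE (hr : m + n = r) (i k : Fin n) :
    cartanE r (nodeE hr i) (nodeE hr k) = cartanE n i k := by
  unfold cartanE
  have h : nodeE hr i = nodeE hr k ↔ i = k := by
    simp only [nodeE, Fin.ext_iff]
    omega
  rw [if_congr h rfl rfl]
  congr 1
  refine if_congr ?_ rfl rfl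
  simp only [nodeE]
  omega

/-- The bound `4 ≤ n` places both the branching node r − 3 and the node r inside E_n, so the first m
nodes form a plain chain. -/
theorem cartanE_nodeSl (hr : m + n = r) (hn : 4 ≤ n) (i k : Fin m) :
    cartanE r (nodeSl hr i) (nodeSl hr k) =
      if i = k then 2 else if i.val + 1 = k.val ∨ k.val + 1 = i.val then -1 else 0 := by
  unfold cartanE
  have h : nodeSl hr i = nodeSl hr k ↔ i = k := by
    simp only [nodeSl, Fin.ext_iff]
  rw [if_congr h rfl rfl]
  congr 1
  refine if_congr ?_ rfl rfl
  simp only [nodeSl]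
  omega

theorem cartanE_nodeSl_nodeE (hr : m + n = r) (hn : 4 ≤ n) (i : Fin m) (k : Fin n) :
    cartanE r (nodeSl hr i) (nodeE hr k) = if i.val + 1 = m ∧ k.val = 0 then -1 else 0 := by
  unfold cartanE
  have h : nodeSl hr i ≠ nodeE hr k := by
    simp only [nodeSl, nodeE, ne_eq, Fin.ext_iff]
    omega
  rw [if_neg h]
  refine if_congr ?_ rfl rfl
  simp only [nodeSl, nodeE]
  omega

theorem nodeE_isSubdiagram (hr : m + n = r) :
    IsSubdiagram (cartanE n) (fun _ => false) (cartanE r) (fun _ => false) (nodeE hr) where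
  injective i k h := by simpa [nodeE, Fin.ext_iff] using h
  cartan := cartanE_nodeE hr
  parity _ := rfl
  symm := cartanE_symm r

theorem some_isSubdiagram (n : ℕ) :
    IsSubdiagram (cartanE n) (fun _ => false) (cartanU n) Option.isNone some where
  injective := Option.some_injective _
  cartan _ _ := rfl
  parity _ := rfl
  symm := cartanU_symm n

theorem isNone_odd {n : ℕ} (i : Option (Fin n)) (h : i ≠ none) : Option.isNone i = false := by
  cases i with
  | none => exact absurd rfl h
  | some _ => rfl

/-- The nodes of `E_r` different from the node `m`. -/
def nodeSum (hr : m + 1 + n = r) : Fin m ⊕ Fin n → Fin r :=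
  Sum.elim (fun i => nodeSl hr i.castSucc) (nodeE hr)

theorem nodeSum_injective (hr : m + 1 + n = r) : Function.Injective (nodeSum hr) := by
  rintro (i | i) (k | k) h <;>
    simp only [nodeSum, Sum.elim_inl, Sum.elim_inr, nodeSl, nodeE, Fin.ext_iff,
      Fin.val_castSucc] at h
  · rw [Fin.ext h]
  · omega
  · omega
  · rw [Fin.ext (Nat.add_left_cancel h)]

theorem nodeSum_ne (hm : 1 ≤ m + 1) (hr : m + 1 + n = r) (i : Fin m ⊕ Fin n) :
    nodeSum hr i ≠ nodeL hm hr := by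
  rcases i with i | i <;>
    simp only [nodeSum, Sum.elim_inl, Sum.elim_inr, nodeSl, nodeE, nodeL, Fin.ext_iff, ne_eq,
      Fin.val_castSucc] <;> omega

theorem exists_nodeSum (hm : 1 ≤ m + 1) (hr : m + 1 + n = r) (i : Fin r) (hi : i ≠ nodeL hm hr) :
    ∃ k, nodeSum hr k = i := by
  have hi' : i.val ≠ m := fun h => hi (Fin.ext h)
  by_cases h : i.val < m
  · exact ⟨.inl ⟨i, h⟩, rfl⟩
  · refine ⟨.inr ⟨i - (m + 1), by omega⟩, Fin.ext ?_⟩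
    simp only [nodeSum, Sum.elim_inr, nodeE]
    omega

theorem chainSum_eq (hr : m + 1 + n = r) (hn : 4 ≤ n) :
    chainSum (fun i k => cartanU n (some i) (some k)) m =
      fun i k => cartanE r (nodeSum hr i) (nodeSum hr k) := by
  funext i k
  rcases i with i | i <;> rcases k with k | k
  · simp only [nodeSum, Sum.elim_inl, chainSum]
    rw [cartanE_nodeSl hr hn]
    simp [Fin.castSucc_inj]
  · simp only [nodeSum, Sum.elim_inl, Sum.elim_inr, chainSum]
    rw [cartanE_nodeSl_nodeE hr hn, if_neg]
    simp only [Fin.val_castSucc]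
    omega
  · simp only [nodeSum, Sum.elim_inl, Sum.elim_inr, chainSum]
    rw [cartanE_symm, cartanE_nodeSl_nodeE hr hn, if_neg]
    simp only [Fin.val_castSucc]
    omega
  · exact (cartanE_nodeE hr i k).symm

/-- The node m is joined exactly to the end of the chain and to the first node of E_n, and the
latter is where the node 0 is attached in U_{n+1}. -/
theorem chainWeight_eq (hm : 1 ≤ m + 1) (hr : m + 1 + n = r) (hn : 4 ≤ n) :
    chainWeight (fun i => -(cartanU n (some i) none : ℝ)) m =
      fun i => -(cartanE r (nodeSum hr i) (nodeL hm hr) : ℝ) := by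
  funext i
  rcases i with i | i
  · simp only [nodeSum, Sum.elim_inl, nodeL, chainWeight]
    have h1 : i.castSucc ≠ ⟨m + 1 - 1, by omega⟩ := fun h => by
      have := congrArg Fin.val h
      simp only [Fin.val_castSucc] at this
      omega
    rw [cartanE_nodeSl hr hn, if_neg h1]
    have h2 : (i.castSucc.val + 1 = m + 1 - 1 ∨ m + 1 - 1 + 1 = i.castSucc.val) ↔ i.val + 1 = m := by
      simp only [Fin.val_castSucc]
      omega
    rw [if_congr h2 rfl rfl]
    split_ifs <;> simp
  · simp only [nodeSum, Sum.elim_inr, nodeL, chainWeight]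
    rw [cartanE_symm, cartanE_nodeSl_nodeE hr hn]
    simp [cartanU]

variable {κ : Type} [DecidableEq κ] [Fintype κ] in
/-- Equivariance can be checked on the Chevalley generators. -/
theorem equivariant_of_generators {A : Matrix κ κ ℤ} {X Y : Type} [AddCommGroup X] [Module ℝ X]
    [AddCommGroup Y] [Module ℝ Y] (a : KacMoody A → X →ₗ[ℝ] X) (b : KacMoody A → Y →ₗ[ℝ] Y)
    (ha : ∀ z w x, a ⁅z, w⁆ x = a z (a w x) - a w (a z x))
    (hb : ∀ z w x, b ⁅z, w⁆ x = b z (b w x) - b w (b z x))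
    (ha_add : ∀ z w x, a (z + w) x = a z x + a w x) (hb_add : ∀ z w x, b (z + w) x = b z x + b w x)
    (ha_smul : ∀ (c : ℝ) z x, a (c • z) x = c • a z x)
    (hb_smul : ∀ (c : ℝ) z x, b (c • z) x = c • b z x) (Φ : X →ₗ[ℝ] Y)
    (he : ∀ i x, Φ (a (gE A _ i) x) = b (gE A _ i) (Φ x))
    (hf : ∀ i x, Φ (a (gF A _ i) x) = b (gF A _ i) (Φ x)) (z : KacMoody A) (x : X) :
    Φ (a z x) = b z (Φ x) := by
  induction z using borcherds_induction generalizing x with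
  | h0 =>
    have h1 := ha_smul 0 0 x
    have h2 := hb_smul 0 0 (Φ x)
    rw [zero_smul, zero_smul] at h1 h2
    rw [h1, h2, map_zero]
  | hadd z w hz hw => rw [ha_add, hb_add, map_add, hz, hw]
  | hsmul c z hz => rw [ha_smul, hb_smul, map_smul, hz]
  | hmon u =>
    induction u generalizing x with
    | ih1 g =>
      cases g with
      | e i => exact he i x
      | f i => exact hf i x
      | h i =>
        have : proj A (fun _ => false) (mon (.of (.h i))) =
            ⁅gE A (fun _ => false) i, gF A (fun _ => false) i⁆ := by
          rw [gE_gF, if_pos rfl]; rfl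
        rw [this, ha, hb, map_sub, he, hf, hf, he]
    | ih2 u v hu hv =>
      rw [← proj_mon_bracket, ha, hb, map_sub, hu, hv, hv, hu]

variable (n) in
/-- The embedding of `E_n` into `U_{n+1}`. -/
def embedU : E n →ₗ[ℝ] U n := borcherdsMap (some_isSubdiagram n)

theorem embedU_mem (z : E n) : embedU n z ∈ levelU n 0 :=
  borcherdsMap_mem_level _ (fun i => Option.some_ne_none i) z

/-- The embedding of `E_n` into `E_r`. -/
def embedE (hr : m + n = r) : E n →ₗ⁅ℝ⁆ E r :=
  { borcherdsMap (nodeE_isSubdiagram hr) with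
    map_lie' := fun {x y} => borcherdsMap_bracket (nodeE_isSubdiagram hr) x y }

theorem embedU_even (z : E n) : embedU n z ∈ parityPart (cartanU n) Option.isNone false :=
  level_le_parity isNone_odd 0 (embedU_mem z)

theorem parityPart_false_eq_top {ι : Type} [DecidableEq ι] [Fintype ι] (A : Matrix ι ι ℤ)
    (x : KacMoody A) : x ∈ parityPart A (fun _ => false) false := by
  induction x using borcherds_induction with
  | h0 => exact zero_mem _
  | hadd a b ha hb => exact add_mem ha hb
  | hsmul c a ha => exact Submodule.smul_mem _ _ ha
  | hmon u => exact Submodule.subset_span ⟨u, monParity_false u, rfl⟩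

theorem embedU_equivariant {p : ℤ} {hr : m + n = r}
    (Φ : levelU n p →ₗ[ℝ] E r)
    (he : ∀ i (x : levelU n p), Φ (adLevel (bg_mem_level_zero true (Option.some_ne_none i)) p x) =
      ⁅(gE _ _ (nodeE hr i) : E r), Φ x⁆)
    (hf : ∀ i (x : levelU n p), Φ (adLevel (bg_mem_level_zero false (Option.some_ne_none i)) p x) =
      ⁅(gF _ _ (nodeE hr i) : E r), Φ x⁆)
    (z : E n) (x x' : levelU n p) (hx : (x' : U n) = ⁅embedU n z, (x : U n)⁆) :
    Φ x' = ⁅embedE hr z, Φ x⁆ := by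
  have := equivariant_of_generators (fun z => adLevel (embedU_mem z) p)
    (fun z => superBr (cartanE r) (fun _ => false) (embedE hr z))
    (fun z w x => Subtype.ext (by
      simp only [adLevel_coe, Submodule.coe_sub]
      rw [embedU, borcherdsMap_bracket, eq_sub_iff_add_eq]
      exact (even_leibniz (embedU_even z) _ _).symm))
    (fun z w x => by
      simp only [← bracket_def]
      rw [LieHom.map_lie, lie_lie])
    (fun z w x => Subtype.ext (by
      simp only [adLevel_coe, Submodule.coe_add, map_add, add_bracket]))
    (fun z w x => by simp only [map_add, LinearMap.add_apply])
    (fun c z x => Subtype.ext (by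
      simp only [adLevel_coe, Submodule.coe_smul, map_smul, smul_bracket]))
    (fun c z x => by simp only [map_smul, LinearMap.smul_apply]) Φ
    (fun i x => by
      have h1 : embedU n (gE _ _ i) = gE _ _ (some i) := borcherdsMap_proj _ _
      have h2 : embedE hr (gE _ _ i) = gE _ _ (nodeE hr i) :=
        borcherdsMap_proj (nodeE_isSubdiagram hr) _
      rw [h2]
      refine Eq.trans (congrArg Φ (Subtype.ext ?_)) (he i x)
      exact congrArg (fun w => ⁅w, (x : U n)⁆) h1)
    (fun i x => by
      have h1 : embedU n (gF _ _ i) = gF _ _ (some i) := borcherdsMap_proj _ _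
      have h2 : embedE hr (gF _ _ i) = gF _ _ (nodeE hr i) :=
        borcherdsMap_proj (nodeE_isSubdiagram hr) _
      rw [h2]
      refine Eq.trans (congrArg Φ (Subtype.ext ?_)) (hf i x)
      exact congrArg (fun w => ⁅w, (x : U n)⁆) h1) z x
  rw [bracket_def, ← this]
  congr 1
  exact Subtype.ext hx

/-- The tensor product of the pair of U_{n+1} with the fundamental representation has the Cartan
matrix and weight of the level ∓1 pair of E_r. The resulting isomorphisms, restricted to the
individual indices, are `xE` and `xF`; equivariance and duality are the intertwining properties. -/
theorem nonempty_levelDecomposition (hn : 4 ≤ n) (hm : 1 ≤ m) (hr : m + n = r) :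
    Nonempty (LevelDecomposition hm hr) := by
  obtain ⟨m, rfl⟩ : ∃ k, m = k + 1 := ⟨m - 1, by omega⟩
  let LU := levelPair (odd := Option.isNone) (cartanU_symm n) none some (Option.some_injective _)
    (fun i => Option.some_ne_none i) (fun i hi => Option.ne_none_iff_exists.1 hi) isNone_odd
  let LE := levelPair (odd := fun _ => false) (cartanE_symm r) (nodeL hm hr) (nodeSum hr)
    (nodeSum_injective hr) (nodeSum_ne hm hr) (exists_nodeSum hm hr) fun _ _ => rfl
  obtain ⟨Φ, Φ', he, hf, he', hf', hb⟩ :=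
    (LU.tensor m).exists_equiv (chainSum_eq hr hn) (chainWeight_eq hm hr hn) LE
  have hsum : ∀ x : Fin (m + 1) → levelU n (-1),
      ∑ a, (Φ (Pi.single a (x a)) : E r) = (Φ x : E r) := fun x => by
    rw [← Submodule.coe_sum, ← map_sum, Finset.univ_sum_single]
  have hsum' : ∀ y : Fin (m + 1) → levelU n 1,
      ∑ a, (Φ' (Pi.single a (y a)) : E r) = (Φ' y : E r) := fun y => by
    rw [← Submodule.coe_sum, ← map_sum, Finset.univ_sum_single]
  have hij : ∀ i j : Fin (m + 1), i.val + 1 = j.val →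
      ∃ k : Fin m, i = k.castSucc ∧ j = k.succ := fun i j h =>
    ⟨⟨i, by omega⟩, rfl, Fin.ext h.symm⟩
  have hcl : ∀ (D : levelU n (-1) →ₗ[ℝ] levelU n (-1)) (a : Fin (m + 1)) x,
      D.compLeft (Fin (m + 1)) (Pi.single a x) = Pi.single a (D x) := fun D a x => by
    funext c
    simp only [LinearMap.compLeft_apply, Function.comp_apply, Pi.single_apply]
    split_ifs
    · rfl
    · rw [map_zero]
  have hcl' : ∀ (D : levelU n 1 →ₗ[ℝ] levelU n 1) (a : Fin (m + 1)) x,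
      D.compLeft (Fin (m + 1)) (Pi.single a x) = Pi.single a (D x) := fun D a x => by
    funext c
    simp only [LinearMap.compLeft_apply, Function.comp_apply, Pi.single_apply]
    split_ifs
    · rfl
    · rw [map_zero]
  exact ⟨{
    formU := borcherdsForm (cartanU_symm n)
    formU_standard := borcherdsForm_standard _ _
    formE := borcherdsForm (cartanE_symm r)
    formE_standard := borcherdsForm_standard _ _
    enU := embedU n
    enU_lie := borcherdsMap_bracket _
    enU_e := fun i => borcherdsMap_proj _ _
    enU_f := fun i => borcherdsMap_proj _ _
    enU_mem := embedU_mem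
    enE := embedE hr
    enE_e := fun i => borcherdsMap_proj (nodeE_isSubdiagram hr) _
    enE_f := fun i => borcherdsMap_proj (nodeE_isSubdiagram hr) _
    xE := fun a => (levelE hm hr (-1)).subtype ∘ₗ Φ.toLinearMap ∘ₗ
      LinearMap.single ℝ (fun _ => levelU n (-1)) a
    xF := fun a => (levelE hm hr 1).subtype ∘ₗ Φ'.toLinearMap ∘ₗ
      LinearMap.single ℝ (fun _ => levelU n 1) a
    xE_injective := fun x y h => Φ.injective (Subtype.ext ((hsum x).symm.trans (h.trans (hsum y))))
    xE_range := by
      ext w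
      constructor
      · rintro ⟨x, rfl⟩
        exact sum_mem fun a _ => (Φ (Pi.single a (x a))).2
      · intro hw
        exact ⟨Φ.symm ⟨w, hw⟩, (hsum _).trans (by rw [LinearEquiv.apply_symm_apply])⟩
    xF_injective := fun x y h =>
      Φ'.injective (Subtype.ext ((hsum' x).symm.trans (h.trans (hsum' y))))
    xF_range := by
      ext w
      constructor
      · rintro ⟨x, rfl⟩
        exact sum_mem fun a _ => (Φ' (Pi.single a (x a))).2
      · intro hw
        exact ⟨Φ'.symm ⟨w, hw⟩, (hsum' _).trans (by rw [LinearEquiv.apply_symm_apply])⟩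
    xE_equivariant := fun z a x x' hx => by
      refine embedU_equivariant (hr := hr) _ (fun i x => ?_) (fun i x => ?_) z x x' hx
      · have := congrArg Subtype.val (he (.inr i) (Pi.single a x))
        rw [show (LU.tensor m).e (.inr i) (Pi.single a x) = Pi.single a (LU.e i x) from
          hcl _ _ _] at this
        exact this
      · have := congrArg Subtype.val (hf (.inr i) (Pi.single a x))
        rw [show (LU.tensor m).f (.inr i) (Pi.single a x) = Pi.single a (LU.f i x) from
          hcl _ _ _] at this
        exact this
    xF_equivariant := fun z a x x' hx => by
      refine embedU_equivariant (hr := hr) _ (fun i x => ?_) (fun i x => ?_) z x x' hx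
      · have := congrArg Subtype.val (he' (.inr i) (Pi.single a x))
        rw [show (LU.tensor m).e' (.inr i) (Pi.single a x) = Pi.single a (LU.e' i x) from
          hcl' _ _ _] at this
        exact this
      · have := congrArg Subtype.val (hf' (.inr i) (Pi.single a x))
        rw [show (LU.tensor m).f' (.inr i) (Pi.single a x) = Pi.single a (LU.f' i x) from
          hcl' _ _ _] at this
        exact this
    xE_sl_e := fun i j h a x => by
      obtain ⟨k, rfl, rfl⟩ := hij i j h
      refine (congrArg Subtype.val (he (.inl k) (Pi.single a x))).symm.trans ?_
      rw [show (LU.tensor m).e (.inl k) (Pi.single a x) = Pi.single k.castSucc ((Pi.single a x :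
        Fin (m + 1) → levelU n (-1)) k.succ) from rfl]
      split_ifs with h1
      · subst h1; rw [Pi.single_eq_same]; rfl
      · rw [Pi.single_eq_of_ne (Ne.symm h1), Pi.single_zero, map_zero]; rfl
    xE_sl_f := fun i j h a x => by
      obtain ⟨k, rfl, rfl⟩ := hij i j h
      refine (congrArg Subtype.val (hf (.inl k) (Pi.single a x))).symm.trans ?_
      rw [show (LU.tensor m).f (.inl k) (Pi.single a x) = Pi.single k.succ ((Pi.single a x :
        Fin (m + 1) → levelU n (-1)) k.castSucc) from rfl]
      split_ifs with h1
      · subst h1; rw [Pi.single_eq_same]; rfl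
      · rw [Pi.single_eq_of_ne (Ne.symm h1), Pi.single_zero, map_zero]; rfl
    xF_sl_e := fun i j h a x => by
      obtain ⟨k, rfl, rfl⟩ := hij i j h
      refine (congrArg Subtype.val (he' (.inl k) (Pi.single a x))).symm.trans ?_
      rw [show (LU.tensor m).e' (.inl k) (Pi.single a x) = -Pi.single k.succ ((Pi.single a x :
        Fin (m + 1) → levelU n 1) k.castSucc) from rfl, map_neg]
      split_ifs with h1
      · subst h1; rw [Pi.single_eq_same]; rfl
      · rw [Pi.single_eq_of_ne (Ne.symm h1), Pi.single_zero, map_zero, neg_zero]; rfl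
    xF_sl_f := fun i j h a x => by
      obtain ⟨k, rfl, rfl⟩ := hij i j h
      refine (congrArg Subtype.val (hf' (.inl k) (Pi.single a x))).symm.trans ?_
      rw [show (LU.tensor m).f' (.inl k) (Pi.single a x) = -Pi.single k.castSucc ((Pi.single a x :
        Fin (m + 1) → levelU n 1) k.succ) from rfl, map_neg]
      split_ifs with h1
      · subst h1; rw [Pi.single_eq_same]; rfl
      · rw [Pi.single_eq_of_ne (Ne.symm h1), Pi.single_zero, map_zero, neg_zero]; rfl
    dual := fun a b x y => by
      refine (hb (Pi.single a x) (Pi.single b y)).trans ?_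
      refine (sumPairing_single_left LU.b a x _).trans ?_
      split_ifs with h
      · subst h; rw [Pi.single_eq_same]; rfl
      · rw [Pi.single_eq_of_ne h, map_zero] }⟩

end Existence

end TensorHierarchy
end

noncomputable section
set_option linter.unusedSectionVars false
namespace TensorHierarchy
open scoped TensorProduct

/-! ### The triple bracket -/

section TripleBracket

variable {n m r : ℕ}

theorem IsStandardForm.eq_zero_right {ι : Type} [DecidableEq ι] [Fintype ι] {A : Matrix ι ι ℤ}
    {odd : ι → Bool} {j : ι} (hodd : ∀ i, i ≠ j → odd i = false)
    (hA : ∀ i k, A i k = A k i)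
    {B : Borcherds A odd →ₗ[ℝ] Borcherds A odd →ₗ[ℝ] ℝ} (hB : IsStandardForm A odd j B)
    {y : Borcherds A odd} (hy : y ∈ level A odd j 1)
    (h : ∀ x ∈ level A odd j (-1), B x y = 0) : y = 0 :=
  eq_zero_of_borcherdsForm hA one_ne_zero hy fun x hx => by
    rw [(borcherdsForm_standard hA j).supersymm _ _ _ (level_le_parity hodd _ hy) _
        (level_le_parity hodd _ hx),
      ← hB.eq_on_level_one hodd (borcherdsForm_standard hA j) hx hy, h x hx, mul_zero]

variable (n) in
/-- The generator `e_0` of `U_{n+1}`. -/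
def eZero : levelU n (-1) := ⟨gE _ _ none, bg_mem_level_self true none⟩

variable (n) in
/-- The generator `f_0` of `U_{n+1}`. -/
def fZero : levelU n 1 := ⟨gF _ _ none, bg_mem_level_self false none⟩

theorem bracket_mem_zero (x : levelU n (-1)) (y : levelU n 1) : ⁅(x : U n), (y : U n)⁆ ∈ levelU n 0 := by
  have := level_bracket x.2 y.2
  rwa [neg_add_cancel] at this

theorem levelU_zero_even {z : U n} (hz : z ∈ levelU n 0) :
    z ∈ parityPart (cartanU n) Option.isNone false :=
  level_le_parity isNone_odd 0 hz

namespace LevelDecomposition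

variable {hm : 1 ≤ m} {hr : m + n = r} (d : LevelDecomposition hm hr)

/-- The action of `E_n` on the level `p` subspace of `U_{n+1}`. -/
def act (p : ℤ) (w : E n) : levelU n p →ₗ[ℝ] levelU n p := adLevel (d.enU_mem w) p

theorem act_coe (p : ℤ) (w : E n) (x : levelU n p) : (d.act p w x : U n) = ⁅d.enU w, (x : U n)⁆ :=
  rfl

theorem bracket_xE (w : E n) (a : Fin m) (x : levelU n (-1)) :
    ⁅d.enE w, d.xE a x⁆ = d.xE a (d.act _ w x) := (d.xE_equivariant w a x _ rfl).symm

theorem bracket_xF (w : E n) (a : Fin m) (y : levelU n 1) :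
    ⁅d.enE w, d.xF a y⁆ = d.xF a (d.act _ w y) := (d.xF_equivariant w a y _ rfl).symm

/-- As a lowest weight module, level −1 is generated from e_0 by the raising generators of E_n
alone. -/
theorem neg_induction {P : levelU n (-1) → Prop} (h0 : P (eZero n))
    (hadd : ∀ x y, P x → P y → P (x + y)) (hsmul : ∀ (c : ℝ) x, P x → P (c • x))
    (he : ∀ i x, P x → P (d.act _ (gE _ _ i) x)) (x : levelU n (-1)) : P x := by
  let Q : Submodule ℝ (levelU n (-1)) :=
    { carrier := {x | P x}
      add_mem' := fun ha hb => hadd _ _ ha hb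
      zero_mem' := by
        have := hsmul 0 _ h0
        rwa [zero_smul] at this
      smul_mem' := hsmul }
  have hQ : Q = ⊤ := (levelPair (odd := Option.isNone) (cartanU_symm n) none some
    (Option.some_injective _) (fun i => Option.some_ne_none i)
    (fun i hi => Option.ne_none_iff_exists.1 hi) isNone_odd).generate Q h0 fun i x hx => by
      have := he i x hx
      change P _
      convert this using 1
      exact Subtype.ext (congrArg (fun w => ⁅w, (x : U n)⁆) (d.enU_e i).symm)
  have : x ∈ Q := by rw [hQ]; trivial
  exact this

theorem pos_induction {P : levelU n 1 → Prop} (h0 : P (fZero n))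
    (hadd : ∀ x y, P x → P y → P (x + y)) (hsmul : ∀ (c : ℝ) x, P x → P (c • x))
    (hf : ∀ i x, P x → P (d.act _ (gF _ _ i) x)) (x : levelU n 1) : P x := by
  let Q : Submodule ℝ (levelU n 1) :=
    { carrier := {x | P x}
      add_mem' := fun ha hb => hadd _ _ ha hb
      zero_mem' := by
        have := hsmul 0 _ h0
        rwa [zero_smul] at this
      smul_mem' := hsmul }
  have hQ : Q = ⊤ := (levelPair (odd := Option.isNone) (cartanU_symm n) none some
    (Option.some_injective _) (fun i => Option.some_ne_none i)
    (fun i hi => Option.ne_none_iff_exists.1 hi) isNone_odd).generate' Q h0 fun i x hx => by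
      have := hf i x hx
      change P _
      convert this using 1
      exact Subtype.ext (congrArg (fun w => ⁅w, (x : U n)⁆) (d.enU_f i).symm)
  have : x ∈ Q := by rw [hQ]; trivial
  exact this

theorem act_gF_eZero (i : Fin n) : d.act _ (gF _ _ i) (eZero n) = 0 := by
  refine Subtype.ext ?_
  rw [act_coe, d.enU_f]
  have hf : gF (cartanU n) Option.isNone (some i) ∈ parityPart (cartanU n) Option.isNone false :=
    bg_mem_parity false (some i)
  change ⁅gF (cartanU n) Option.isNone (some i), gE (cartanU n) Option.isNone none⁆ = 0
  rw [← neg_eq_zero, ← even_skew hf, gE_gF, if_neg (Option.some_ne_none i).symm]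

theorem act_gE_fZero (i : Fin n) : d.act _ (gE _ _ i) (fZero n) = 0 := by
  refine Subtype.ext ?_
  rw [act_coe, d.enU_e]
  change ⁅gE (cartanU n) Option.isNone (some i), gF (cartanU n) Option.isNone none⁆ = 0
  rw [gE_gF, if_neg (Option.some_ne_none i)]

/-- The last `sl_m` index. -/
def last (_ : LevelDecomposition hm hr) : Fin m := ⟨m - 1, by omega⟩

theorem last_ne {i j : Fin m} (h : i.val + 1 = j.val) : d.last ≠ i := fun h' => by
  have := congrArg Fin.val h'
  simp only [last] at this
  omega

theorem node_cases (i : Fin r) (hi : i ≠ nodeL hm hr) :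
    (∃ k : Fin n, i = nodeE hr k) ∨ ∃ k j : Fin m, k.val + 1 = j.val ∧ i = nodeSl hr k := by
  have hi' : i.val ≠ m - 1 := fun h => hi (Fin.ext h)
  by_cases h : i.val < m
  · exact Or.inr ⟨⟨i, h⟩, ⟨i + 1, by omega⟩, rfl, rfl⟩
  · refine Or.inl ⟨⟨i - m, by omega⟩, Fin.ext ?_⟩
    simp only [nodeE]
    omega

/-! ### Lowest weight vectors in E_r and the action of h_m -/

theorem xE_mem (a : Fin m) (x : levelU n (-1)) : d.xE a x ∈ levelE hm hr (-1) := by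
  have : d.xE a x ∈ Set.range (fun x : Fin m → levelU n (-1) => ∑ a, d.xE a (x a)) := by
    refine ⟨Pi.single a x, ?_⟩
    dsimp only
    rw [Finset.sum_eq_single a]
    · rw [Pi.single_eq_same]
    · intro b _ hb
      rw [Pi.single_eq_of_ne hb, map_zero]
    · simp
  rw [d.xE_range] at this
  exact this

theorem xF_mem (a : Fin m) (x : levelU n 1) : d.xF a x ∈ levelE hm hr 1 := by
  have : d.xF a x ∈ Set.range (fun x : Fin m → levelU n 1 => ∑ a, d.xF a (x a)) := by
    refine ⟨Pi.single a x, ?_⟩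
    dsimp only
    rw [Finset.sum_eq_single a]
    · rw [Pi.single_eq_same]
    · intro b _ hb
      rw [Pi.single_eq_of_ne hb, map_zero]
    · simp
  rw [d.xF_range] at this
  exact this

theorem formE_skew (z x y : E r) : d.formE ⁅z, x⁆ y = -d.formE x ⁅z, y⁆ :=
  d.formE_standard.skew_even (parityPart_false_eq_top _ z) x y

/-- Both sides are annihilated by all f_i with i ≠ m, so their pairings with level 1 are determined
by the value on f_m. The scalar is not 1 in general, because `xE` and `xF` may be rescaled
inversely. -/
theorem xE_last_eZero : d.xE d.last (eZero n) =
    d.formE (d.xE d.last (eZero n)) (gF _ _ (nodeL hm hr)) • gE _ _ (nodeL hm hr) := by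
  rw [← sub_eq_zero]
  refine d.formE_standard.eq_zero (fun _ _ => rfl) (cartanE_symm r) (p := 1) le_rfl
    (sub_mem (d.xE_mem _ _) (Submodule.smul_mem _ _ (bg_mem_level_self true _))) fun y hy => ?_
  have h : levelE hm hr 1 ≤ LinearMap.ker (d.formE (d.xE d.last (eZero n) -
      d.formE (d.xE d.last (eZero n)) (gF _ _ (nodeL hm hr)) • gE _ _ (nodeL hm hr))) := by
    refine level_pos_one_le ?_ fun i hi y _ => ?_
    · rw [LinearMap.mem_ker, map_sub, map_smul, LinearMap.sub_apply, LinearMap.smul_apply,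
        d.formE_standard.ef, if_pos rfl, smul_eq_mul, mul_one, sub_self]
    · have h1 : ⁅(gF _ _ i : E r), d.xE d.last (eZero n)⁆ = 0 := by
        rcases node_cases (hm := hm) (hr := hr) i hi with ⟨k, rfl⟩ | ⟨k, j, hkj, rfl⟩
        · rw [← d.enE_f, bracket_xE, act_gF_eZero, map_zero]
        · rw [d.xE_sl_f k j hkj, if_neg (d.last_ne hkj)]
      have h2 : ⁅(gF _ _ i : E r), (gE _ _ (nodeL hm hr) : E r)⁆ = 0 := by
        rw [← lie_skew, gE_gF, if_neg hi.symm, neg_zero]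
      rw [LinearMap.mem_ker, ← neg_eq_zero, ← formE_skew, lie_sub, lie_smul, h1, h2, smul_zero,
        sub_zero, map_zero, LinearMap.zero_apply]
  exact h (hy 0)

theorem xF_last_fZero : d.xF d.last (fZero n) =
    d.formE (gE _ _ (nodeL hm hr)) (d.xF d.last (fZero n)) • gF _ _ (nodeL hm hr) := by
  rw [← sub_eq_zero]
  refine d.formE_standard.eq_zero_right (fun _ _ => rfl) (cartanE_symm r)
    (sub_mem (d.xF_mem _ _) (Submodule.smul_mem _ _ (bg_mem_level_self false _))) fun x hx => ?_
  have h : levelE hm hr (-1) ≤ LinearMap.ker (d.formE.flip (d.xF d.last (fZero n) -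
      d.formE (gE _ _ (nodeL hm hr)) (d.xF d.last (fZero n)) • gF _ _ (nodeL hm hr))) := by
    refine level_neg_one_le ?_ fun i hi x _ => ?_
    · rw [LinearMap.mem_ker, LinearMap.flip_apply, map_sub, map_smul,
        d.formE_standard.ef, if_pos rfl, smul_eq_mul, mul_one, sub_self]
    · have h1 : ⁅(gE _ _ i : E r), d.xF d.last (fZero n)⁆ = 0 := by
        rcases node_cases (hm := hm) (hr := hr) i hi with ⟨k, rfl⟩ | ⟨k, j, hkj, rfl⟩
        · rw [← d.enE_e, bracket_xF, act_gE_fZero, map_zero]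
        · rw [d.xF_sl_e k j hkj, if_neg (d.last_ne hkj)]
      have h2 : ⁅(gE _ _ i : E r), (gF _ _ (nodeL hm hr) : E r)⁆ = 0 := by
        rw [gE_gF, if_neg hi]
      rw [LinearMap.mem_ker, LinearMap.flip_apply, formE_skew, lie_sub, lie_smul, h1, h2,
        smul_zero, sub_zero, map_zero, neg_zero]
  exact h hx

/-- The unknown scalars for `xE` and `xF` are inverse to each other by the normalization `dual`, so
the bracket is exactly ⁅e_m, f_m⁆. -/
theorem xE_xF_last : ⁅d.xE d.last (eZero n), d.xF d.last (fZero n)⁆ = gH _ _ (nodeL hm hr) := by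
  have h := d.dual d.last d.last (eZero n) (fZero n)
  rw [if_pos rfl] at h
  have h' : d.formU (eZero n) (fZero n) = 1 :=
    (d.formU_standard.ef none none).trans (if_pos rfl)
  rw [h', d.xE_last_eZero, d.xF_last_fZero, map_smul, map_smul, LinearMap.smul_apply,
    d.formE_standard.ef, if_pos rfl, smul_eq_mul, smul_eq_mul, mul_one] at h
  rw [d.xE_last_eZero, d.xF_last_fZero, lie_smul, smul_lie, gE_gF, if_pos rfl, smul_smul, h,
    one_smul]

theorem sl_induction {P : Fin m → Prop} (h0 : P d.last)
    (h : ∀ i j : Fin m, i.val + 1 = j.val → P j → P i) (i : Fin m) : P i := by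
  obtain ⟨k, hk⟩ : ∃ k, i.val + k = m - 1 := ⟨m - 1 - i, by omega⟩
  induction k generalizing i with
  | zero =>
    have : i = d.last := Fin.ext hk
    rwa [this]
  | succ k ih => exact h i ⟨i + 1, by omega⟩ rfl (ih _ (by simp only; omega))

/-- On the lowest weight vector the eigenvalues are 2 for h_m and 0 for h_0, and 2 = 0 + 1 + 1. The
Cartan entries towards E_n agree for both nodes. Lowering the index from the last one brings in the
entry −1 between the nodes m − 1 and m, which removes the extra term. -/
theorem gH_xE (hn : 4 ≤ n) (c : Fin m) (z : levelU n (-1)) :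
    ⁅(gH _ _ (nodeL hm hr) : E r), d.xE c z⁆ =
      d.xE c (adLevel (gH_mem_level none none) (-1) z + z) +
        if c = d.last then d.xE d.last z else 0 := by
  have hlast : ∀ z, ⁅(gH _ _ (nodeL hm hr) : E r), d.xE d.last z⁆ =
      d.xE d.last (adLevel (gH_mem_level none none) (-1) z + z) + d.xE d.last z := by
    refine d.neg_induction ?_ (fun x y hx hy => ?_) (fun c x hx => ?_) fun k x hx => ?_
    · have h1 : adLevel (gH_mem_level none none) (-1) (eZero n) = 0 := by
        refine Subtype.ext ((gH_gE none none).trans ?_)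
        simp [cartanU]
      have h2 : cartanE r (nodeL hm hr) (nodeL hm hr) = 2 := if_pos rfl
      rw [h1, zero_add, d.xE_last_eZero, lie_smul, gH_gE, h2]
      push_cast
      module
    · simp only [map_add, lie_add] at hx hy ⊢
      rw [hx, hy]; abel
    · simp only [map_add, map_smul, lie_smul] at hx ⊢
      rw [hx, smul_add, smul_add]
    · have h1 : adLevel (gH_mem_level none none) (-1) (d.act _ (gE _ _ k) x) =
          (cartanU n none (some k) : ℝ) • d.act _ (gE _ _ k) x +
            d.act _ (gE _ _ k) (adLevel (gH_mem_level none none) (-1) x) := by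
        refine Subtype.ext ?_
        simp only [adLevel_coe, Submodule.coe_add, Submodule.coe_smul, act_coe]
        rw [even_leibniz (gH_mem_parity _), d.enU_e, gH_gE, smul_bracket]
      have h2 : cartanE r (nodeL hm hr) (nodeE hr k) = cartanU n none (some k) := by
        rw [nodeL, cartanE_nodeSl_nodeE hr hn]
        simp only [cartanU]
        refine if_congr ?_ rfl rfl
        omega
      rw [← bracket_xE, leibniz_lie, hx, d.enE_e, gH_gE, h2, h1, lie_add, ← d.enE_e, bracket_xE,
        bracket_xE, smul_lie, bracket_xE]
      simp only [map_add, map_smul]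
      abel
  induction c using d.sl_induction with
  | h0 => rw [hlast, if_pos rfl]
  | h i j hij ih =>
    rw [if_neg (d.last_ne hij).symm, add_zero]
    have h1 : ∀ w, d.xE i w = ⁅(gE _ _ (nodeSl hr i) : E r), d.xE j w⁆ := fun w => by
      rw [d.xE_sl_e i j hij, if_pos rfl]
    rw [h1 z, leibniz_lie, ih, gH_gE, lie_add, ← h1, smul_lie, ← h1, nodeL,
      cartanE_nodeSl hr hn, if_neg]
    · by_cases hj : j = d.last
      · rw [if_pos hj, ← hj, ← h1, if_pos]
        · simp
        · right
          rw [hj] at hij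
          exact hij
      · rw [if_neg hj, lie_zero, add_zero, if_neg]
        · simp
        · intro h
          apply hj
          refine Fin.ext ?_
          simp only [last] at h ⊢
          omega
    · exact fun h => d.last_ne hij h

/-! ### The triple bracket formula and its propagation by equivariance -/

/-- The operator `z ↦ ⁅⁅x, y⁆, z⁆ + ⟨x|y⟩ z`. -/
def twist (x : levelU n (-1)) (y : levelU n 1) (z : levelU n (-1)) : levelU n (-1) :=
  adLevel (bracket_mem_zero x y) (-1) z + d.formU x y • z

/-- The value of the triple bracket. -/
def tripleValue (a : Fin m) (x : levelU n (-1)) (b : Fin m) (y : levelU n 1) (c : Fin m)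
    (z : levelU n (-1)) : E r :=
  (if a = b then d.xE c (d.twist x y z) else 0) +
    if c = b then d.formU x y • d.xE a z else 0

theorem twist_add_left (x x' : levelU n (-1)) (y : levelU n 1) (z : levelU n (-1)) :
    d.twist (x + x') y z = d.twist x y z + d.twist x' y z := by
  refine Subtype.ext ?_
  simp only [twist, Submodule.coe_add, Submodule.coe_smul, adLevel_coe, add_bracket, map_add,
    LinearMap.add_apply, add_smul]
  abel

theorem twist_smul_left (c : ℝ) (x : levelU n (-1)) (y : levelU n 1) (z : levelU n (-1)) :
    d.twist (c • x) y z = c • d.twist x y z := by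
  refine Subtype.ext ?_
  simp only [twist, Submodule.coe_add, Submodule.coe_smul, adLevel_coe, smul_bracket, map_smul,
    LinearMap.smul_apply, smul_add, smul_smul, smul_eq_mul]

theorem twist_add_right (x : levelU n (-1)) (y y' : levelU n 1) (z : levelU n (-1)) :
    d.twist x (y + y') z = d.twist x y z + d.twist x y' z := by
  refine Subtype.ext ?_
  simp only [twist, Submodule.coe_add, Submodule.coe_smul, adLevel_coe, bracket_add, add_bracket,
    map_add, add_smul]
  abel

theorem twist_smul_right (c : ℝ) (x : levelU n (-1)) (y : levelU n 1) (z : levelU n (-1)) :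
    d.twist x (c • y) z = c • d.twist x y z := by
  refine Subtype.ext ?_
  simp only [twist, Submodule.coe_add, Submodule.coe_smul, adLevel_coe, bracket_smul, smul_bracket,
    map_smul, smul_add, smul_smul, smul_eq_mul]

theorem formU_act (w : E n) (x : levelU n (-1)) (y : levelU n 1) :
    d.formU (d.act _ w x) y = -d.formU x (d.act _ w y) :=
  d.formU_standard.skew_even (levelU_zero_even (d.enU_mem w)) x y

theorem act_twist (w : E n) (x : levelU n (-1)) (y : levelU n 1) (z : levelU n (-1)) :
    d.act _ w (d.twist x y z) = d.twist (d.act _ w x) y z + d.twist x (d.act _ w y) z +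
      d.twist x y (d.act _ w z) := by
  have hw := levelU_zero_even (d.enU_mem w)
  refine Subtype.ext ?_
  have hb : d.formU ⁅d.enU w, (x : U n)⁆ y = -d.formU x ⁅d.enU w, (y : U n)⁆ := d.formU_act w x y
  simp only [twist, Submodule.coe_add, Submodule.coe_smul, adLevel_coe, act_coe, hb]
  rw [bracket_add, bracket_smul, even_leibniz hw, even_leibniz hw, add_bracket]
  module

theorem lie_tripleValue (w : E n) (a : Fin m) (x : levelU n (-1)) (b : Fin m) (y : levelU n 1)
    (c : Fin m) (z : levelU n (-1)) :
    ⁅d.enE w, d.tripleValue a x b y c z⁆ = d.tripleValue a (d.act _ w x) b y c z +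
      d.tripleValue a x b (d.act _ w y) c z + d.tripleValue a x b y c (d.act _ w z) := by
  simp only [tripleValue, formU_act]
  rw [lie_add]
  split_ifs <;> simp only [lie_zero, lie_smul, bracket_xE, act_twist, map_add] <;> module

/-- The triple bracket takes the expected value. -/
def Good (a : Fin m) (x : levelU n (-1)) (b : Fin m) (y : levelU n 1) : Prop :=
  ∀ c z, ⁅⁅d.xE a x, d.xF b y⁆, d.xE c z⁆ = d.tripleValue a x b y c z

theorem lie_triple (u X Y Z : E r) :
    ⁅u, ⁅⁅X, Y⁆, Z⁆⁆ = ⁅⁅⁅u, X⁆, Y⁆, Z⁆ + ⁅⁅X, ⁅u, Y⁆⁆, Z⁆ + ⁅⁅X, Y⁆, ⁅u, Z⁆⁆ := by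
  rw [leibniz_lie u, leibniz_lie u X Y, add_lie]

/-- Both sides of the triple bracket formula obey the Leibniz rule under E_n. The formula for (x, y)
and (x, w·y), with any third entry, therefore yields it for (w·x, y). -/
theorem Good.act_left {d : LevelDecomposition hm hr} {w : E n} {a b : Fin m} {x : levelU n (-1)}
    {y : levelU n 1} (h1 : d.Good a x b y) (h2 : d.Good a x b (d.act _ w y)) :
    d.Good a (d.act _ w x) b y := by
  intro c z
  have h3 := lie_triple (d.enE w) (d.xE a x) (d.xF b y) (d.xE c z)
  rw [h1, lie_tripleValue, bracket_xE, bracket_xF, bracket_xE, h2, h1] at h3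
  exact (add_right_cancel (add_right_cancel h3)).symm

theorem Good.act_right {d : LevelDecomposition hm hr} {w : E n} {a b : Fin m} {x : levelU n (-1)}
    {y : levelU n 1} (h1 : d.Good a x b y) (h2 : d.Good a (d.act _ w x) b y) :
    d.Good a x b (d.act _ w y) := by
  intro c z
  have h3 := lie_triple (d.enE w) (d.xE a x) (d.xF b y) (d.xE c z)
  rw [h1, lie_tripleValue, bracket_xE, bracket_xF, bracket_xE, h2, h1] at h3
  exact (add_left_cancel (add_right_cancel h3)).symm

theorem Good.zero_right (a b : Fin m) (x : levelU n (-1)) : d.Good a x b 0 := by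
  intro c z
  have h := d.twist_smul_right 0 x 0 z
  rw [zero_smul, zero_smul] at h
  simp [tripleValue, h]

theorem Good.add_left {d : LevelDecomposition hm hr} {a b : Fin m} {x x' : levelU n (-1)}
    {y : levelU n 1} (h : d.Good a x b y) (h' : d.Good a x' b y) : d.Good a (x + x') b y := by
  intro c z
  rw [map_add, add_lie, add_lie, h, h']
  simp only [tripleValue, twist_add_left, Submodule.coe_add, map_add, LinearMap.add_apply, add_smul]
  split_ifs <;> abel

theorem Good.smul_left {d : LevelDecomposition hm hr} {a b : Fin m} {x : levelU n (-1)}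
    {y : levelU n 1} (t : ℝ) (h : d.Good a x b y) : d.Good a (t • x) b y := by
  intro c z
  rw [map_smul, smul_lie, smul_lie, h]
  simp only [tripleValue, twist_smul_left, Submodule.coe_smul, map_smul, LinearMap.smul_apply,
    smul_eq_mul, mul_smul]
  split_ifs <;> simp

theorem Good.add_right {d : LevelDecomposition hm hr} {a b : Fin m} {x : levelU n (-1)}
    {y y' : levelU n 1} (h : d.Good a x b y) (h' : d.Good a x b y') : d.Good a x b (y + y') := by
  intro c z
  rw [map_add, lie_add, add_lie, h, h']
  simp only [tripleValue, twist_add_right, Submodule.coe_add, map_add, add_smul]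
  split_ifs <;> abel

theorem Good.smul_right {d : LevelDecomposition hm hr} {a b : Fin m} {x : levelU n (-1)}
    {y : levelU n 1} (t : ℝ) (h : d.Good a x b y) : d.Good a x b (t • y) := by
  intro c z
  rw [map_smul, lie_smul, smul_lie, h]
  simp only [tripleValue, twist_smul_right, Submodule.coe_smul, map_smul, smul_eq_mul, mul_smul]
  split_ifs <;> simp

/-- The generator of sl_m takes the upper index j to i. Since b ≠ i, it annihilates the entry with
lower index b, so no second instance of the formula is involved. -/
theorem good_sl_e {i j b : Fin m} (hij : i.val + 1 = j.val) (hb : b ≠ i) {x : levelU n (-1)}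
    {y : levelU n 1} (h : d.Good j x b y) : d.Good i x b y := by
  intro c z
  have h3 := lie_triple (gE _ _ (nodeSl hr i)) (d.xE j x) (d.xF b y) (d.xE c z)
  rw [h, d.xE_sl_e i j hij j, if_pos rfl, d.xF_sl_e i j hij, if_neg hb, lie_zero, zero_lie,
    add_zero, d.xE_sl_e i j hij c] at h3
  rw [eq_sub_iff_add_eq.2 h3.symm]
  have h4 : ⁅⁅d.xE j x, d.xF b y⁆, if c = j then d.xE i z else 0⁆ =
      if c = j then d.tripleValue j x b y i z else 0 := by
    split_ifs
    · exact h _ _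
    · exact lie_zero _
  rw [h4]
  simp only [tripleValue, lie_add, apply_ite (fun w => ⁅(gE _ _ (nodeSl hr i) : E r), w⁆),
    lie_zero, lie_smul, d.xE_sl_e i j hij]
  by_cases h5 : c = j <;> by_cases h6 : j = b <;> by_cases h7 : c = b <;>
    simp_all [Ne.symm hb]

/-- The lowering generator takes the lower index j to i up to a sign but also moves the upper
indices, so the formula for j is needed with all upper indices and all x. -/
theorem good_sl_f {a i j : Fin m} (hij : i.val + 1 = j.val) 
    {y : levelU n 1} (h : ∀ a x, d.Good a x j y) (x : levelU n (-1)) : d.Good a x i y := by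
  intro c z
  have h3 := lie_triple (gF _ _ (nodeSl hr i)) (d.xE a x) (d.xF j y) (d.xE c z)
  rw [h, d.xE_sl_f i j hij a, d.xF_sl_f i j hij, if_pos rfl, d.xE_sl_f i j hij c, lie_neg, neg_lie]
    at h3
  have h4 : ⁅⁅d.xE a x, d.xF j y⁆, if c = i then d.xE j z else 0⁆ =
      if c = i then d.tripleValue a x j y j z else 0 := by
    split_ifs
    · exact h _ _ _ _
    · exact lie_zero _
  have h5 : ⁅⁅if a = i then d.xE j x else 0, d.xF j y⁆, d.xE c z⁆ =
      if a = i then d.tripleValue j x j y c z else 0 := by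
    split_ifs
    · exact h _ _ _ _
    · rw [zero_lie, zero_lie]
  rw [h4, h5] at h3
  have h6 : ⁅⁅d.xE a x, d.xF i y⁆, d.xE c z⁆ = (if a = i then d.tripleValue j x j y c z else 0) +
      (if c = i then d.tripleValue a x j y j z else 0) -
        ⁅(gF _ _ (nodeSl hr i) : E r), d.tripleValue a x j y c z⁆ := by
    rw [h3]; abel
  rw [h6]
  have hne : i ≠ j := fun h => by rw [h] at hij; omega
  simp only [tripleValue, lie_add, apply_ite (fun w => ⁅(gF _ _ (nodeSl hr i) : E r), w⁆),
    lie_zero, lie_smul, d.xE_sl_f i j hij]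
  by_cases h5 : c = i <;> by_cases h6 : a = i <;> by_cases h7 : c = j <;> by_cases h8 : a = j <;>
    simp_all

/-- The triple bracket of level `-1`, `1`, `-1`. -/
theorem good (hn : 4 ≤ n) (a : Fin m) (x : levelU n (-1)) (b : Fin m) (y : levelU n 1) :
    d.Good a x b y := by
  have h0 : d.Good d.last (eZero n) d.last (fZero n) := by
    intro c z
    have h1 : d.formU (eZero n) (fZero n) = 1 :=
      (d.formU_standard.ef none none).trans (if_pos rfl)
    have h2 : ⁅(eZero n : U n), (fZero n : U n)⁆ = gH (cartanU n) Option.isNone none :=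
      (gE_gF (A := cartanU n) (odd := Option.isNone) none none).trans (if_pos rfl)
    rw [d.xE_xF_last, d.gH_xE hn, tripleValue, if_pos rfl, twist, h1, one_smul, one_smul]
    congr 3
    exact Subtype.ext (congrArg (fun w => ⁅w, (z : U n)⁆) h2.symm)
  -- The order matters: f_0 with the last index is killed by all raising generators, so x and a can
  -- be varied while it is held fixed. After that y is varied with x and a free, and finally b.
  have h1 : ∀ a x, d.Good a x d.last (fZero n) := by
    intro a x
    induction a using d.sl_induction with
    | h0 =>
      refine d.neg_induction (P := fun x => d.Good d.last x d.last (fZero n)) h0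
        (fun _ _ h h' => Good.add_left h h') (fun t _ h => Good.smul_left t h)
        (fun k x hx => Good.act_left hx ?_) x
      rw [act_gE_fZero]
      exact Good.zero_right _ _ _ _
    | h i j hij ih => exact d.good_sl_e hij (d.last_ne hij) ih
  have h2 : ∀ y a x, d.Good a x d.last y := by
    exact d.pos_induction (P := fun y => ∀ a x, d.Good a x d.last y) h1
      (fun _ _ h h' a x => Good.add_right (h a x) (h' a x))
      (fun t _ h a x => Good.smul_right t (h a x)) fun k y hy a x =>
        Good.act_right (hy a x) (hy a _)
  induction b using d.sl_induction generalizing a x with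
  | h0 => exact h2 y a x
  | h i j hij ih => exact d.good_sl_f hij ih x

end LevelDecomposition

end TripleBracket

end TensorHierarchy
end

noncomputable section
set_option linter.unusedSectionVars false
namespace TensorHierarchy
open scoped TensorProduct

/-! ### Nested brackets as multilinear maps -/

section NestMultilinear

variable {ι : Type} [DecidableEq ι] [Fintype ι] {A : Matrix ι ι ℤ} {odd : ι → Bool}

theorem nest_succ_succ (p : ℕ) (x : Fin (p + 2) → Borcherds A odd) :
    nest (p + 2) x = ⁅x 0, nest (p + 1) fun i => x i.succ⁆ := rfl

theorem nest_update_zero (p : ℕ) (x : Fin (p + 2) → Borcherds A odd) (u : Borcherds A odd) :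
    nest (p + 2) (Function.update x 0 u) = ⁅u, nest (p + 1) fun i => x i.succ⁆ := rfl

theorem nest_update_succ (p : ℕ) (x : Fin (p + 2) → Borcherds A odd) (k : Fin (p + 1))
    (u : Borcherds A odd) : nest (p + 2) (Function.update x k.succ u) =
      ⁅x 0, nest (p + 1) (Function.update (fun i => x i.succ) k u)⁆ := by
  rw [nest_succ_succ, Function.update_of_ne (Fin.succ_ne_zero k).symm]
  congr 2
  funext i
  by_cases h : i = k
  · subst h; simp
  · rw [Function.update_of_ne h, Function.update_of_ne (fun h' => h (Fin.succ_inj.1 h'))]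

theorem nest_update_add (p : ℕ) (x : Fin p → Borcherds A odd) (k : Fin p) (u v : Borcherds A odd) :
    nest p (Function.update x k (u + v)) =
      nest p (Function.update x k u) + nest p (Function.update x k v) := by
  induction p with
  | zero => exact k.elim0
  | succ p ih =>
    cases p with
    | zero =>
      obtain rfl : k = 0 := Fin.fin_one_eq_zero k
      simp [nest]
    | succ p =>
      refine Fin.cases ?_ (fun k => ?_) k
      · rw [nest_update_zero, nest_update_zero, nest_update_zero, add_bracket]
      · rw [nest_update_succ, nest_update_succ, nest_update_succ, ih, bracket_add]

theorem nest_update_smul (p : ℕ) (x : Fin p → Borcherds A odd) (k : Fin p) (t : ℝ)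
    (u : Borcherds A odd) :
    nest p (Function.update x k (t • u)) = t • nest p (Function.update x k u) := by
  induction p with
  | zero => exact k.elim0
  | succ p ih =>
    cases p with
    | zero =>
      obtain rfl : k = 0 := Fin.fin_one_eq_zero k
      simp [nest]
    | succ p =>
      refine Fin.cases ?_ (fun k => ?_) k
      · rw [nest_update_zero, nest_update_zero, smul_bracket]
      · rw [nest_update_succ, nest_update_succ, ih, bracket_smul]

variable (A odd) in
/-- The nested bracket as a multilinear map. -/
def nestMultilinear (p : ℕ) :
    MultilinearMap ℝ (fun _ : Fin p => Borcherds A odd) (Borcherds A odd) where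
  toFun := nest p
  map_update_add' := by
    intro inst x k u v
    rw [Subsingleton.elim inst (instDecidableEqFin p)]
    exact nest_update_add p x k u v
  map_update_smul' := by
    intro inst x k t u
    rw [Subsingleton.elim inst (instDecidableEqFin p)]
    exact nest_update_smul p x k t u

end NestMultilinear

/-! ### Antisymmetrized brackets -/

section Antisymmetrized

/-- `ω` is antisymmetric in its indices. -/
def IsAntisymm {p m : ℕ} (ω : (Fin p → Fin m) → ℝ) : Prop :=
  ∀ i j, i ≠ j → ∀ c, ω (c ∘ Equiv.swap i j) = -ω c

theorem IsAntisymm.cons {p m : ℕ} {ω : (Fin (p + 1) → Fin m) → ℝ} (h : IsAntisymm ω) (a : Fin m) :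
    IsAntisymm fun c : Fin p → Fin m => ω (Fin.cons a c) := by
  intro i j hij c
  rw [← h i.succ j.succ fun h' => hij (Fin.succ_inj.1 h')]
  refine congrArg ω ?_
  funext k
  refine Fin.cases ?_ (fun k => ?_) k
  · rw [Function.comp_apply, Equiv.swap_apply_of_ne_of_ne (Fin.succ_ne_zero i).symm
      (Fin.succ_ne_zero j).symm]
    rfl
  · rw [Function.comp_apply, Fin.cons_succ, Function.comp_apply]
    have : Equiv.swap i.succ j.succ k.succ = (Equiv.swap i j k).succ := by
      rw [Equiv.swap_apply_def, Equiv.swap_apply_def]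
      simp only [Fin.succ_inj]
      split_ifs <;> rfl
    rw [this, Fin.cons_succ]

theorem sum_cons {p m : ℕ} {M : Type} [AddCommMonoid M] (f : (Fin (p + 1) → Fin m) → M) :
    ∑ c, f c = ∑ a, ∑ c : Fin p → Fin m, f (Fin.cons a c) := by
  rw [← (Fin.consEquiv fun _ => Fin m).sum_comp f, Fintype.sum_prod_type]
  rfl

/-- Exchanging the first index with another one. -/
theorem IsAntisymm.sum_exchange {p m : ℕ} {M : Type} [AddCommGroup M] [Module ℝ M]
    {ω : (Fin (p + 1) → Fin m) → ℝ} (h : IsAntisymm ω) (G : (Fin p → Fin m) → M) (k : Fin p)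
    (b : Fin m) :
    ∑ a, ∑ c : Fin p → Fin m,
        (if c k = b then ω (Fin.cons a c) • G (Function.update c k a) else 0) =
      -∑ c, ω (Fin.cons b c) • G c := by
  -- The summand as a function of the whole tuple (a, c). Reindexing by the transposition of the
  -- positions 0 and k + 1 turns the condition c_k = b into a = b and yields the sign.
  let f : (Fin (p + 1) → Fin m) → M := fun d => if d k.succ = b then
    ω d • G (fun i => (d ∘ Equiv.swap 0 k.succ) i.succ) else 0
  have h1 : ∀ (a : Fin m) (c : Fin p → Fin m),
      (if c k = b then ω (Fin.cons a c) • G (Function.update c k a) else 0) = f (Fin.cons a c) := by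
    intro a c
    simp only [f, Fin.cons_succ]
    refine if_congr Iff.rfl ?_ rfl
    congr 2
    funext i
    by_cases hi : i = k
    · subst hi; simp
    · rw [Function.update_of_ne hi, Function.comp_apply,
        Equiv.swap_apply_of_ne_of_ne (Fin.succ_ne_zero i) fun h' => hi (Fin.succ_inj.1 h'),
        Fin.cons_succ]
  simp only [h1]
  rw [← sum_cons, ← ((Equiv.swap 0 k.succ).arrowCongr (Equiv.refl (Fin m))).sum_comp, sum_cons]
  have h2 : ∀ (d : Fin (p + 1) → Fin m), ((Equiv.swap 0 k.succ).arrowCongr (Equiv.refl (Fin m))) d =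
      d ∘ Equiv.swap 0 k.succ := fun d => by
    funext i
    simp [Equiv.arrowCongr]
  simp only [f, h2, h 0 k.succ (Fin.succ_ne_zero k).symm]
  rw [Finset.sum_eq_single b]
  · rw [← Finset.sum_neg_distrib]
    refine Finset.sum_congr rfl fun c _ => ?_
    rw [Function.comp_apply, Equiv.swap_apply_right, if_pos (Fin.cons_zero _ _), neg_smul]
    congr 3
    funext i
    rw [Function.comp_apply, Function.comp_apply, Equiv.swap_apply_self, Fin.cons_succ]
  · intro a _ ha
    refine Finset.sum_eq_zero fun c _ => ?_
    rw [Function.comp_apply, Equiv.swap_apply_right, Fin.cons_zero, if_neg ha]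
  · simp

variable {n m r : ℕ} {hm : 1 ≤ m} {hr : m + n = r} (d : LevelDecomposition hm hr)

namespace LevelDecomposition

/-- The element `E_{M_1 ⋯ M_p}^{c_1 ⋯ c_p}` for `x_i = E_{M_i}`. -/
def nestE {p : ℕ} (x : Fin p → levelU n (-1)) (c : Fin p → Fin m) : E r :=
  nest p fun i => d.xE (c i) (x i)

/-- The pairs formed by an element of `U_{n+1}` of level `-p` and the corresponding family of
elements of `E_r`. -/
def pairSpan (p : ℕ) : Submodule ℝ (U n × ((Fin p → Fin m) → E r)) :=
  Submodule.span ℝ {w | ∃ x : Fin p → levelU n (-1), w = (nest p fun i => (x i : U n), d.nestE x)}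

/-- The correspondence between U_{n+1} and E_r is carried as a relation, because a relation between
nested brackets of U_{n+1} is not yet known to hold in E_r. Brackets that must be expanded again
into nested ones can thus be followed in both algebras at once. -/
theorem mem_pairSpan {p : ℕ} (x : Fin p → levelU n (-1)) :
    ((nest p fun i => (x i : U n)), d.nestE x) ∈ d.pairSpan p := Submodule.subset_span ⟨x, rfl⟩

theorem coe_update {p : ℕ} (x : Fin p → levelU n (-1)) (k : Fin p) (u : levelU n (-1)) :
    (fun i => (Function.update x k u i : U n)) =
      Function.update (fun i => (x i : U n)) k (u : U n) := by
  funext i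
  by_cases h : i = k
  · subst h; simp
  · rw [Function.update_of_ne h, Function.update_of_ne h]

theorem nestE_update {p : ℕ} (x : Fin p → levelU n (-1)) (c : Fin p → Fin m) (k : Fin p)
    (u : levelU n (-1)) : d.nestE (Function.update x k u) c =
      nest p (Function.update (fun i => d.xE (c i) (x i)) k (d.xE (c k) u)) := by
  rw [nestE]
  congr 1
  funext i
  by_cases h : i = k
  · subst h; simp
  · rw [Function.update_of_ne h, Function.update_of_ne h]

theorem nestE_update_index {p : ℕ} (x : Fin p → levelU n (-1)) (c : Fin p → Fin m) (k : Fin p)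
    (a : Fin m) : d.nestE x (Function.update c k a) =
      nest p (Function.update (fun i => d.xE (c i) (x i)) k (d.xE a (x k))) := by
  rw [nestE]
  congr 1
  funext i
  by_cases h : i = k
  · subst h; simp
  · rw [Function.update_of_ne h, Function.update_of_ne h]

/-- The bracket ⁅E^a, F_b⁆ acts by the Leibniz rule, with the triple bracket formula in each
position k. The term with ⟨x|y⟩ and δ^a_b occurs once per position, as does the exchange term, so
they can cancel pairwise. -/
theorem triple_nestE (hn : 4 ≤ n) {p : ℕ} (x : levelU n (-1)) (y : levelU n 1) (a b : Fin m)
    (x' : Fin p → levelU n (-1)) (c : Fin p → Fin m) :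
    ⁅⁅d.xE a x, d.xF b y⁆, d.nestE x' c⁆ = ∑ k,
      ((if a = b then d.nestE (Function.update x' k
          (adLevel (bracket_mem_zero x y) (-1) (x' k))) c + d.formU x y • d.nestE x' c else 0) +
        if c k = b then d.formU x y • d.nestE x' (Function.update c k a) else 0) := by
  rw [nestE, nest_leibniz (parityPart_false_eq_top _ _)]
  refine Finset.sum_congr rfl fun k _ => ?_
  rw [d.good hn a x b y (c k) (x' k), tripleValue, nest_update_add, nestE_update,
    nestE_update_index]
  congr 1
  · split_ifs
    · rw [twist, map_add, map_smul, nest_update_add, nest_update_smul]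
      congr 2
      exact congrArg (nest p) (Function.update_eq_self k fun i => d.xE (c i) (x' i))
    · have := nest_update_smul p (fun i => d.xE (c i) (x' i)) k 0 0
      rwa [zero_smul, zero_smul] at this
  · split_ifs
    · rw [nest_update_smul]
    · have := nest_update_smul p (fun i => d.xE (c i) (x' i)) k 0 0
      rwa [zero_smul, zero_smul] at this

variable {d} in
-- After contraction with an antisymmetric tensor, the exchange of a and c_k in position k
-- contributes −⟨x|y⟩ times the unchanged bracket (`IsAntisymm.sum_exchange`). This cancels the
-- ⟨x|y⟩ term of the same position and leaves the adjoint action in U_{n+1}.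
theorem exists_pair_triple (hn : 4 ≤ n) {p : ℕ} {w : U n × ((Fin p → Fin m) → E r)}
    (h : w ∈ d.pairSpan p) (x : levelU n (-1)) (y : levelU n 1) :
    ∃ F', (⁅⁅(x : U n), (y : U n)⁆, w.1⁆, F') ∈ d.pairSpan p ∧
      ∀ ω : (Fin (p + 1) → Fin m) → ℝ, IsAntisymm ω → ∀ b,
        ∑ a, ∑ c : Fin p → Fin m, ω (Fin.cons a c) • ⁅⁅d.xE a x, d.xF b y⁆, w.2 c⁆ =
          ∑ c, ω (Fin.cons b c) • F' c := by
  induction h using Submodule.span_induction with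
  | zero => exact ⟨0, by rw [Prod.fst_zero, bracket_zero]; exact zero_mem _, fun ω _ b => by simp⟩
  | add u v _ _ h h' =>
    obtain ⟨F', h1, h2⟩ := h
    obtain ⟨G', h1', h2'⟩ := h'
    refine ⟨F' + G', by rw [Prod.fst_add, bracket_add]; exact add_mem h1 h1', fun ω hω b => ?_⟩
    simp only [Prod.snd_add, Pi.add_apply, lie_add, smul_add, Finset.sum_add_distrib]
    rw [h2 ω hω, h2' ω hω]
  | smul t u _ h =>
    obtain ⟨F', h1, h2⟩ := h
    refine ⟨t • F', by rw [Prod.smul_fst, bracket_smul]; exact Submodule.smul_mem _ t h1,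
      fun ω hω b => ?_⟩
    simp only [Prod.smul_snd, Pi.smul_apply, lie_smul, smul_comm _ t, ← Finset.smul_sum]
    rw [h2 ω hω]
  | mem w hw =>
    obtain ⟨x', rfl⟩ := hw
    refine ⟨∑ k, d.nestE (Function.update x' k (adLevel (bracket_mem_zero x y) (-1) (x' k))), ?_,
      fun ω hω b => ?_⟩
    · rw [nest_leibniz (levelU_zero_even (bracket_mem_zero x y))]
      have : ∀ k, (nest p (Function.update (fun i => (x' i : U n)) k
          ⁅⁅(x : U n), (y : U n)⁆, (x' k : U n)⁆),
          d.nestE (Function.update x' k (adLevel (bracket_mem_zero x y) (-1) (x' k)))) ∈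
          d.pairSpan p := by
        intro k
        have := d.mem_pairSpan (Function.update x' k (adLevel (bracket_mem_zero x y) (-1) (x' k)))
        rwa [coe_update] at this
      have h2 := sum_mem (t := Finset.univ) fun k _ => this k
      convert h2 using 1
      exact Prod.ext (by rw [Prod.fst_sum]) (by rw [Prod.snd_sum])
    · simp only [d.triple_nestE hn, Finset.smul_sum, smul_add, Finset.sum_apply]
      have h1 : ∀ k, ∑ a, ∑ c : Fin p → Fin m, ω (Fin.cons a c) •
          (if c k = b then d.formU x y • d.nestE x' (Function.update c k a) else 0) =
          -∑ c, ω (Fin.cons b c) • d.formU x y • d.nestE x' c := by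
        intro k
        rw [← hω.sum_exchange (fun c => (d.formU x y : ℝ) • d.nestE x' c) k b]
        refine Finset.sum_congr rfl fun a _ => Finset.sum_congr rfl fun c _ => ?_
        split_ifs
        · rfl
        · exact smul_zero _
      have h2 : ∀ k, ∑ a, ∑ c : Fin p → Fin m, ω (Fin.cons a c) •
          (if a = b then d.nestE (Function.update x' k
            (adLevel (bracket_mem_zero x y) (-1) (x' k))) c + d.formU x y • d.nestE x' c else 0) =
          ∑ c, ω (Fin.cons b c) • (d.nestE (Function.update x' k
            (adLevel (bracket_mem_zero x y) (-1) (x' k))) c + d.formU x y • d.nestE x' c) := by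
        intro k
        rw [Finset.sum_eq_single b]
        · simp
        · intro a _ ha
          simp [ha]
        · simp
      have h3 : ∀ f : Fin m → (Fin p → Fin m) → Fin p → E r,
          ∑ a, ∑ c, ∑ k, f a c k = ∑ k, ∑ a, ∑ c, f a c k := by
        intro f
        rw [Finset.sum_comm (s := Finset.univ (α := Fin p))]
        exact Finset.sum_congr rfl fun a _ => Finset.sum_comm
      rw [h3]
      refine (Finset.sum_congr rfl fun k _ => ?_).trans Finset.sum_comm
      simp only [Finset.sum_add_distrib]
      rw [h1, h2]
      simp only [smul_add, Finset.sum_add_distrib]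
      abel

variable {d} in
theorem pair_cons {p : ℕ} {w : U n × ((Fin (p + 1) → Fin m) → E r)}
    (h : w ∈ d.pairSpan (p + 1)) (x : levelU n (-1)) :
    (⁅(x : U n), w.1⁆, fun c : Fin (p + 2) → Fin m => ⁅d.xE (c 0) x, w.2 fun i => c i.succ⁆) ∈
      d.pairSpan (p + 2) := by
  induction h using Submodule.span_induction with
  | zero =>
    convert zero_mem (d.pairSpan (p + 2)) using 1
    refine Prod.ext (bracket_zero _) (funext fun c => lie_zero _)
  | add u v _ _ h h' =>
    convert add_mem h h' using 1
    exact Prod.ext (bracket_add _ _ _) (funext fun c => lie_add _ _ _)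
  | smul t u _ h =>
    convert Submodule.smul_mem _ t h using 1
    exact Prod.ext (bracket_smul _ _ _)
      (funext fun c => lie_smul t (d.xE (c 0) x) (u.2 fun i => c i.succ))
  | mem w hw =>
    obtain ⟨x', rfl⟩ := hw
    exact d.mem_pairSpan (Fin.cons x x' : Fin (p + 2) → levelU n (-1))

/-! ### Bracketing antisymmetrized nested brackets with level 1 -/

theorem koszul_level (p : ℕ) :
    koszul (Option.isNone (none : Option (Fin n)) && !decide (Even (-1 : ℤ)))
      (Option.isNone (none : Option (Fin n)) && !decide (Even (((p + 1 : ℕ) : ℤ) * -1))) =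
        (-1) ^ (p + 1) := by
  have h1 : Even (((p + 1 : ℕ) : ℤ) * -1) ↔ Even (p + 1) := by
    rw [mul_neg_one, even_neg, Int.even_coe_nat]
  have h2 : decide (Even (((p + 1 : ℕ) : ℤ) * -1)) = decide (Even (p + 1)) :=
    decide_eq_decide.2 h1
  have h3 : decide (Even (-1 : ℤ)) = false := rfl
  rw [h2, h3]
  rcases Nat.even_or_odd (p + 1) with h | h
  · simp [koszul, h]
  · simp [koszul, Nat.not_even_iff_odd.2 h, h.neg_one_pow]

theorem _root_.TensorHierarchy.IsAntisymm.cons_cons {p m : ℕ} {ω : (Fin (p + 2) → Fin m) → ℝ}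
    (h : IsAntisymm ω) (a b : Fin m) (c : Fin p → Fin m) :
    ω (Fin.cons a (Fin.cons b c : Fin (p + 1) → Fin m)) =
      -ω (Fin.cons b (Fin.cons a c : Fin (p + 1) → Fin m)) := by
  rw [← h 0 1 (by simp)]
  refine congrArg ω (funext fun i => ?_)
  refine Fin.cases ?_ (fun i => Fin.cases ?_ (fun i => ?_) i) i
  · rw [Function.comp_apply, Equiv.swap_apply_left]; rfl
  · rw [Fin.succ_zero_eq_one, Function.comp_apply, Equiv.swap_apply_right]; rfl
  · rw [Function.comp_apply, Equiv.swap_apply_of_ne_of_ne (Fin.succ_ne_zero _)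
      (by rw [← Fin.succ_zero_eq_one]; exact fun h => Fin.succ_ne_zero i (Fin.succ_inj.1 h))]
    rfl

theorem nestE_cons {p : ℕ} (x : Fin (p + 2) → levelU n (-1)) (a : Fin m)
    (c : Fin (p + 1) → Fin m) : d.nestE x (Fin.cons a c) =
      ⁅d.xE a (x 0), d.nestE (fun i => x i.succ) c⁆ := rfl

theorem nest_lower_eq {p : ℕ} (x : Fin (p + 2) → levelU n (-1)) (y : levelU n 1) :
    ⁅(nest (p + 2) fun i => (x i : U n)), (y : U n)⁆ =
      ⁅(x 0 : U n), ⁅nest (p + 1) fun i => (x i.succ : U n), (y : U n)⁆⁆ +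
        (-1 : ℝ) ^ (p + 1) • ⁅⁅(x 0 : U n), (y : U n)⁆, nest (p + 1) fun i => (x i.succ : U n)⁆ := by
  rw [nest_succ_succ, super_jacobi (level_le_parity isNone_odd _ (x 0).2)
    (level_le_parity isNone_odd _ (nest_mem_level _ _ _ (-1) (p + 1) _ fun i => (x i.succ).2)),
    koszul_level, even_skew (levelU_zero_even (bracket_mem_zero (x 0) y)), smul_neg, sub_neg_eq_add]

variable {d} in
-- The Jacobi identity produces an inner part F, where y enters the tail, and a triple bracket part
-- G. The sign (−1)^(p+1) stands in front of G in U_{n+1} and in front of F in E_r; taking it out as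
-- a common factor makes the two sides agree, since its square is 1.
theorem exists_pair_lower_of_first (hn : 4 ≤ n) {p : ℕ} (x : Fin (p + 2) → levelU n (-1))
    (y : levelU n 1) {F : (Fin (p + 1) → Fin m) → E r}
    (hF : (⁅(x 0 : U n), ⁅nest (p + 1) fun i => (x i.succ : U n), (y : U n)⁆⁆, F) ∈
      d.pairSpan (p + 1))
    (h : ∀ ω : (Fin (p + 2) → Fin m) → ℝ, IsAntisymm ω → ∀ b,
      ∑ a, ∑ c : Fin (p + 1) → Fin m, ω (Fin.cons a c) •
        ⁅d.xE a (x 0), ⁅d.nestE (fun i => x i.succ) c, d.xF b y⁆⁆ =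
          (-1 : ℝ) ^ (p + 1) • ∑ c, ω (Fin.cons b c) • F c) :
    ∃ F', (⁅(nest (p + 2) fun i => (x i : U n)), (y : U n)⁆, F') ∈ d.pairSpan (p + 1) ∧
      ∀ ω : (Fin (p + 2) → Fin m) → ℝ, IsAntisymm ω → ∀ b,
        ⁅∑ c, ω c • d.nestE x c, d.xF b y⁆ =
          (-1 : ℝ) ^ (p + 1) • ∑ c, ω (Fin.cons b c) • F' c := by
  obtain ⟨G, hG, h2⟩ := exists_pair_triple hn (d.mem_pairSpan fun i => x i.succ) (x 0) y
  refine ⟨F + (-1 : ℝ) ^ (p + 1) • G, ?_, fun ω hω b => ?_⟩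
  · rw [nest_lower_eq]
    exact add_mem hF (Submodule.smul_mem _ _ hG)
  · have h3 : ∀ (a : Fin m) (c : Fin (p + 1) → Fin m),
        ⁅⁅d.xE a (x 0), d.nestE (fun i => x i.succ) c⁆, d.xF b y⁆ =
          ⁅d.xE a (x 0), ⁅d.nestE (fun i => x i.succ) c, d.xF b y⁆⁆ +
            ⁅⁅d.xE a (x 0), d.xF b y⁆, d.nestE (fun i => x i.succ) c⁆ := fun a c => by
      rw [lie_lie, ← lie_skew (d.nestE (fun i => x i.succ) c) ⁅d.xE a (x 0), d.xF b y⁆,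
        sub_neg_eq_add]
    have h4 : (-1 : ℝ) ^ (p + 1) * (-1 : ℝ) ^ (p + 1) = 1 := by
      rw [← mul_pow]; simp
    rw [sum_cons, sum_lie]
    simp only [sum_lie, smul_lie, nestE_cons, h3, smul_add, Finset.sum_add_distrib]
    rw [h ω hω, h2 ω hω]
    have h5 : ∑ c, ω (Fin.cons b c) • (F + (-1 : ℝ) ^ (p + 1) • G) c =
        ∑ c, ω (Fin.cons b c) • F c + (-1 : ℝ) ^ (p + 1) • ∑ c, ω (Fin.cons b c) • G c := by
      rw [Finset.smul_sum, ← Finset.sum_add_distrib]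
      refine Finset.sum_congr rfl fun c _ => ?_
      rw [Pi.add_apply, Pi.smul_apply, smul_add, smul_comm]
    rw [h5, smul_add, smul_smul, h4, one_smul]

theorem sum_fin_one {M : Type} [AddCommMonoid M] (f : (Fin (0 + 1) → Fin m) → M) :
    ∑ c, f c = ∑ a, f (Fin.cons a Fin.elim0) := by
  rw [sum_cons]
  refine Finset.sum_congr rfl fun a _ => ?_
  rw [Fintype.sum_subsingleton _ (Fin.elim0 : Fin 0 → Fin m)]

variable {d} in
-- In the Jacobi recursion the bracket with F_b gives either a triple bracket at the front, which
-- sets the first index to b, or a bracket deeper inside, which sets a later one. Antisymmetry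
-- brings that index to the front.
theorem exists_pair_lower (hn : 4 ≤ n) {p : ℕ} {w : U n × ((Fin (p + 2) → Fin m) → E r)}
    (h : w ∈ d.pairSpan (p + 2)) (y : levelU n 1) :
    ∃ F', (⁅w.1, (y : U n)⁆, F') ∈ d.pairSpan (p + 1) ∧
      ∀ ω : (Fin (p + 2) → Fin m) → ℝ, IsAntisymm ω → ∀ b,
        ⁅∑ c, ω c • w.2 c, d.xF b y⁆ = (-1 : ℝ) ^ (p + 1) • ∑ c, ω (Fin.cons b c) • F' c := by
  have main : ∀ x : Fin (p + 2) → levelU n (-1),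
      ∃ F', (⁅(nest (p + 2) fun i => (x i : U n)), (y : U n)⁆, F') ∈ d.pairSpan (p + 1) ∧
        ∀ ω : (Fin (p + 2) → Fin m) → ℝ, IsAntisymm ω → ∀ b,
          ⁅∑ c, ω c • d.nestE x c, d.xF b y⁆ =
            (-1 : ℝ) ^ (p + 1) • ∑ c, ω (Fin.cons b c) • F' c := by
    clear h w
    induction p with
    | zero =>
      intro x
      -- With two entries the inner part ⁅x_0, ⁅x_1, y⁆⁆ is minus the triple bracket with x_0 and
      -- x_1 interchanged. In E_r antisymmetry in the two indices compensates for the interchange.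
      obtain ⟨F, hF, h⟩ := exists_pair_triple hn (d.mem_pairSpan fun _ : Fin 1 => x 0) (x 1) y
      refine exists_pair_lower_of_first hn x y (F := -F) ?_ fun ω hω b => ?_
      · have h1 : ⁅(x 0 : U n), ⁅nest 1 fun i : Fin 1 => (x i.succ : U n), (y : U n)⁆⁆ =
            -⁅⁅(x 1 : U n), (y : U n)⁆, (x 0 : U n)⁆ :=
          even_skew (levelU_zero_even (bracket_mem_zero (x 1) y)) _
        rw [h1]
        exact neg_mem hF
      · have h0 : ∀ f : (Fin 1 → Fin m) → E r, ∑ c, f c = ∑ a, f (Fin.cons a Fin.elim0) :=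
          sum_fin_one
        have h1 := h ω hω b
        simp only [h0] at h1 ⊢
        rw [Finset.sum_comm] at h1
        simp only [Pi.neg_apply, smul_neg, Finset.sum_neg_distrib, zero_add, pow_one, neg_smul,
          one_smul, neg_neg]
        rw [← h1]
        refine Finset.sum_congr rfl fun a _ => Finset.sum_congr rfl fun c _ => ?_
        rw [hω.cons_cons a c, neg_smul, ← smul_neg, lie_skew]
        rfl
    | succ p ih =>
      intro x
      obtain ⟨F, hF, h⟩ := ih fun i => x i.succ
      refine exists_pair_lower_of_first hn x y (pair_cons hF (x 0)) fun ω hω b => ?_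
      have h1 : ∀ a, ∑ c : Fin (p + 2) → Fin m, ω (Fin.cons a c) •
          ⁅d.xE a (x 0), ⁅d.nestE (fun i => x i.succ) c, d.xF b y⁆⁆ =
          ⁅d.xE a (x 0), ⁅∑ c : Fin (p + 2) → Fin m, ω (Fin.cons a c) •
            d.nestE (fun i => x i.succ) c, d.xF b y⁆⁆ := fun a => by
        simp only [sum_lie, lie_sum, smul_lie, lie_smul]
      simp only [h1]
      simp only [h _ (hω.cons _)]
      rw [sum_cons (p := p + 1)]
      rw [Finset.smul_sum]
      refine Finset.sum_congr rfl fun a _ => ?_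
      have h2 : (-1 : ℝ) ^ (p + 1 + 1) = (-1) ^ (p + 1) * -1 := pow_succ _ _
      rw [lie_smul, lie_sum, h2, mul_smul]
      congr 1
      rw [neg_one_smul, ← Finset.sum_neg_distrib]
      refine Finset.sum_congr rfl fun c _ => ?_
      -- The tail has set its own first index to b, which is the second index overall. Moving it in
      -- front of a supplies the additional factor −1 from (−1)^(p+1) to (−1)^(p+2).
      rw [hω.cons_cons a b, lie_smul, neg_smul]
      rfl
  induction h using Submodule.span_induction with
  | zero =>
    exact ⟨0, by rw [Prod.fst_zero, zero_bracket]; exact zero_mem _, fun ω _ b => by simp⟩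
  | add u v _ _ h h' =>
    obtain ⟨F', h1, h2⟩ := h
    obtain ⟨G', h1', h2'⟩ := h'
    refine ⟨F' + G', by rw [Prod.fst_add, add_bracket]; exact add_mem h1 h1', fun ω hω b => ?_⟩
    simp only [Prod.snd_add, Pi.add_apply, add_lie, smul_add, Finset.sum_add_distrib]
    rw [h2 ω hω, h2' ω hω]
  | smul t u _ h =>
    obtain ⟨F', h1, h2⟩ := h
    refine ⟨t • F', by rw [Prod.smul_fst, smul_bracket]; exact Submodule.smul_mem _ t h1,
      fun ω hω b => ?_⟩
    simp only [Prod.smul_snd, Pi.smul_apply, smul_lie, smul_comm _ t, ← Finset.smul_sum]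
    rw [h2 ω hω]
  | mem w hw =>
    obtain ⟨x, rfl⟩ := hw
    exact main x

/-- The exponents p + 1, p, … collected by successive lowerings add up to the binomial coefficient
in claim 1. -/
theorem choose_sign (p : ℕ) : (p + 2) * (p + 1) / 2 = (p + 1) + (p + 1) * p / 2 := by
  have h1 : (p + 2) * (p + 1) = (p + 1) * p + (p + 1) * 2 := by ring
  rw [h1, Nat.add_mul_div_right _ _ two_pos, add_comm]

variable {d} in
/-- The inner products of antisymmetrized nested brackets. -/
theorem formE_antisymm (hn : 4 ≤ n) {p : ℕ} {w : U n × ((Fin (p + 1) → Fin m) → E r)}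
    (h : w ∈ d.pairSpan (p + 1)) {ω : (Fin (p + 1) → Fin m) → ℝ} (hω : IsAntisymm ω)
    (y : Fin (p + 1) → levelU n 1) (b : Fin (p + 1) → Fin m) :
    d.formE (∑ c, ω c • w.2 c) (nest (p + 1) fun i => d.xF (b i) (y i)) =
      (-1) ^ ((p + 1) * p / 2) * ω b * d.formU w.1 (nest (p + 1) fun i => (y i : U n)) := by
  induction p with
  | zero =>
    clear hω
    simp only [nest, zero_add, mul_zero, Nat.zero_div, pow_zero, one_mul]
    induction h using Submodule.span_induction with
    | zero => simp
    | add u v _ _ h h' =>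
      simp only [Prod.snd_add, Prod.fst_add, Pi.add_apply, smul_add, Finset.sum_add_distrib,
        map_add, LinearMap.add_apply, h, h']
      ring
    | smul t u _ h =>
      simp only [Prod.smul_snd, Prod.smul_fst, Pi.smul_apply, smul_comm _ t, ← Finset.smul_sum,
        map_smul, LinearMap.smul_apply, h, smul_eq_mul]
      ring
    | mem w hw =>
      obtain ⟨x, rfl⟩ := hw
      have hb : b = Fin.cons (b 0) Fin.elim0 := by
        funext i
        rw [Fin.fin_one_eq_zero i]
        rfl
      rw [sum_fin_one]
      simp only [nestE, nest, Fin.cons_zero, map_sum, map_smul, LinearMap.sum_apply,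
        LinearMap.smul_apply, d.dual, smul_eq_mul]
      rw [Finset.sum_eq_single (b 0)]
      · rw [if_pos rfl, ← hb]
      · intro a _ ha
        rw [if_neg ha, mul_zero]
      · simp
  | succ p ih =>
    -- Invariance moves the first level 1 entry to the left argument in both algebras; lowering then
    -- fixes the first index to b_0 and the induction hypothesis applies to the remaining ones.
    obtain ⟨F, hF, h1⟩ := exists_pair_lower hn h (y 0)
    rw [nest_succ_succ, nest_succ_succ, ← d.formE_standard.invariant,
      ← d.formU_standard.invariant, h1 ω hω, map_smul, LinearMap.smul_apply,
      ih hF (hω.cons (b 0)) (fun i => y i.succ) fun i => b i.succ, smul_eq_mul, choose_sign, pow_add]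
    have hb : (Fin.cons (b 0) fun i : Fin (p + 1) => b i.succ) = b := Fin.cons_self_tail b
    rw [hb]
    ring

end LevelDecomposition

end Antisymmetrized

end TensorHierarchy
end

noncomputable section
set_option linter.unusedSectionVars false
namespace TensorHierarchy
open scoped TensorProduct

/-! ### Elements of the exterior power as antisymmetric tensors -/

section Exterior

variable {p m : ℕ}

/-- The components of an element of `Λ^p ℝ^m`, with total weight one. -/
def components (p m : ℕ) : ⋀[ℝ]^p (Fin m → ℝ) →ₗ[ℝ] (Fin p → Fin m) → ℝ :=
  LinearMap.pi fun c => (p.factorial : ℝ)⁻¹ •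
    exteriorPower.alternatingMapToDual ℝ (Fin m → ℝ) p fun j => LinearMap.proj (c j)

theorem components_apply (w : ⋀[ℝ]^p (Fin m → ℝ)) (c : Fin p → Fin m) :
    components p m w c = (p.factorial : ℝ)⁻¹ *
      exteriorPower.alternatingMapToDual ℝ (Fin m → ℝ) p (fun j => LinearMap.proj (c j)) w := rfl

theorem components_antisymm (w : ⋀[ℝ]^p (Fin m → ℝ)) : IsAntisymm (components p m w) := by
  intro i j hij c
  rw [components_apply, components_apply, ← mul_neg]
  congr 1
  have := (exteriorPower.alternatingMapToDual ℝ (Fin m → ℝ) p).map_swap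
    (fun j => (LinearMap.proj (c j) : Module.Dual ℝ (Fin m → ℝ))) hij
  exact LinearMap.congr_fun this w

/-- The wedge product of standard basis vectors. -/
def wedge (a : Fin p → Fin m) : ⋀[ℝ]^p (Fin m → ℝ) :=
  exteriorPower.ιMulti ℝ p fun i => Pi.single (a i) (1 : ℝ)

theorem components_wedge (a : Fin p → Fin m) : components p m (wedge a) = antisymDelta a := by
  funext c
  rw [components_apply, wedge, exteriorPower.alternatingMapToDual_apply_ιMulti, antisymDelta,
    Matrix.det_apply']
  congr 1
  refine Finset.sum_congr rfl fun σ _ => ?_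
  congr 1
  refine Finset.prod_congr rfl fun i _ => ?_
  simp [Pi.single_apply, eq_comm]

/-- Up to the factor p!, the components at increasing tuples are the coordinates in the standard
basis of the exterior power. -/
theorem components_injective : Function.Injective (components p m) := by
  rw [← LinearMap.ker_eq_bot, LinearMap.ker_eq_bot']
  intro w hw
  rw [← ((Pi.basisFun ℝ (Fin m)).exteriorPower p).forall_coord_eq_zero_iff]
  intro s
  rw [exteriorPower.basis_coord]
  have h := congrFun hw (Set.powersetCard.ofFinEmbEquiv.symm s)
  rw [components_apply] at h
  have hp : (p.factorial : ℝ)⁻¹ ≠ 0 := inv_ne_zero (by exact_mod_cast p.factorial_ne_zero)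
  have h2 := (mul_eq_zero.1 h).resolve_left hp
  rw [← h2]
  simp only [exteriorPower.ιMultiDual, exteriorPower.ιMulti_family, exteriorPower.pairingDual,
    exteriorPower.alternatingMapLinearEquiv_apply_ιMulti]
  congr 2

theorem span_wedge : Submodule.span ℝ (Set.range (wedge (p := p) (m := m))) = ⊤ := by
  rw [eq_top_iff, ← exteriorPower.ιMulti_family_span_of_span ℝ (Pi.basisFun ℝ (Fin m)).span_eq]
  refine Submodule.span_mono ?_
  rintro _ ⟨s, rfl⟩
  refine ⟨Set.powersetCard.ofFinEmbEquiv.symm s, ?_⟩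
  rw [wedge, exteriorPower.ιMulti_family]
  congr 1
  funext i
  simp

theorem antisymDelta_antisymm (a : Fin p → Fin m) : IsAntisymm (antisymDelta a) := by
  rw [← components_wedge]
  exact components_antisymm _

theorem antisymDelta_self {a : Fin p → Fin m} (ha : Function.Injective a) :
    antisymDelta a a ≠ 0 := by
  rw [antisymDelta, Finset.sum_eq_single 1]
  · simp [p.factorial_ne_zero]
  · intro σ _ hσ
    obtain ⟨i, hi⟩ : ∃ i, σ i ≠ i := by
      by_contra! h
      exact hσ (Equiv.ext h)
    rw [Finset.prod_eq_zero (Finset.mem_univ i) (if_neg fun h => hi (ha h)), mul_zero]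
  · simp

/-- Converts the sum over permutations into a contraction with an antisymmetric tensor, the form in
which the lowering results are proved. -/
theorem sum_antisymDelta {M : Type} [AddCommGroup M] [Module ℝ M] (a : Fin p → Fin m)
    (G : (Fin p → Fin m) → M) : ∑ c, antisymDelta a c • G c =
      (p.factorial : ℝ)⁻¹ • ∑ σ : Equiv.Perm (Fin p),
        ((Equiv.Perm.sign σ : ℤ) : ℝ) • G fun i => a (σ i) := by
  simp only [antisymDelta, mul_smul, Finset.sum_smul, ← Finset.smul_sum]
  congr 1
  rw [Finset.sum_comm]
  refine Finset.sum_congr rfl fun σ _ => ?_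
  rw [← Finset.smul_sum, Finset.sum_eq_single fun i => a (σ i)]
  · simp
  · intro c _ hc
    obtain ⟨i, hi⟩ : ∃ i, a (σ i) ≠ c i := by
      by_contra! h
      exact hc (funext fun i => (h i).symm)
    rw [Finset.prod_eq_zero (Finset.mem_univ i) (if_neg hi), zero_smul]
  · simp

end Exterior

/-! ### The antisymmetric part -/

/-- A relation that is total and single-valued on the relevant part defines a linear map. -/
theorem exists_linearMap_of_relation {U F W : Type} [AddCommGroup U] [Module ℝ U]
    [AddCommGroup F] [Module ℝ F] [AddCommGroup W] [Module ℝ W] (P : Submodule ℝ (U × F))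
    (S : Submodule ℝ U) (φ : F →ₗ[ℝ] W) (hS : ∀ X ∈ S, ∃ G, (X, G) ∈ P)
    (h : ∀ G, (0, G) ∈ P → φ G = 0) :
    ∃ T : S →ₗ[ℝ] W, ∀ (X : S) (G : F), ((X : U), G) ∈ P → T X = φ G := by
  have huniq : ∀ X G G', (X, G) ∈ P → (X, G') ∈ P → φ G = φ G' := by
    intro X G G' hG hG'
    rw [← sub_eq_zero, ← map_sub]
    refine h _ ?_
    have := sub_mem hG hG'
    rwa [Prod.mk_sub_mk, sub_self] at this
  choose! g hg using hS
  refine ⟨{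
    toFun := fun X => φ (g X)
    map_add' := fun X Y => ?_
    map_smul' := fun t X => ?_ }, fun X G hG => huniq _ _ _ (hg X X.2) hG⟩
  · rw [← map_add]
    exact huniq _ _ _ (hg _ (X + Y).2) (add_mem (hg X X.2) (hg Y Y.2))
  · rw [RingHom.id_apply, ← map_smul]
    exact huniq _ _ _ (hg _ (t • X).2) (Submodule.smul_mem _ t (hg X X.2))

section AntisymmetricPart

variable {n m r : ℕ} {hm : 1 ≤ m} {hr : m + n = r} (d : LevelDecomposition hm hr)

namespace LevelDecomposition

theorem antisymE_eq {p : ℕ} (x : Fin p → levelU n (-1)) (a : Fin p → Fin m) :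
    d.antisymE x a = ∑ c, antisymDelta a c • d.nestE x c := (sum_antisymDelta a (d.nestE x)).symm

theorem formE_antisymE (hn : 4 ≤ n) {p : ℕ} (hp : 1 ≤ p) (x : Fin p → levelU n (-1))
    (a : Fin p → Fin m) (y : Fin p → levelU n 1) (b : Fin p → Fin m) :
    (p.factorial : ℝ)⁻¹ * ∑ σ : Equiv.Perm (Fin p),
        ((Equiv.Perm.sign σ : ℤ) : ℝ) * d.hTensor x (a ∘ σ) y b =
      (-1) ^ (p * (p - 1) / 2) * antisymDelta a b * d.fTensor x y := by
  obtain ⟨p, rfl⟩ : ∃ q, p = q + 1 := ⟨p - 1, by omega⟩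
  have h := formE_antisymm hn (d.mem_pairSpan x) (antisymDelta_antisymm a) y b
  rw [← antisymE_eq] at h
  simp only [antisymE, map_smul, map_sum, LinearMap.smul_apply, LinearMap.sum_apply,
    smul_eq_mul] at h
  exact h

theorem eq_zero_of_formU {p : ℕ} (hp : 1 ≤ p) {X : U n} (hX : X ∈ levelU n (-p))
    (h : ∀ y : Fin p → levelU n 1, d.formU X (nest p fun i => (y i : U n)) = 0) : X = 0 :=
  d.formU_standard.eq_zero isNone_odd (cartanU_symm n) hp hX fun y hy => h fun i => ⟨y i, hy i⟩

/-- Level 1 of E_r is the sum of the ranges of the `xF b`, so by multilinearity every nested bracket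
is a sum of those of the stated form. -/
theorem eq_zero_of_formE {p : ℕ} (hp : 1 ≤ p) {X : E r} (hX : X ∈ levelE hm hr (-p))
    (h : ∀ (y : Fin p → levelU n 1) (b : Fin p → Fin m),
      d.formE X (nest p fun i => d.xF (b i) (y i)) = 0) : X = 0 := by
  refine d.formE_standard.eq_zero (fun _ _ => rfl) (cartanE_symm r) hp hX fun y hy => ?_
  have h1 : ∀ i, ∃ Y : Fin m → levelU n 1, ∑ a, d.xF a (Y a) = y i := fun i => by
    have := hy i
    rw [← SetLike.mem_coe, ← d.xF_range] at this
    exact this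
  choose Y hY using h1
  obtain rfl : y = fun i => ∑ a, d.xF a (Y i a) := funext fun i => (hY i).symm
  have h2 := (nestMultilinear (cartanE r) (fun _ => false) p).map_sum fun i a => d.xF a (Y i a)
  have h3 : nest p (fun i => ∑ a, d.xF a (Y i a)) =
      ∑ b : Fin p → Fin m, nest p fun i => d.xF (b i) (Y i (b i)) := h2
  rw [h3, map_sum]
  exact Finset.sum_eq_zero fun b _ => h _ _

theorem pairSpan_level {p : ℕ} {w : U n × ((Fin p → Fin m) → E r)} (hw : w ∈ d.pairSpan p)
    (c : Fin p → Fin m) : w.2 c ∈ levelE hm hr (-p) := by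
  induction hw using Submodule.span_induction with
  | zero => exact zero_mem _
  | add u v _ _ hu hv => exact add_mem hu hv
  | smul t u _ hu => exact Submodule.smul_mem _ t hu
  | mem w hw =>
    obtain ⟨x, rfl⟩ := hw
    have := nest_mem_level _ _ (nodeL hm hr) (-1) p (fun i => d.xE (c i) (x i))
      fun i => d.xE_mem _ _
    rwa [mul_neg_one] at this

/-- The Leibniz rule on both sides, together with equivariance of `xE`, replaces one entry at a time
in the two algebras simultaneously. -/
theorem pair_act {p : ℕ} (z : E n) {w : U n × ((Fin p → Fin m) → E r)} (hw : w ∈ d.pairSpan p) :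
    (⁅d.enU z, w.1⁆, fun c => ⁅d.enE z, w.2 c⁆) ∈ d.pairSpan p := by
  induction hw using Submodule.span_induction with
  | zero =>
    convert zero_mem (d.pairSpan p) using 1
    exact Prod.ext (bracket_zero _) (funext fun c => lie_zero _)
  | add u v _ _ hu hv =>
    convert add_mem hu hv using 1
    exact Prod.ext (bracket_add _ _ _) (funext fun c => lie_add _ _ _)
  | smul t u _ hu =>
    convert Submodule.smul_mem _ t hu using 1
    exact Prod.ext (bracket_smul _ _ _) (funext fun c => lie_smul t (d.enE z) (u.2 c))
  | mem w hw =>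
    obtain ⟨x, rfl⟩ := hw
    have h := sum_mem (t := Finset.univ) fun k _ =>
      d.mem_pairSpan (Function.update x k (d.act _ z (x k)))
    convert h using 1
    refine Prod.ext ?_ ?_
    · rw [Prod.fst_sum]
      simp only [coe_update]
      exact nest_leibniz (levelU_zero_even (d.enU_mem z)) p _
    · rw [Prod.snd_sum]
      funext c
      rw [Finset.sum_apply]
      simp only [nestE_update, ← bracket_xE]
      exact nest_leibniz (parityPart_false_eq_top _ _) p _

theorem span_nestU {p : ℕ} (hp : 1 ≤ p) :
    Submodule.span ℝ (Set.range (nestU (n := n) (p := p))) = ⊤ := by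
  refine eq_top_iff.2 fun X _ => ?_
  have h1 : levelU n (-p) ≤
      (Submodule.span ℝ (Set.range (nestU (n := n) (p := p)))).map (levelU n (-p)).subtype := by
    refine (level_neg_le_nestSpan isNone_odd hp).trans (Submodule.span_le.2 ?_)
    rintro _ ⟨x, hx, rfl⟩
    exact ⟨nestU fun i => ⟨x i, hx i⟩, Submodule.subset_span ⟨_, rfl⟩, rfl⟩
  obtain ⟨Y, hY, hYX⟩ := h1 X.2
  rwa [← Subtype.ext hYX]

theorem exists_mem_pairSpan {p : ℕ} (hp : 1 ≤ p) (X : levelU n (-p)) :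
    ∃ F, ((X : U n), F) ∈ d.pairSpan p := by
  have h1 : levelU n (-p) ≤ (d.pairSpan p).map (LinearMap.fst ℝ _ _) := by
    refine (level_neg_le_nestSpan isNone_odd hp).trans (Submodule.span_le.2 ?_)
    rintro _ ⟨x, hx, rfl⟩
    exact ⟨_, d.mem_pairSpan fun i => ⟨x i, hx i⟩, rfl⟩
  obtain ⟨⟨Y, F⟩, hF, hY⟩ := h1 X.2
  exact ⟨F, hY ▸ hF⟩

/-- The map `(X, w) ↦ X^w` from `s_p × Λ^p ℝ^m` to `E_r`. -/
theorem exists_antisymMap (hn : 4 ≤ n) {p : ℕ} (hp : 1 ≤ p) :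
    ∃ T : levelU n (-p) →ₗ[ℝ] ⋀[ℝ]^p (Fin m → ℝ) →ₗ[ℝ] E r,
      ∀ (X : levelU n (-p)) (F : (Fin p → Fin m) → E r), ((X : U n), F) ∈ d.pairSpan p →
        ∀ w, T X w = ∑ c, components p m w c • F c := by
  let φ : ((Fin p → Fin m) → E r) →ₗ[ℝ] ⋀[ℝ]^p (Fin m → ℝ) →ₗ[ℝ] E r :=
    ∑ c, (LinearMap.smulRightₗ (LinearMap.proj c ∘ₗ components p m)) ∘ₗ LinearMap.proj c
  have hφ : ∀ F w, φ F w = ∑ c, components p m w c • F c := fun F w => by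
    simp [φ, LinearMap.sum_apply]
  obtain ⟨T, hT⟩ := exists_linearMap_of_relation (d.pairSpan p) (levelU n (-p)) φ
    (fun X hX => d.exists_mem_pairSpan hp ⟨X, hX⟩)
    -- Single-valuedness: a family related to 0 in U_{n+1} has, after antisymmetrization, pairing a
    -- multiple of ⟨0|·⟩ = 0 with every nested bracket of level p in E_r, so it vanishes by
    -- nondegeneracy.
    (fun F hF => by
      refine LinearMap.ext fun w => ?_
      rw [hφ, LinearMap.zero_apply]
      refine d.eq_zero_of_formE hp (sum_mem fun c _ => Submodule.smul_mem _ _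
        (d.pairSpan_level hF c)) fun y b => ?_
      obtain ⟨p, rfl⟩ : ∃ q, p = q + 1 := ⟨p - 1, by omega⟩
      exact (formE_antisymm hn hF (components_antisymm w) y b).trans (by simp))
  exact ⟨T, fun X F hF w => by rw [hT X F hF, hφ]⟩

end LevelDecomposition

end AntisymmetricPart

end TensorHierarchy
end

noncomputable section
set_option linter.unusedSectionVars false
namespace TensorHierarchy
open scoped TensorProduct

/-! ### The isomorphisms onto t_p and onto the antisymmetric part -/

section Isomorphisms

variable {n m r : ℕ} {hm : 1 ≤ m} {hr : m + n = r} (d : LevelDecomposition hm hr)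

namespace LevelDecomposition

variable {p : ℕ} {T : levelU n (-p) →ₗ[ℝ] ⋀[ℝ]^p (Fin m → ℝ) →ₗ[ℝ] E r}

/-- The defining property of the map `(X, w) ↦ X^w`. -/
def IsAntisymMap (T : levelU n (-p) →ₗ[ℝ] ⋀[ℝ]^p (Fin m → ℝ) →ₗ[ℝ] E r) : Prop :=
  ∀ (X : levelU n (-p)) (F : (Fin p → Fin m) → E r), ((X : U n), F) ∈ d.pairSpan p →
    ∀ w, T X w = ∑ c, components p m w c • F c

variable {d}

theorem IsAntisymMap.apply_wedge (hT : d.IsAntisymMap T) (x : Fin p → levelU n (-1))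
    (a : Fin p → Fin m) : T (nestU x) (wedge a) = d.antisymE x a := by
  rw [hT _ _ (d.mem_pairSpan x), components_wedge, d.antisymE_eq]

theorem IsAntisymMap.formE_apply (hT : d.IsAntisymMap T) (hn : 4 ≤ n) (hp : 1 ≤ p)
    (X : levelU n (-p)) (w : ⋀[ℝ]^p (Fin m → ℝ)) (y : Fin p → levelU n 1) (b : Fin p → Fin m) :
    d.formE (T X w) (nest p fun i => d.xF (b i) (y i)) =
      (-1) ^ (p * (p - 1) / 2) * components p m w b *
        d.formU X (nest p fun i => (y i : U n)) := by
  obtain ⟨F, hF⟩ := d.exists_mem_pairSpan hp X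
  rw [hT X F hF]
  obtain ⟨p, rfl⟩ : ∃ q, p = q + 1 := ⟨p - 1, by omega⟩
  exact formE_antisymm hn hF (components_antisymm w) y b

theorem IsAntisymMap.equivariant (hT : d.IsAntisymMap T) (hp : 1 ≤ p) (z : E n)
    (X : levelU n (-p)) (w : ⋀[ℝ]^p (Fin m → ℝ)) : T (d.actS p z X) w = ⁅d.enE z, T X w⁆ := by
  obtain ⟨F, hF⟩ := d.exists_mem_pairSpan hp X
  rw [hT X F hF, hT (d.actS p z X) _ (d.pair_act z hF), lie_sum]
  exact Finset.sum_congr rfl fun c _ => (lie_smul _ _ _).symm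

theorem IsAntisymMap.range_flip (hT : d.IsAntisymMap T) (hp : 1 ≤ p) (a : Fin p → Fin m) :
    LinearMap.range (T.flip (wedge a)) = d.tRep a := by
  rw [LinearMap.range_eq_map, ← span_nestU hp, Submodule.map_span, ← Set.range_comp, tRep]
  congr 1
  ext w
  exact exists_congr fun x => by
    rw [Function.comp_apply, LinearMap.flip_apply, hT.apply_wedge, eq_comm]

/-- Pairing with the same lower indices a produces the factor δ^[a]_a, which is nonzero because the
a_i are distinct. So the kernel lies in the radical of the form of U_{n+1}. -/
theorem IsAntisymMap.injective_flip (hT : d.IsAntisymMap T) (hn : 4 ≤ n) (hp : 1 ≤ p)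
    {a : Fin p → Fin m} (ha : Function.Injective a) : Function.Injective (T.flip (wedge a)) := by
  rw [← LinearMap.ker_eq_bot, LinearMap.ker_eq_bot']
  intro X hX
  rw [LinearMap.flip_apply] at hX
  refine Subtype.ext (d.eq_zero_of_formU hp X.2 fun y => ?_)
  have h := hT.formE_apply hn hp X (wedge a) y a
  rw [hX, map_zero, LinearMap.zero_apply, components_wedge] at h
  exact (mul_eq_zero.1 h.symm).resolve_left
    (mul_ne_zero (pow_ne_zero _ (by norm_num)) (antisymDelta_self ha))

theorem IsAntisymMap.range_lift (hT : d.IsAntisymMap T) (hp : 1 ≤ p) :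
    LinearMap.range (TensorProduct.lift T) = d.antisymPart p := by
  refine le_antisymm ?_ (Submodule.span_le.2 ?_)
  · rw [LinearMap.range_eq_map, ← TensorProduct.span_tmul_eq_top, Submodule.map_span,
      Submodule.span_le]
    rintro _ ⟨_, ⟨X, w, rfl⟩, rfl⟩
    rw [TensorProduct.lift.tmul, SetLike.mem_coe]
    have hX : X ∈ Submodule.span ℝ (Set.range (nestU (n := n) (p := p))) := by
      rw [span_nestU hp]; trivial
    have hw : w ∈ Submodule.span ℝ (Set.range (wedge (p := p) (m := m))) := by
      rw [span_wedge]; trivial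
    have h := Submodule.apply_mem_map₂ T hX hw
    rw [Submodule.map₂_span_span] at h
    refine Submodule.span_mono ?_ h
    rintro _ ⟨_, ⟨x, rfl⟩, _, ⟨a, rfl⟩, rfl⟩
    exact ⟨x, a, hT.apply_wedge x a⟩
  · rintro _ ⟨x, a, rfl⟩
    exact ⟨nestU x ⊗ₜ wedge a, by rw [TensorProduct.lift.tmul, hT.apply_wedge]⟩

/-- The tensor is expanded in the standard basis of the exterior power. Since the pairings
factorize, a zero image means that for each y the combination of basis vectors with coefficients
⟨X_s|y⟩ has zero components. Linear independence and nondegeneracy on U_{n+1} then give X_s = 0. -/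
theorem IsAntisymMap.eq_zero_of_lift_eq_zero (hT : d.IsAntisymMap T) (hn : 4 ≤ n) (hp : 1 ≤ p)
    {t : levelU n (-p) ⊗[ℝ] ⋀[ℝ]^p (Fin m → ℝ)} (ht : TensorProduct.lift T t = 0) : t = 0 := by
  let ℬ := (Pi.basisFun ℝ (Fin m)).exteriorPower p
  obtain ⟨X, rfl⟩ := TensorProduct.eq_repr_basis_right ℬ t
  suffices h : X = 0 by rw [h, Finsupp.sum_zero_index]
  have hX (y : Fin p → levelU n 1) :
      ∑ s ∈ X.support, d.formU (X s) (nest p fun i => (y i : U n)) • ℬ s = 0 := by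
    refine components_injective (funext fun b => ?_)
    have h := congrArg (fun Z => d.formE Z (nest p fun i => d.xF (b i) (y i))) ht
    simp only [Finsupp.sum, map_sum, TensorProduct.lift.tmul, LinearMap.sum_apply,
      hT.formE_apply hn hp, map_zero, LinearMap.zero_apply] at h
    simp only [mul_assoc, ← Finset.mul_sum] at h
    have h2 := (mul_eq_zero.1 h).resolve_left (pow_ne_zero _ (by norm_num))
    rw [map_sum, Finset.sum_apply, map_zero, Pi.zero_apply, ← h2]
    exact Finset.sum_congr rfl fun s _ => by rw [map_smul, Pi.smul_apply, smul_eq_mul, mul_comm]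
  refine Finsupp.ext fun s => ?_
  by_contra hs
  refine hs (Subtype.ext (d.eq_zero_of_formU hp (X s).2 fun y => ?_))
  exact linearIndependent_iff'.1 ℬ.linearIndependent _ _ (hX y) s (Finsupp.mem_support_iff.2 hs)

theorem IsAntisymMap.injective_lift (hT : d.IsAntisymMap T) (hn : 4 ≤ n) (hp : 1 ≤ p) :
    Function.Injective (TensorProduct.lift T) := by
  intro t t' h
  have h0 : t + (-1 : ℝ) • t' = 0 := hT.eq_zero_of_lift_eq_zero hn hp (by
    rw [map_add, map_smul, h, neg_one_smul, add_neg_cancel])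
  calc t = t + ((-1 : ℝ) + 1) • t' := by rw [neg_add_cancel, zero_smul, add_zero]
    _ = t' := by rw [add_smul, ← add_assoc, h0, one_smul, zero_add]

theorem exists_equiv_tRep (d : LevelDecomposition hm hr) (hn : 4 ≤ n) (hp : 1 ≤ p)
    {a : Fin p → Fin m} (ha : Function.Injective a) :
    ∃ Φ : levelU n (-p) ≃ₗ[ℝ] d.tRep a,
      (∀ x : Fin p → levelU n (-1), (Φ (nestU x) : E r) = d.antisymE x a) ∧
      ∀ (z : E n) (v : levelU n (-p)), (Φ (d.actS p z v) : E r) = ⁅d.enE z, (Φ v : E r)⁆ := by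
  obtain ⟨T, hT : d.IsAntisymMap T⟩ := d.exists_antisymMap hn hp
  exact ⟨(LinearEquiv.ofInjective _ (hT.injective_flip hn hp ha)).trans
    (LinearEquiv.ofEq _ _ (hT.range_flip hp a)), fun x => hT.apply_wedge x a,
    fun z v => hT.equivariant hp z v _⟩

theorem exists_equiv_antisymPart (d : LevelDecomposition hm hr) (hn : 4 ≤ n) (hp : 1 ≤ p) :
    ∃ Ψ : (levelU n (-p) ⊗[ℝ] ⋀[ℝ]^p (Fin m → ℝ)) ≃ₗ[ℝ] d.antisymPart p,
      (∀ (x : Fin p → levelU n (-1)) (a : Fin p → Fin m),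
        (Ψ (nestU x ⊗ₜ exteriorPower.ιMulti ℝ p fun i => Pi.single (a i) (1 : ℝ)) : E r) =
          d.antisymE x a) ∧
      ∀ (z : E n) (v : levelU n (-p)) (w : ⋀[ℝ]^p (Fin m → ℝ)),
        (Ψ (d.actS p z v ⊗ₜ w) : E r) = ⁅d.enE z, (Ψ (v ⊗ₜ w) : E r)⁆ := by
  obtain ⟨T, hT : d.IsAntisymMap T⟩ := d.exists_antisymMap hn hp
  exact ⟨(LinearEquiv.ofInjective _ (hT.injective_lift hn hp)).trans
    (LinearEquiv.ofEq _ _ (hT.range_lift hp)), fun x a => hT.apply_wedge x a,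
    fun z v w => hT.equivariant hp z v w⟩

end LevelDecomposition

end Isomorphisms

end TensorHierarchy
end

open TensorHierarchy TensorProduct in
theorem mainTheorem3 (D n m r : ℕ) (hD3 : 3 ≤ D) (hD7 : D ≤ 7) (hn : D + n = 11)
    (hm : 1 ≤ m) (hmD : m + 11 = D + r) (hr : m + n = r) :
    Nonempty (LevelDecomposition hm hr) ∧
    ∀ d : LevelDecomposition hm hr,
      (∀ (p : ℕ), 1 ≤ p → ∀ (x : Fin p → levelU n (-1)) (a : Fin p → Fin m)
        (y : Fin p → levelU n 1) (b : Fin p → Fin m),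
        (p.factorial : ℝ)⁻¹ * ∑ σ : Equiv.Perm (Fin p),
            ((Equiv.Perm.sign σ : ℤ) : ℝ) * d.hTensor x (a ∘ σ) y b =
          (-1) ^ (p * (p - 1) / 2) * antisymDelta a b * d.fTensor x y) ∧
      (∀ (p : ℕ), 1 ≤ p → p ≤ m →
        (∀ a : Fin p → Fin m, Function.Injective a →
          ∃ Φ : levelU n (-p) ≃ₗ[ℝ] d.tRep a,
            (∀ x : Fin p → levelU n (-1), (Φ (nestU x) : E r) = d.antisymE x a) ∧
            ∀ (z : E n) (v : levelU n (-p)), (Φ (d.actS p z v) : E r) = ⁅d.enE z, (Φ v : E r)⁆) ∧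
        ∃ Ψ : (levelU n (-p) ⊗[ℝ] ⋀[ℝ]^p (Fin m → ℝ)) ≃ₗ[ℝ] d.antisymPart p,
          (∀ (x : Fin p → levelU n (-1)) (a : Fin p → Fin m),
            (Ψ (nestU x ⊗ₜ exteriorPower.ιMulti ℝ p fun i => Pi.single (a i) (1 : ℝ)) : E r) =
              d.antisymE x a) ∧
          ∀ (z : E n) (v : levelU n (-p)) (w : ⋀[ℝ]^p (Fin m → ℝ)),
            (Ψ (d.actS p z v ⊗ₜ w) : E r) = ⁅d.enE z, (Ψ (v ⊗ₜ w) : E r)⁆) := by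
  -- From D ≤ 7; this keeps the branching node of E_r inside E_n.
  have hn4 : 4 ≤ n := by omega
  exact ⟨nonempty_levelDecomposition hn4 hm hr, fun d =>
    ⟨fun p hp x a y b => d.formE_antisymE hn4 hp x a y b, fun p hp _ =>
      ⟨fun a ha => d.exists_equiv_tRep hn4 hp ha, d.exists_equiv_antisymPart hn4 hp⟩⟩⟩
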